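/- For a C*-algebra $A$ (unital or not) and $a,b\in A$ write $a\sim_{\mathrm{Tr}}b$ if $a-b\in\overline{[A,A]}$, the closed linear span of the elements $xy-yx$ with $x,y\in A$. If $A$ is unital, let $\mathrm U^0(A)$ be the connected component of $1$ in the unitary group $\mathrm U(A)$. If $A$ is not unital, let $A^\sim$ be its unitization, let $\mathrm U^0(A)$ be the group of those unitaries in the connected component of $1$ in $\mathrm U(A^\sim)$ that are of the form $1+x$ with $x\in A$, and let the exponentials $e^{ih}$, for $h\in A_{\mathrm{sa}}$, be taken in $A^\sim$. For $v,w\in \mathrm U^0(A)$ write $(v,w)=vwv^{-1}w^{-1}$. **Theorem.** Let $A$ be a C*-algebra of nuclear dimension at most $1$ (in the sense of Winter and Zacharias). Let $k\ge 1$ and let $u\in\mathrm U^0(A)$ be of the form $u=e^{ih_1}e^{ih_2}\cdots e^{ih_k}$, where $h_j\in A_{\mathrm{sa}}$ for $j=1,\dots,k$ and $\sum_{j=1}^k h_j\sim_{\mathrm{Tr}}0$. Then for each $\epsilon>0$ there exist $v_j,w_j\in\mathrm U^0(A)$, $j=1,\dots,5k-1$, and $c\in A_{\mathrm{sa}}$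 such that \[ u=\prod_{j=1}^{5k-1}(v_j,w_j)\cdot e^{ic},\qquad c\sim_{\mathrm{Tr}}0,\qquad \|c\|<\epsilon . \] -/

import Mathlib

open scoped CStarAlgebra

namespace CommutatorProducts

noncomputable section

/-! ### The universal trace -/

/-- The closed linear span of the additive commutators `x * y - y * x` in `A`. -/
def closedCommutatorSpan (A : Type*) [NonUnitalCStarAlgebra A] : Submodule ℂ A :=
  (Submodule.span ℂ {z : A | ∃ x y : A, z = x * y - y * x}).topologicalClosure

/-- The universal trace `Tr`, i.e. the quotient map from `A` onto the quotient of `A` by the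
closed linear span of its additive commutators. -/
def universalTrace (A : Type*) [NonUnitalCStarAlgebra A] :
    A →ₗ[ℂ] A ⧸ closedCommutatorSpan A :=
  (closedCommutatorSpan A).mkQ

/-- The relation `a ∼_Tr b`, meaning `Tr (a - b) = 0`. -/
def TrEquiv {A : Type*} [NonUnitalCStarAlgebra A] (a b : A) : Prop :=
  universalTrace A (a - b) = 0

/-! ### Nuclear dimension -/

/-- A completely positive map has order zero if it sends orthogonal positive elements to
orthogonal elements. (For positive `a`, `b`, orthogonality means `a * b = 0`.) -/
def IsOrderZero {A B : Type*} [NonUnitalCStarAlgebra A] [NonUnitalCStarAlgebra B]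
    [PartialOrder A] [StarOrderedRing A] [PartialOrder B] [StarOrderedRing B]
    (φ : A →CP B) : Prop :=
  ∀ a b : A, 0 ≤ a → 0 ≤ b → a * b = 0 → φ a * φ b = 0

/-- `A` has nuclear dimension at most `n` (Winter and Zacharias): for every finite set `S` in `A`
and every `ε > 0` there are a finite-dimensional C*-algebra `F = F 0 ⊕ ⋯ ⊕ F n`, a completely
positive contractive map `ψ : A → F` and a completely positive map `φ : F → A` whose restriction
to each `F i` is contractive of order zero, such that `‖φ (ψ a) - a‖ < ε` for all `a ∈ S`.

The maps `ψ` and `φ` are given by their components `ψ i : A → F i` and `φ i : F i → A`, so that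
`φ (ψ a) = ∑ i, φ i (ψ i a)`. Finite-dimensional C*-algebras are automatically unital, and each is
isomorphic to one whose underlying type lies in `Type`. The order in a `StarOrderedRing` that is a
C*-algebra is the usual one. -/
def NuclearDimensionAtMost (n : ℕ) (A : Type*) [NonUnitalCStarAlgebra A]
    [PartialOrder A] [StarOrderedRing A] : Prop :=
  ∀ (S : Finset A) (ε : ℝ), 0 < ε →
    ∃ (F : Fin (n + 1) → Type) (_ : ∀ i, CStarAlgebra (F i)) (_ : ∀ i, PartialOrder (F i))
      (_ : ∀ i, StarOrderedRing (F i)) (_ : ∀ i, FiniteDimensional ℂ (F i))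
      (ψ : ∀ i, A →CP F i) (φ : ∀ i, F i →CP A),
      (∀ i a, ‖ψ i a‖ ≤ ‖a‖) ∧
      (∀ i x, ‖φ i x‖ ≤ ‖x‖) ∧
      (∀ i, IsOrderZero (φ i)) ∧
      ∀ a ∈ S, ‖(∑ i, φ i (ψ i a)) - a‖ < ε

/-! ### The groups `U⁰` and exponentials -/

/-- For unital `A`, the group `U⁰(A)`: the connected component of `1` in the unitary group. -/
def unitaryZero (A : Type*) [CStarAlgebra A] : Subgroup (unitary A) :=
  Subgroup.connectedComponentOfOne (unitary A)

/-- The quotient map `A~ → ℂ` from the unitization of `A`, as a star homomorphism. -/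
def unitizationQuotient (A : Type*) [NonUnitalCStarAlgebra A] : Unitization ℂ A →⋆* ℂ :=
  { (Unitization.fstHom ℂ A : Unitization ℂ A →* ℂ) with
    map_star' := fun x => Unitization.fst_star x }

/-- For an algebra `A` without unit, the group `U⁰(A)`: the kernel of the homomorphism
`U⁰(A~) → U(ℂ)` induced by the quotient map `A~ → ℂ`, where `A~` is the unitization of `A`. In
other words, the unitaries in `U⁰(A~)` of the form `1 + x` with `x` in `A`. -/
def unitaryZeroOfNonUnital (A : Type*) [NonUnitalCStarAlgebra A] :
    Subgroup (unitary (Unitization ℂ A)) :=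
  unitaryZero (Unitization ℂ A) ⊓
    (Unitary.map (unitizationQuotient A)).ker

/-- For an algebra `A` without unit and selfadjoint `h` in `A`, the unitary `e ^ (i h)` in the
unitization of `A`. (For unital `A` the unitary `e ^ (i h)` is `selfAdjoint.expUnitary h`.) -/
def expUnitization {A : Type*} [NonUnitalCStarAlgebra A] (h : selfAdjoint A) :
    unitary (Unitization ℂ A) :=
  selfAdjoint.expUnitary
    (⟨((h : A) : Unitization ℂ A), IsSelfAdjoint.inr (R := ℂ) h.2⟩ :
      selfAdjoint (Unitization ℂ A))

end

end CommutatorProducts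

/-!
The proof compares the path `t ↦ e^{i t h₁} ⋯ e^{i t hₖ}` with a path `z_t` of the same kind that
stays uniformly close to it, whose end point `z_1` is a product of `3 * k - 1` commutators, and
whose exponents add up to zero under the universal trace. For two such paths the end points differ by
`e^{i c}` with `c` small and `Tr c` the difference of the traces of the sums of the exponents
(`exists_expUnitization_of_norm_sub_le`): along a path of unitaries near `1`, a trace composed with
the power series of the logarithm has the trace of the logarithmic derivative as its derivative.

The path `z_t` comes from nuclear dimension one. An approximation `φ₀ ∘ ψ₀ + φ₁ ∘ ψ₁` of the
identity through finite-dimensional algebras, with `φ₀` and `φ₁` of order zero, can be chosen such that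
`φ₀ (ψ₀ a)` and `φ₁ (ψ₁ a)` nearly commute for the relevant `a`: both summands are nearly
multiplication by an element that nearly commutes with `a`. If `h` has trace zero and `Φ` is the
centre-valued trace of the finite-dimensional algebra, then `φᵢ (Φ (ψᵢ h))` is moreover small
(`exists_tracial_approximation`); here `ψᵢ` is not nearly multiplicative, but becomes so after
multiplication by a resolvent.

In a finite-dimensional algebra `T - Φ T`, for selfadjoint `T`, has the form `S - w * S * star w`
with a unitary `w = e^{i K}` such that `S` commutes with `w * S * star w`
(`exists_central_add_conjugate_difference`): `T` is diagonal in a system of matrix units, and a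
diagonal matrix of trace zero is the difference of a diagonal matrix and its image under a cyclic
permutation of the entries. An order zero map `φ` is close to `ρ = r * φ`, where `r` is a cutoff
function of `φ 1`, and for `ρ` the conjugation by `w` is implemented by a unitary of `U⁰(A)`. So the
exponential of `ρ (T - Φ T)` is a commutator (`IsOrderZero.exists_commutator_model`).

Each `h_j` is thus approximated by four exponents, for each colour one whose exponential is a
commutator and one that is central for its colour, where the central ones add up to zero. Sorting
the factors by colour costs `k - 1` commutators (`exists_prod_mul_eq`), after which the central
factors cancel and `k` commutators are left for each colour. Everything takes place in the
unitization of `A`; for unital `A` the result is carried over by the retraction of the unitization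
onto `A`.
-/

namespace CommutatorProducts

/-! ### Kadison-Schwarz inequalities -/

section KadisonSchwarz

variable {A B : Type*} [NonUnitalCStarAlgebra A] [NonUnitalCStarAlgebra B]
  [PartialOrder A] [StarOrderedRing A] [PartialOrder B] [StarOrderedRing B]

theorem exists_star_mul_self_eq {a : A} (ha : 0 ≤ a) : ∃ b : A, a = star b * b :=
  CStarAlgebra.nonneg_iff_eq_star_mul_self.mp ha

/-- The positivity of `θ` on `2 × 2` matrices, applied to the Gram matrix of `a` and `b`, with the
image again written as a Gram matrix. -/
theorem cp_gram_entries (θ : A →CP B) (a b : A) :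
    ∃ r s t w : B, θ (star a * a) = star r * r + star s * s ∧
      θ (star a * b) = star r * t + star s * w ∧ θ (star b * a) = star t * r + star w * s ∧
      θ (star b * b) = star t * t + star w * w := by
  -- `star N * N` is the Gram matrix of `a` and `b`.
  let N : CStarMatrix (Fin 2) (Fin 2) A := CStarMatrix.ofMatrix !![a, b; 0, 0]
  have h1 : 0 ≤ (star N * N).map θ :=
    θ.map_cstarMatrix_nonneg _ (star_mul_self_nonneg N)
  obtain ⟨P, hP⟩ := exists_star_mul_self_eq h1
  have e : ∀ i j, θ ((star N * N) i j) = (star P * P) i j := fun i j => by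
    rw [← hP]; rfl
  have e00 := e 0 0
  have e01 := e 0 1
  have e10 := e 1 0
  have e11 := e 1 1
  simp [CStarMatrix.mul_apply, CStarMatrix.star_apply, N] at e00 e01 e10 e11
  exact ⟨_, _, _, _, e00, e01, e10, e11⟩

/-- The image under `θ` of the Gram matrix of `a` and `b` is positive on the formal vector `(c, 1)`,
even though `B` need not have a unit. -/
theorem cp_quadratic_nonneg (θ : A →CP B) (a b : A) (c : B) :
    0 ≤ star c * θ (star a * a) * c + star c * θ (star a * b) + θ (star b * a) * c
      + θ (star b * b) := by
  obtain ⟨r, s, t, w, h1, h2, h3, h4⟩ := cp_gram_entries θ a b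
  have : star c * θ (star a * a) * c + star c * θ (star a * b) + θ (star b * a) * c
      + θ (star b * b) = star (r * c + t) * (r * c + t) + star (s * c + w) * (s * c + w) := by
    rw [h1, h2, h3, h4]
    simp only [star_add, star_mul]
    noncomm_ring
  rw [this]
  exact add_nonneg (star_mul_self_nonneg _) (star_mul_self_nonneg _)

theorem cp_quadratic_nonneg' (θ : A →CP B) (a b : A) (c d : B) :
    0 ≤ star c * θ (star a * a) * c + star c * θ (star a * b) * d + star d * θ (star b * a) * c
      + star d * θ (star b * b) * d := by
  obtain ⟨r, s, t, w, h1, h2, h3, h4⟩ := cp_gram_entries θ a b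
  have : star c * θ (star a * a) * c + star c * θ (star a * b) * d
      + star d * θ (star b * a) * c + star d * θ (star b * b) * d
      = star (r * c + t * d) * (r * c + t * d) + star (s * c + w * d) * (s * c + w * d) := by
    rw [h1, h2, h3, h4]
    simp only [star_add, star_mul]
    noncomm_ring
  rw [this]
  exact add_nonneg (star_mul_self_nonneg _) (star_mul_self_nonneg _)

theorem eq_zero_of_forall_real_quadratic_nonneg {H K : B}
    (h : ∀ t : ℝ, 0 ≤ t • H + (t * t) • K) : H = 0 := by
  have hlim : Filter.Tendsto (fun t : ℝ => t • K) (nhdsWithin 0 (Set.Ioi 0)) (nhds 0) := by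
    have : Continuous (fun t : ℝ => t • K) := by fun_prop
    simpa using (this.tendsto 0).mono_left nhdsWithin_le_nhds
  have key : ∀ H' : B, (∀ t : ℝ, 0 < t → 0 ≤ t • H' + (t * t) • K) → 0 ≤ H' := by
    intro H' h'
    have h2 : Filter.Tendsto (fun t : ℝ => H' + t • K) (nhdsWithin 0 (Set.Ioi 0)) (nhds H') := by
      simpa using hlim.const_add H'
    refine CStarAlgebra.isClosed_nonneg.mem_of_tendsto h2 ?_
    filter_upwards [self_mem_nhdsWithin] with t ht
    have ht' : (0 : ℝ) < t := ht
    have h3 := smul_nonneg (inv_nonneg.mpr ht'.le) (h' t ht')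
    rw [smul_add, smul_smul, smul_smul, inv_mul_cancel₀ ht'.ne', ← mul_assoc,
      inv_mul_cancel₀ ht'.ne', one_mul, one_smul] at h3
    exact h3
  refine le_antisymm ?_ (key H fun t _ => h t)
  rw [← neg_nonneg]
  refine key (-H) fun t _ => ?_
  have := h (-t)
  simpa using this

end KadisonSchwarz

/-! ### Spectral projections in finite-dimensional C*-algebras -/

section FiniteDimensional

variable {F : Type*} [CStarAlgebra F] [FiniteDimensional ℂ F]

theorem finite_spectrum (x : F) : (spectrum ℂ x).Finite := by
  cases subsingleton_or_nontrivial F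
  · simp [spectrum.of_subsingleton]
  have hx : IsIntegral ℂ x := Algebra.IsIntegral.isIntegral x
  refine (Polynomial.rootSet_finite (minpoly ℂ x) ℂ).subset fun μ hμ => ?_
  rw [Polynomial.mem_rootSet]
  refine ⟨minpoly.ne_zero hx, ?_⟩
  have h := spectrum.subset_polynomial_aeval x (minpoly ℂ x) (Set.mem_image_of_mem _ hμ)
  rw [minpoly.aeval, spectrum.zero_eq] at h
  simpa [Polynomial.aeval_def] using h

theorem finite_real_spectrum (x : F) : (spectrum ℝ x).Finite := by
  have h := (finite_spectrum x).preimage (Complex.ofReal_injective.injOn)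
  have e : spectrum ℝ x = (fun t : ℝ => (t : ℂ)) ⁻¹' spectrum ℂ x :=
    (spectrum.preimage_algebraMap ℂ (R := ℝ) (a := x)).symm
  rw [e]
  exact h

/-- The spectral theorem in a finite-dimensional C*-algebra: every function is continuous on a
finite spectrum, so the functional calculus contains the spectral projections. -/
theorem exists_spectral_projections {x : F} (hx : IsSelfAdjoint x) :
    ∃ (s : Finset ℝ) (e : ℝ → F), (∀ μ, IsStarProjection (e μ)) ∧
      (∀ μ ν, μ ≠ ν → e μ * e ν = 0) ∧ ∑ μ ∈ s, e μ = 1 ∧ x = ∑ μ ∈ s, μ • e μ ∧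
      ∀ μ y, Commute x y → Commute (e μ) y := by
  classical
  have hc : ∀ f : ℝ → ℝ, ContinuousOn f (spectrum ℝ x) :=
    fun f => (finite_real_spectrum x).continuousOn f
  refine ⟨(finite_real_spectrum x).toFinset, fun μ => cfc (fun t => if t = μ then 1 else 0) x,
    fun μ => ⟨?_, cfc_predicate _ _⟩, fun μ ν hne => ?_, ?_, ?_, fun μ y h => h.cfc_real _⟩
  · rw [IsIdempotentElem, ← cfc_mul _ _ _ (hc _) (hc _)]
    congr 1
    ext t
    simp
  · rw [← cfc_mul _ _ _ (hc _) (hc _), ← cfc_zero ℝ x]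
    congr 1
    ext t
    by_cases h : t = μ <;> simp [h, hne]
  · rw [← cfc_sum _ _ _ (fun _ _ => hc _), ← cfc_one ℝ x]
    refine cfc_congr fun t ht => ?_
    simp [ht]
  · simp_rw [← cfc_const_mul _ _ x (hc _)]
    rw [← cfc_sum _ _ _ (fun _ _ => hc _)]
    conv_lhs => rw [← cfc_id' ℝ x]
    refine cfc_congr fun t ht => ?_
    simp [ht]

end FiniteDimensional

/-! ### Order zero maps on finite-dimensional C*-algebras -/

section OrderZero

variable {F B : Type*} [CStarAlgebra F] [NonUnitalCStarAlgebra B]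
  [PartialOrder F] [StarOrderedRing F] [PartialOrder B] [StarOrderedRing B]
  {φ : F →CP B}

theorem map_real_smul (φ : F →CP B) (r : ℝ) (x : F) : φ (r • x) = r • φ x := by
  have h := map_smul φ (r : ℂ) x
  simpa using h

/-- This is the order zero condition for `q` and `1 - q`. -/
theorem IsOrderZero.proj_mul_one (hφ : IsOrderZero φ) {q : F} (hq : IsStarProjection q) :
    φ q * φ 1 = φ q * φ q ∧ φ 1 * φ q = φ q * φ q := by
  have h1 := hφ q (1 - q) hq.nonneg hq.one_sub.nonneg hq.mul_one_sub_self
  have h2 := hφ (1 - q) q hq.one_sub.nonneg hq.nonneg hq.one_sub_mul_self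
  rw [map_sub, mul_sub, sub_eq_zero] at h1
  rw [map_sub, sub_mul, sub_eq_zero] at h2
  exact ⟨h1, h2⟩

theorem map_one_star (φ : F →CP B) : star (φ 1) = φ 1 := by rw [← map_star, star_one]

theorem star_mul_mul_le (x y : F) :
    star (y * x) * (y * x) ≤ (‖y‖ ^ 2) • (star x * x) := by
  have h := CStarAlgebra.star_left_conjugate_le_norm_smul (a := x) (b := star y * y)
    (IsSelfAdjoint.star_mul_self y)
  rw [CStarRing.norm_star_mul_self, ← sq] at h
  rw [star_mul]
  simpa only [mul_assoc] using h

variable [FiniteDimensional ℂ F]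

/-- The projection case extends to selfadjoint elements, which are combinations of orthogonal
projections. -/
theorem IsOrderZero.selfAdjoint_mul (hφ : IsOrderZero φ) {x : F} (hx : IsSelfAdjoint x) :
    φ x * φ 1 = φ 1 * φ x ∧ φ x * φ x = φ 1 * φ (x * x) := by
  obtain ⟨s, e, he, hort, -, hsum, -⟩ := exists_spectral_projections hx
  have hφx : φ x = ∑ μ ∈ s, μ • φ (e μ) := by
    rw [hsum, map_sum]; simp only [map_real_smul]
  have hsq : x * x = ∑ μ ∈ s, (μ * μ) • e μ := by
    rw [hsum, Finset.sum_mul_sum]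
    refine Finset.sum_congr rfl fun μ hμ => ?_
    rw [Finset.sum_eq_single μ]
    · rw [smul_mul_smul_comm, (he μ).isIdempotentElem]
    · intro ν _ hne
      rw [smul_mul_smul_comm, hort μ ν hne.symm, smul_zero]
    · intro h; exact absurd hμ h
  have hort' : ∀ μ ν, μ ≠ ν → φ (e μ) * φ (e ν) = 0 := fun μ ν h =>
    hφ _ _ (he μ).nonneg (he ν).nonneg (hort μ ν h)
  constructor
  · rw [hφx, Finset.sum_mul, Finset.mul_sum]
    refine Finset.sum_congr rfl fun μ _ => ?_
    rw [smul_mul_assoc, mul_smul_comm, (hφ.proj_mul_one (he μ)).1, (hφ.proj_mul_one (he μ)).2]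
  · rw [hsq, map_sum, hφx, Finset.sum_mul_sum, Finset.mul_sum]
    refine Finset.sum_congr rfl fun μ hμ => ?_
    rw [Finset.sum_eq_single μ, map_real_smul, smul_mul_smul_comm, mul_smul_comm,
      (hφ.proj_mul_one (he μ)).2]
    · intro ν _ hne
      rw [smul_mul_smul_comm, hort' μ ν hne.symm, smul_zero]
    · intro h; exact absurd hμ h

theorem IsOrderZero.commute_one (hφ : IsOrderZero φ) (x : F) : Commute (φ 1) (φ x) := by
  have h : ∀ y : F, IsSelfAdjoint y → Commute (φ 1) (φ y) :=
    fun y hy => ((hφ.selfAdjoint_mul hy).1).symm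
  rw [← realPart_add_I_smul_imaginaryPart x, map_add, map_smul]
  exact (h _ (realPart x).2).add_right ((h _ (imaginaryPart x).2).smul_right _)

/-- A Kadison-Schwarz inequality with `φ 1` in place of the unit: the defect of multiplicativity is
positive after multiplication by `φ 1`. -/
theorem IsOrderZero.mul_map_sub_nonneg (hφ : IsOrderZero φ) (x : F) :
    0 ≤ φ 1 * (φ 1 * φ (star x * x) - star (φ x) * φ x) := by
  have h := cp_quadratic_nonneg' φ 1 x (-φ x) (φ 1)
  have hs : star (φ 1) = φ 1 := by rw [← map_star]; simp
  have hx := (hφ.commute_one x).eq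
  have hx' := (hφ.commute_one (star x)).eq
  have hxx := (hφ.commute_one (star x * x)).eq
  rw [map_star] at hx'
  convert h using 1
  simp only [star_one, mul_one, one_mul, map_star, star_neg, hs]
  have e1 : φ 1 * φ (star x * x) * φ 1 = φ 1 * (φ 1 * φ (star x * x)) := by
    rw [mul_assoc, ← hxx]
  have e2 : star (φ x) * φ 1 * φ x = φ 1 * (star (φ x) * φ x) := by
    rw [← hx', mul_assoc]
  have e3 : star (φ x) * φ x * φ 1 = φ 1 * (star (φ x) * φ x) := by
    rw [mul_assoc, ← hx, ← mul_assoc, e2]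
  simp only [neg_mul, mul_neg, neg_neg]
  rw [e1, e2, e3, ← mul_assoc (φ 1) (star (φ x))]
  noncomm_ring

/-- The positive sesquilinear form `Q` of defects vanishes at `(x, x)`, hence at `(x, y)`. -/
theorem IsOrderZero.map_mul_selfAdjoint (hφ : IsOrderZero φ) {x : F} (hx : IsSelfAdjoint x)
    (y : F) : φ x * φ y = φ 1 * φ (x * y) := by
  have hφx : star (φ x) = φ x := by rw [← map_star, hx.star_eq]
  have hsq := (hφ.selfAdjoint_mul hx).2
  let Q : F → F → B := fun x y => φ 1 * (φ 1 * φ (star x * y) - star (φ x) * φ y)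
  have hQxx : Q x x = 0 := by simp only [Q, hx.star_eq, hφx, hsq, sub_self, mul_zero]
  have hQ : ∀ y, Q x y + Q y x = 0 := by
    intro y
    refine eq_zero_of_forall_real_quadratic_nonneg (K := Q y y) fun t => ?_
    have h := hφ.mul_map_sub_nonneg (x + t • y)
    have e : φ 1 * (φ 1 * φ (star (x + t • y) * (x + t • y))
        - star (φ (x + t • y)) * φ (x + t • y))
        = Q x x + t • (Q x y + Q y x) + (t * t) • Q y y := by
      simp only [Q, star_add, star_smul, star_trivial, map_add, map_real_smul, add_mul, mul_add,
        smul_mul_assoc, mul_smul_comm, smul_add, smul_sub, mul_sub, smul_smul]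
      abel
    rw [e, hQxx, zero_add] at h
    exact h
  have hQ2 : Q x y = 0 := by
    have h1 := hQ y
    have h2 := hQ (Complex.I • y)
    have e1 : Q x (Complex.I • y) = Complex.I • Q x y := by
      simp only [Q, map_smul, mul_smul_comm, smul_sub, mul_sub]
    have e2 : Q (Complex.I • y) x = -(Complex.I • Q y x) := by
      simp only [Q, map_smul, star_smul, smul_mul_assoc, mul_smul_comm, smul_sub, mul_sub]
      simp only [RCLike.star_def, Complex.conj_I, neg_smul]
      abel
    rw [e1, e2, ← sub_eq_add_neg, ← smul_sub] at h2
    have h3 : Q x y - Q y x = 0 := (smul_eq_zero.mp h2).resolve_left Complex.I_ne_zero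
    have h4 : (2 : ℂ) • Q x y = 0 := by
      rw [two_smul]
      calc Q x y + Q x y = (Q x y + Q y x) + (Q x y - Q y x) := by abel
        _ = 0 := by rw [h1, h3, add_zero]
    exact (smul_eq_zero.mp h4).resolve_left two_ne_zero
  -- `Q x y = 0` says that `φ 1` kills the defect `D`. Then `φ x` kills it as well, and `star D`
  -- ends in a multiple of `φ 1` or `φ x`.
  set D : B := φ 1 * φ (x * y) - φ x * φ y with hD
  have hpD : φ 1 * D = 0 := by simpa only [Q, hx.star_eq, hφx] using hQ2
  have hxD : φ x * D = 0 := by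
    rw [← CStarRing.star_mul_self_eq_zero_iff, star_mul, hφx, mul_assoc, ← mul_assoc (φ x), hsq,
      (hφ.commute_one _).eq, mul_assoc, hpD, mul_zero, mul_zero]
  have hDD : star D * D = 0 := by
    have : star D = star (φ (x * y)) * φ 1 - star (φ y) * φ x := by
      rw [hD, star_sub, star_mul, star_mul, hφx, ← map_star φ 1, star_one]
    rw [this, sub_mul, mul_assoc, mul_assoc, hpD, hxD, mul_zero, mul_zero, sub_zero]
  rw [CStarRing.star_mul_self_eq_zero_iff, hD, sub_eq_zero] at hDD
  exact hDD.symm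

/-- An order zero map is multiplicative up to the factor `φ 1`: a replacement for the structure
theorem of Winter and Zacharias. -/
theorem IsOrderZero.map_mul (hφ : IsOrderZero φ) (x y : F) : φ x * φ y = φ 1 * φ (x * y) := by
  have h := hφ.map_mul_selfAdjoint (realPart x).2 y
  have h' := hφ.map_mul_selfAdjoint (imaginaryPart x).2 y
  conv_lhs => rw [← realPart_add_I_smul_imaginaryPart x]
  conv_rhs => rw [← realPart_add_I_smul_imaginaryPart x]
  simp only [map_add, map_smul, add_mul, mul_add, smul_mul_assoc, mul_smul_comm]
  rw [h, h']

theorem IsOrderZero.star_map_mul_map (hφ : IsOrderZero φ) (x : F) :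
    star (φ x) * φ x = φ 1 * φ (star x * x) := by
  rw [← map_star, hφ.map_mul]

theorem IsOrderZero.one_mul_map_mono (hφ : IsOrderZero φ) {a b : F} (h : a ≤ b) :
    φ 1 * φ a ≤ φ 1 * φ b := by
  obtain ⟨s, hs⟩ := exists_star_mul_self_eq (sub_nonneg.mpr h)
  rw [← sub_nonneg, ← mul_sub, ← map_sub, hs, ← hφ.star_map_mul_map]
  exact star_mul_self_nonneg _

/-- Left multiplication by `y` is bounded by `‖y‖` in the seminorm `x ↦ ‖φ 1 * φ x‖`. This seminorm
measures defects of multiplicativity in `F`, by `IsOrderZero.map_mul`. -/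
theorem IsOrderZero.norm_one_mul_map_mul_le (hφ : IsOrderZero φ) (y x : F) :
    ‖φ 1 * φ (y * x)‖ ≤ ‖y‖ * ‖φ 1 * φ x‖ := by
  have key : ∀ z : F, star (φ 1 * φ z) * (φ 1 * φ z)
      = star (φ 1) * (φ 1 * φ (star z * z)) * φ 1 := by
    intro z
    rw [star_mul, map_one_star]
    have h1 := (hφ.commute_one z).eq
    have h2 := (hφ.commute_one (star z)).eq
    rw [map_star] at h2
    rw [← hφ.star_map_mul_map, ← h2]
    simp only [mul_assoc, h1]
  have hle : star (φ 1 * φ (y * x)) * (φ 1 * φ (y * x))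
      ≤ (‖y‖ ^ 2) • (star (φ 1 * φ x) * (φ 1 * φ x)) := by
    rw [key, key]
    have h := hφ.one_mul_map_mono (star_mul_mul_le x y)
    have h' := star_left_conjugate_le_conjugate h (φ 1)
    simpa only [map_real_smul, mul_smul_comm, smul_mul_assoc] using h'
  have hn := CStarAlgebra.norm_le_norm_of_nonneg_of_le (star_mul_self_nonneg _) hle
  rw [norm_smul, CStarRing.norm_star_mul_self, CStarRing.norm_star_mul_self, norm_pow,
    norm_norm] at hn
  refine abs_le_of_sq_le_sq' (b := ‖y‖ * ‖φ 1 * φ x‖) ?_ (by positivity) |>.2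
  calc _ = ‖φ 1 * φ (y * x)‖ * ‖φ 1 * φ (y * x)‖ := by ring
    _ ≤ _ := hn
    _ = _ := by ring

theorem IsOrderZero.norm_one_mul_map_star (hφ : IsOrderZero φ) (x : F) :
    ‖φ 1 * φ (star x)‖ = ‖φ 1 * φ x‖ := by
  rw [← norm_star, star_mul, map_one_star, ← map_star, star_star, (hφ.commute_one x).eq]

theorem IsOrderZero.norm_one_mul_map_mul_le' (hφ : IsOrderZero φ) (x y : F) :
    ‖φ 1 * φ (x * y)‖ ≤ ‖φ 1 * φ x‖ * ‖y‖ := by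
  rw [← hφ.norm_one_mul_map_star, star_mul]
  refine (hφ.norm_one_mul_map_mul_le _ _).trans ?_
  rw [hφ.norm_one_mul_map_star, norm_star, mul_comm]

theorem IsOrderZero.norm_map_sq_le (hφ : IsOrderZero φ) {x : F} (hx : IsSelfAdjoint x) :
    ‖φ x‖ ^ 2 ≤ ‖x‖ * ‖φ 1 * φ x‖ := by
  rw [sq, ← CStarRing.norm_star_mul_self, hφ.star_map_mul_map, hx.star_eq]
  exact hφ.norm_one_mul_map_mul_le x x

/-- Multiplying an order zero map by an element `r` of the commutant of its range changes it by no
more than the corresponding change of its value at `1`. -/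
theorem IsOrderZero.norm_sub_mul_map_le (hφ : IsOrderZero φ) {r : B} (hr : IsSelfAdjoint r)
    (hc : ∀ x, Commute r (φ x)) (x : F) :
    ‖φ x - r * φ x‖ ≤ ‖x‖ * ‖φ 1 - r * φ 1‖ := by
  have key : ∀ z : F, star (φ z - r * φ z) * (φ z - r * φ z)
      = φ 1 * φ (star z * z) - r * (φ 1 * φ (star z * z)) - φ 1 * φ (star z * z) * r
        + r * (φ 1 * φ (star z * z)) * r := by
    intro z
    rw [← hφ.star_map_mul_map, ← map_star φ z]
    have h1 := (hc z).eq
    have h2 := (hc (star z)).eq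
    rw [star_sub, star_mul, hr.star_eq, ← map_star φ z, ← h2, h1]
    noncomm_ring
  have hpos : ∀ c : B, 0 ≤ c → 0 ≤ c - r * c - c * r + r * c * r := by
    intro c hc
    obtain ⟨s, rfl⟩ := exists_star_mul_self_eq hc
    have : star s * s - r * (star s * s) - star s * s * r + r * (star s * s) * r
        = star (s - s * r) * (s - s * r) := by
      rw [star_sub, star_mul, hr.star_eq]
      noncomm_ring
    rw [this]
    exact star_mul_self_nonneg _
  have hle : star (φ x - r * φ x) * (φ x - r * φ x)
      ≤ (‖x‖ ^ 2) • (star (φ 1 - r * φ 1) * (φ 1 - r * φ 1)) := by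
    have h := hφ.one_mul_map_mono (star_mul_mul_le 1 x)
    rw [mul_one, map_real_smul, mul_smul_comm] at h
    have h' := hpos _ (sub_nonneg.mpr h)
    rw [key, key, ← sub_nonneg]
    convert h' using 1
    simp only [smul_add, smul_sub, mul_sub, sub_mul, mul_smul_comm, smul_mul_assoc]
    abel
  have hn := CStarAlgebra.norm_le_norm_of_nonneg_of_le (star_mul_self_nonneg _) hle
  rw [norm_smul, CStarRing.norm_star_mul_self, CStarRing.norm_star_mul_self, norm_pow,
    norm_norm] at hn
  refine abs_le_of_sq_le_sq' (b := ‖x‖ * ‖φ 1 - r * φ 1‖) ?_ (by positivity) |>.2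
  calc _ = ‖φ x - r * φ x‖ * ‖φ x - r * φ x‖ := by ring
    _ ≤ _ := hn
    _ = _ := by ring

end OrderZero

/-! ### Minimal projections -/

section Diagonalisation

variable {F : Type*} [CStarAlgebra F]

/-- A finite set of nonzero orthogonal projections with sum `1` that commute with `T`. -/
structure IsDiagonalFamily (T : F) (S : Finset F) : Prop where
  proj : ∀ q ∈ S, IsStarProjection q
  ne_zero : ∀ q ∈ S, q ≠ 0
  orth : ∀ q ∈ S, ∀ r ∈ S, q ≠ r → q * r = 0
  sum_eq : ∑ q ∈ S, q = 1
  comm : ∀ q ∈ S, Commute q T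

variable {T : F}

theorem exists_isDiagonalFamily (T : F) : ∃ S, IsDiagonalFamily T S := by
  cases subsingleton_or_nontrivial F
  · exact ⟨∅, by simp, by simp, by simp, Subsingleton.elim _ _, by simp⟩
  · exact ⟨{1}, by simp [IsStarProjection.one], by simp, by simp +contextual, by simp, by simp⟩

/-- A proper subprojection `r` of a member `q` that commutes with `T` refines the family. -/
theorem IsDiagonalFamily.split [DecidableEq F] {S : Finset F} (h : IsDiagonalFamily T S) {q r : F}
    (hq : q ∈ S) (hr : IsStarProjection r) (hrq : q * r = r) (hrT : Commute r T) (h0 : r ≠ 0)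
    (h1 : r ≠ q) : ∃ S', IsDiagonalFamily T S' ∧ S.card < S'.card := by
  have hrq' : r * q = r := by
    have := congrArg star hrq
    rwa [star_mul, hr.isSelfAdjoint.star_eq, (h.proj q hq).isSelfAdjoint.star_eq] at this
  have hqr : IsStarProjection (q - r) := IsStarProjection.sub_of_mul_eq_left hr (h.proj q hq) hrq'
  have hr_orth : r * (q - r) = 0 := by
    rw [mul_sub, hrq', hr.isIdempotentElem, sub_self]
  have hr_orth' : (q - r) * r = 0 := by
    rw [sub_mul, hrq, hr.isIdempotentElem, sub_self]
  have ho : ∀ s ∈ S.erase q, r * s = 0 ∧ s * r = 0 := by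
    intro s hs
    rw [Finset.mem_erase] at hs
    constructor
    · rw [← hrq', mul_assoc, h.orth q hq s hs.2 (Ne.symm hs.1), mul_zero]
    · rw [← hrq, ← mul_assoc, h.orth s hs.2 q hq hs.1, zero_mul]
  have ho' : ∀ s ∈ S.erase q, (q - r) * s = 0 ∧ s * (q - r) = 0 := by
    intro s hs
    have h2 := ho s hs
    rw [Finset.mem_erase] at hs
    rw [sub_mul, mul_sub, h2.1, h2.2, h.orth q hq s hs.2 (Ne.symm hs.1),
      h.orth s hs.2 q hq hs.1, sub_zero]
    exact ⟨rfl, rfl⟩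
  have hne : r ≠ q - r := by
    intro e
    rw [← e, hr.isIdempotentElem] at hr_orth
    exact h0 hr_orth
  have hn2 : q - r ∉ S.erase q := by
    intro hm
    have := (ho' _ hm).1
    rw [hqr.isIdempotentElem] at this
    exact h1 (sub_eq_zero.mp this).symm
  have hn1 : r ∉ insert (q - r) (S.erase q) := by
    rw [Finset.mem_insert, not_or]
    refine ⟨hne, fun hm => ?_⟩
    have := (ho _ hm).1
    rw [hr.isIdempotentElem] at this
    exact h0 this
  refine ⟨insert r (insert (q - r) (S.erase q)), ⟨?_, ?_, ?_, ?_, ?_⟩, ?_⟩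
  · intro s hs
    simp only [Finset.mem_insert] at hs
    rcases hs with rfl | rfl | hs
    · exact hr
    · exact hqr
    · exact h.proj s (Finset.mem_of_mem_erase hs)
  · intro s hs
    simp only [Finset.mem_insert] at hs
    rcases hs with rfl | rfl | hs
    · exact h0
    · exact fun e => h1 (sub_eq_zero.mp e).symm
    · exact h.ne_zero s (Finset.mem_of_mem_erase hs)
  · intro s hs t ht hst
    simp only [Finset.mem_insert] at hs ht
    rcases hs with rfl | rfl | hs <;> rcases ht with rfl | rfl | ht
    · exact absurd rfl hst
    · exact hr_orth
    · exact (ho _ ht).1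
    · exact hr_orth'
    · exact absurd rfl hst
    · exact (ho' _ ht).1
    · exact (ho _ hs).2
    · exact (ho' _ hs).2
    · exact h.orth s (Finset.mem_of_mem_erase hs) t (Finset.mem_of_mem_erase ht) hst
  · rw [Finset.sum_insert hn1, Finset.sum_insert hn2, ← add_assoc, add_sub_cancel,
      Finset.add_sum_erase S (fun x => x) hq, h.sum_eq]
  · intro s hs
    simp only [Finset.mem_insert] at hs
    rcases hs with rfl | rfl | hs
    · exact hrT
    · exact (h.comm q hq).sub_left hrT
    · exact h.comm s (Finset.mem_of_mem_erase hs)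
  · rw [Finset.card_insert_of_notMem hn1, Finset.card_insert_of_notMem hn2,
      Finset.card_erase_of_mem hq]
    have := Finset.card_pos.mpr ⟨q, hq⟩
    omega

variable [FiniteDimensional ℂ F]

theorem IsDiagonalFamily.card_le {S : Finset F} (h : IsDiagonalFamily T S) :
    S.card ≤ Module.finrank ℂ F := by
  have hli : LinearIndependent ℂ (fun q : S => (q : F)) := by
    rw [Fintype.linearIndependent_iff]
    intro g hg q
    have h1 : (q : F) * ∑ i, g i • (i : F) = g q • (q : F) := by
      rw [Finset.mul_sum, Finset.sum_eq_single q]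
      · rw [mul_smul_comm, (h.proj q q.2).isIdempotentElem]
      · intro r _ hr
        rw [mul_smul_comm, h.orth q q.2 r r.2 (fun e => hr (Subtype.ext e.symm)), smul_zero]
      · simp
    rw [hg, mul_zero] at h1
    exact (smul_eq_zero.mp h1.symm).resolve_right (h.ne_zero q q.2)
  simpa using hli.fintype_card_le_finrank

/-- A selfadjoint element of a finite-dimensional C*-algebra is diagonal with respect to a family of
minimal projections. -/
theorem exists_minimal_projections (hT : IsSelfAdjoint T) :
    ∃ S : Finset F, IsDiagonalFamily T S ∧ (∀ q ∈ S, ∃ c : ℝ, T * q = c • q) ∧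
      ∀ q ∈ S, ∀ x, ∃ c : ℂ, q * x * q = c • q := by
  classical
  have hfin : ∃ n, ∃ S, IsDiagonalFamily T S ∧ S.card = n := by
    obtain ⟨S, hS⟩ := exists_isDiagonalFamily T
    exact ⟨_, S, hS, rfl⟩
  obtain ⟨S, hS, hmax⟩ : ∃ S, IsDiagonalFamily T S ∧ ∀ S', IsDiagonalFamily T S' →
      S'.card ≤ S.card := by
    have hb : ∀ n, (∃ S, IsDiagonalFamily T S ∧ S.card = n) → n ≤ Module.finrank ℂ F := by
      rintro n ⟨S, hS, rfl⟩
      exact hS.card_le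
    obtain ⟨n, hn⟩ := hfin
    have hg := Nat.findGreatest_spec (P := fun n => ∃ S, IsDiagonalFamily T S ∧ S.card = n)
      (hb n hn) hn
    obtain ⟨S, hS, hc⟩ := hg
    refine ⟨S, hS, fun S' hS' => ?_⟩
    rw [hc]
    exact Nat.le_findGreatest hS'.card_le ⟨S', hS', rfl⟩
  -- In a family of maximal size no projection can be split.
  have hmin : ∀ q ∈ S, ∀ r, IsStarProjection r → q * r = r → Commute r T → r = 0 ∨ r = q := by
    intro q hq r hr hqr hrT
    by_contra! hne
    obtain ⟨S', hS', hlt⟩ := hS.split hq hr hqr hrT hne.1 hne.2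
    exact absurd (hmax S' hS') (not_le.mpr hlt)
  have hscalar : ∀ q ∈ S, ∀ y, IsSelfAdjoint y → Commute y q →
      Commute y T → ∃ c : ℝ, y * q = c • q := by
    intro q hq y hy hyq hyT
    obtain ⟨s, e, he, hort, hsum, hy', hcomm⟩ := exists_spectral_projections hy
    have hq' := hS.proj q hq
    have hqe : ∀ μ, q * e μ = 0 ∨ q * e μ = q := by
      intro μ
      refine hmin q hq _ (hq'.mul (he μ) (hcomm μ q hyq).symm) ?_ ?_
      · rw [← mul_assoc, hq'.isIdempotentElem]
      · exact (hS.comm q hq).mul_left (hcomm μ T hyT)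
    have hex : ∃ μ ∈ s, q * e μ = q := by
      by_contra! hno
      have : q = 0 := by
        rw [← mul_one q, ← hsum, Finset.mul_sum]
        exact Finset.sum_eq_zero fun μ hμ => (hqe μ).resolve_right (hno μ hμ)
      exact hS.ne_zero q hq this
    obtain ⟨μ, hμ, hμq⟩ := hex
    refine ⟨μ, ?_⟩
    rw [hyq.eq, hy', Finset.mul_sum, Finset.sum_eq_single μ]
    · rw [mul_smul_comm, hμq]
    · intro ν _ hne
      rw [mul_smul_comm, ← hμq, mul_assoc, hort μ ν hne.symm, mul_zero, smul_zero]
    · intro hn; exact absurd hμ hn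
  have hTq : ∀ q ∈ S, ∃ c : ℝ, T * q = c • q := fun q hq =>
    hscalar q hq T hT (hS.comm q hq).symm (Commute.refl T)
  refine ⟨S, hS, hTq, fun q hq x => ?_⟩
  have hq' := hS.proj q hq
  have hsa : ∀ y, IsSelfAdjoint y → ∃ c : ℝ, q * y * q = c • q := by
    intro y hy
    obtain ⟨c, hc⟩ := hTq q hq
    have hc' : q * T = c • q := by rw [(hS.comm q hq).eq, hc]
    have h1 : Commute (q * y * q) q := by
      rw [Commute, SemiconjBy, mul_assoc, hq'.isIdempotentElem, ← mul_assoc, ← mul_assoc,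
        hq'.isIdempotentElem]
    have h2 : Commute (q * y * q) T := by
      rw [Commute, SemiconjBy, mul_assoc, hc', ← mul_assoc, ← mul_assoc, hc]
      simp
    have h3 : IsSelfAdjoint (q * y * q) := by
      rw [isSelfAdjoint_iff]
      simp only [star_mul, hy.star_eq, hq'.isSelfAdjoint.star_eq, mul_assoc]
    obtain ⟨d, hd⟩ := hscalar q hq _ h3 h1 h2
    refine ⟨d, ?_⟩
    rwa [mul_assoc, hq'.isIdempotentElem] at hd
  obtain ⟨c, hc⟩ := hsa _ (realPart x).2
  obtain ⟨d, hd⟩ := hsa _ (imaginaryPart x).2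
  refine ⟨(c : ℂ) + Complex.I * d, ?_⟩
  rw [← realPart_add_I_smul_imaginaryPart x, mul_add, add_mul, hc, mul_smul_comm, smul_mul_assoc,
    hd, add_smul, mul_smul]
  simp

end Diagonalisation

/-! ### Averages along orbits of a permutation -/

section Permutations

variable {ι : Type*} [Finite ι]

/-- There is a permutation of a finite set whose orbits are the classes of a given equivalence
relation. -/
theorem exists_perm_of_setoid (R : Setoid ι) :
    ∃ σ : Equiv.Perm ι, (∀ i, R (σ i) i) ∧
      ∀ (α : Type) (f : ι → α), (∀ i, f (σ i) = f i) → ∀ i j, R i j → f i = f j := by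
  classical
  cases nonempty_fintype ι
  have hex : ∀ c : Quotient R, ∃ f : Equiv.Perm ι, f.IsCycleOn {i | Quotient.mk R i = c} := by
    intro c
    obtain ⟨f, hf, -⟩ := (Finset.univ.filter fun i => Quotient.mk R i = c).exists_cycleOn
    exact ⟨f, by simpa using hf⟩
  choose f hf using hex
  have hmem : ∀ i, Quotient.mk R (f (Quotient.mk R i) i) = Quotient.mk R i :=
    fun i => (hf (Quotient.mk R i)).1.mapsTo rfl
  have hinj : Function.Injective fun i => f (Quotient.mk R i) i := by
    intro i j hij
    have h1 := congrArg (Quotient.mk R) hij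
    simp only [hmem] at h1
    simp only [h1] at hij
    exact (f _).injective hij
  let σ : Equiv.Perm ι := Equiv.ofBijective _ (Finite.injective_iff_bijective.mp hinj)
  have hσ : ∀ i, σ i = f (Quotient.mk R i) i := fun i => rfl
  refine ⟨σ, fun i => Quotient.exact (hmem i), fun α g hg i j hij => ?_⟩
  have hc : Quotient.mk R j = Quotient.mk R i := (Quotient.sound hij).symm
  obtain ⟨n, hn⟩ := ((hf (Quotient.mk R i)).2 (x := i) rfl (y := j) hc).exists_pow_eq'
  have hpow : ∀ m : ℕ, Quotient.mk R ((f (Quotient.mk R i) ^ m) i) = Quotient.mk R i ∧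
      g ((f (Quotient.mk R i) ^ m) i) = g i := by
    intro m
    induction m with
    | zero => simp
    | succ m ih =>
      have h2 : (f (Quotient.mk R i) ^ (m + 1)) i = σ ((f (Quotient.mk R i) ^ m) i) := by
        rw [pow_succ', Equiv.Perm.mul_apply, hσ, ih.1]
      rw [h2, hg, hσ, hmem]
      exact ih
  rw [← hn.2, (hpow n).2]

theorem sum_range_mul_sub (K : ℝ) (a : ℕ → ℝ) (n : ℕ) :
    ∑ m ∈ Finset.range n, (K - m) * (a m - a (m + 1))
      = K * a 0 - (K - n) * a n - ∑ m ∈ Finset.range n, a (m + 1) := by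
  induction n with
  | zero => simp
  | succ n ih =>
    rw [Finset.sum_range_succ, Finset.sum_range_succ, ih]
    push_cast
    ring

/-- A function on a finite set differs from its average along the orbits of a permutation by a
coboundary. -/
theorem exists_average_add_coboundary (σ : Equiv.Perm ι) (a : ι → ℝ) :
    ∃ s e : ι → ℝ, (∀ i, e (σ i) = e i) ∧ ∀ i, a i = e i + (s i - s (σ⁻¹ i)) := by
  set N := orderOf σ with hN
  have hNpos : 0 < N := orderOf_pos σ
  have hN0 : (N : ℝ) ≠ 0 := by positivity
  let b : ι → ℕ → ℝ := fun i m => a ((σ⁻¹ ^ m) i)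
  have hbN : ∀ i, b i N = b i 0 := by
    intro i
    simp only [b, inv_pow, hN, pow_orderOf_eq_one, pow_zero, inv_one]
  have hbs : ∀ i m, b (σ⁻¹ i) m = b i (m + 1) := by
    intro i m
    simp only [b, pow_succ, Equiv.Perm.mul_apply]
  -- The coboundary of `s` telescopes, since its weights decrease by `1 / N` at each step; the
  -- weight of the last term is zero.
  refine ⟨fun i => ∑ m ∈ Finset.range N, ((N - 1 - m) / N) * b i m,
    fun i => (∑ m ∈ Finset.range N, b i (m + 1)) / N, ?_, ?_⟩
  · have h : ∀ i, (∑ m ∈ Finset.range N, b (σ⁻¹ i) (m + 1)) / N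
        = (∑ m ∈ Finset.range N, b i (m + 1)) / N := by
      intro i
      simp only [hbs]
      congr 1
      have h1 := Finset.sum_range_succ (fun m => b i (m + 1)) N
      have h2 := Finset.sum_range_succ' (fun m => b i (m + 1)) N
      have h3 : b i (N + 1) = b i 1 := by
        rw [← hbs, hbN, hbs]
      simp only [zero_add] at h2
      linarith
    intro i
    have := h (σ i)
    rw [show σ⁻¹ (σ i) = i from σ.symm_apply_apply i] at this
    exact this.symm
  · intro i
    have h1 := sum_range_mul_sub (N - 1) (b i) N
    rw [hbN] at h1
    have h2 : ∑ m ∈ Finset.range N, ((N - 1 - m : ℝ) / N) * b i m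
        - ∑ m ∈ Finset.range N, ((N - 1 - m : ℝ) / N) * b (σ⁻¹ i) m
        = (∑ m ∈ Finset.range N, ((N : ℝ) - 1 - m) * (b i m - b i (m + 1))) / N := by
      rw [← Finset.sum_sub_distrib, Finset.sum_div]
      refine Finset.sum_congr rfl fun m _ => ?_
      rw [hbs]
      ring
    simp only
    rw [h2, h1]
    have h3 : b i 0 = a i := rfl
    rw [h3]
    field_simp
    ring

end Permutations

/-! ### Trace-zero elements as differences of conjugates -/

section Transport

variable {F : Type*} [CStarAlgebra F]

/-- Murray-von Neumann equivalence of the projections in a family. -/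
def projectionSetoid {ι : Type*} (q : ι → F) (hq : ∀ i, IsStarProjection (q i)) : Setoid ι where
  r i j := ∃ v : F, star v * v = q j ∧ v * star v = q i
  iseqv := {
    refl := fun i => ⟨q i, by rw [(hq i).isSelfAdjoint.star_eq, (hq i).isIdempotentElem],
      by rw [(hq i).isSelfAdjoint.star_eq, (hq i).isIdempotentElem]⟩
    symm := fun ⟨v, h1, h2⟩ => ⟨star v, by rw [star_star, h2], by rw [star_star, h1]⟩
    trans := fun {i j k} ⟨v, h1, h2⟩ ⟨w, h3, h4⟩ => by
      refine ⟨v * w, ?_, ?_⟩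
      · rw [star_mul, mul_assoc, ← mul_assoc (star v), h1, ← h4]
        calc star w * (w * star w * w) = (star w * w) * (star w * w) := by simp only [mul_assoc]
          _ = q k := by rw [h3, (hq k).isIdempotentElem]
      · rw [star_mul, mul_assoc, ← mul_assoc w, h4, ← h1]
        calc v * (star v * v * star v) = (v * star v) * (v * star v) := by simp only [mul_assoc]
          _ = q i := by rw [h2, (hq i).isIdempotentElem] }

/-- Minimal projections linked by a nonzero element are equivalent: the polar part of `p * y * q` is
a scalar multiple of it. -/
theorem exists_partial_isometry [PartialOrder F] [StarOrderedRing F] {p q y : F}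
    (hp : IsStarProjection p) (hq : IsStarProjection q)
    (hpm : ∀ x, ∃ c : ℂ, p * x * p = c • p) (hqm : ∀ x, ∃ c : ℂ, q * x * q = c • q)
    (hy : p * y * q ≠ 0) : ∃ v : F, star v * v = q ∧ v * star v = p := by
  set z := p * y * q with hz
  obtain ⟨c, hc⟩ := hqm (star y * p * y)
  obtain ⟨d, hd⟩ := hpm (y * q * star y)
  have hzz : star z * z = c • q := by
    rw [← hc, hz]
    simp only [star_mul, hp.isSelfAdjoint.star_eq, hq.isSelfAdjoint.star_eq]
    calc q * (star y * p) * (p * y * q) = q * (star y * (p * p) * y) * q := by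
          simp only [mul_assoc]
      _ = _ := by rw [hp.isIdempotentElem.eq]
  have hzz' : z * star z = d • p := by
    rw [← hd, hz]
    simp only [star_mul, hp.isSelfAdjoint.star_eq, hq.isSelfAdjoint.star_eq]
    calc p * y * q * (q * (star y * p)) = p * (y * (q * q) * star y) * p := by
          simp only [mul_assoc]
      _ = _ := by rw [hq.isIdempotentElem.eq]
  have hzq : z * q = z := by rw [hz, mul_assoc, hq.isIdempotentElem]
  have hq0 : q ≠ 0 := fun h => hy (by rw [hz, h, mul_zero])
  have hp0 : p ≠ 0 := fun h => hy (by rw [hz, h, zero_mul, zero_mul])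
  have hd0 : d ≠ 0 := fun h => by
    rw [h, zero_smul] at hzz'
    exact hy ((CStarRing.mul_star_self_eq_zero_iff z).mp hzz')
  have hcd : c = d := by
    have h1 : d • (d • p) = c • (d • p) := by
      calc d • (d • p) = (d • p) * (d • p) := by
            rw [smul_mul_smul_comm, hp.isIdempotentElem, smul_smul]
        _ = z * (star z * z) * star z := by rw [← hzz']; simp only [mul_assoc]
        _ = c • (d • p) := by rw [hzz, mul_smul_comm, hzq, smul_mul_assoc, hzz']
    have h2 : (c - d) • (d • p) = 0 := by rw [sub_smul, h1, sub_self]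
    rcases smul_eq_zero.mp h2 with h | h
    · exact sub_eq_zero.mp h
    · exact absurd h (smul_ne_zero hd0 hp0)
  have hcr : c = (c.re : ℂ) := by
    have h1 : star (c • q) = c • q := by rw [← hzz, star_mul, star_star]
    rw [star_smul, hq.isSelfAdjoint.star_eq] at h1
    have h2 : (star c - c) • q = 0 := by rw [sub_smul, h1, sub_self]
    have h3 := sub_eq_zero.mp ((smul_eq_zero.mp h2).resolve_right hq0)
    exact (Complex.conj_eq_iff_re.mp h3).symm
  have hc0 : c ≠ 0 := hcd ▸ hd0
  have hcpos : 0 < c.re := by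
    have hne : c.re ≠ 0 := fun h => hc0 (by rw [hcr, h, Complex.ofReal_zero])
    refine lt_of_le_of_ne ?_ hne.symm
    by_contra! hlt
    have h1 : 0 ≤ c.re • q := by
      have := star_mul_self_nonneg z
      rw [hzz, hcr] at this
      simpa using this
    have h2 : c.re • q ≤ 0 := smul_nonpos_of_nonpos_of_nonneg hlt.le hq.nonneg
    exact (smul_ne_zero hne hq0) (le_antisymm h2 h1)
  have hs : (Real.sqrt c.re)⁻¹ * (Real.sqrt c.re)⁻¹ * c.re = 1 := by
    rw [← mul_inv, Real.mul_self_sqrt hcpos.le, inv_mul_cancel₀ hcpos.ne']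
  have e : ∀ r : F, c • r = c.re • r := fun r => by
    conv_lhs => rw [hcr]
    simp
  refine ⟨(Real.sqrt c.re)⁻¹ • z, ?_, ?_⟩
  · rw [star_smul, smul_mul_smul_comm, hzz, star_trivial, e, smul_smul, hs, one_smul]
  · rw [star_smul, smul_mul_smul_comm, hzz', ← hcd, star_trivial, e, smul_smul, hs, one_smul]

/-- Partial isometries from `q i` to `q (σ i)` add up to a unitary that permutes the projections of
a family as `σ` does. -/
theorem exists_unitary_permuting {ι : Type*} [Fintype ι] {q : ι → F}
    (hq : ∀ i, IsStarProjection (q i)) (hort : ∀ i j, i ≠ j → q i * q j = 0)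
    (hsum : ∑ i, q i = 1) (σ : Equiv.Perm ι)
    (hσ : ∀ i, ∃ v : F, star v * v = q i ∧ v * star v = q (σ i)) :
    ∃ w ∈ unitary F, ∀ i, w * q i * star w = q (σ i) := by
  choose v hv hv' using hσ
  have hvq : ∀ i, v i * q i = v i := by
    intro i
    rw [← sub_eq_zero, ← CStarRing.star_mul_self_eq_zero_iff]
    have hs := (hq i).isSelfAdjoint.star_eq
    have hi := (hq i).isIdempotentElem.eq
    rw [star_sub, star_mul, hs]
    calc (q i * star (v i) - star (v i)) * (v i * q i - v i)
        = q i * (star (v i) * v i) * q i - q i * (star (v i) * v i) - (star (v i) * v i) * q i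
          + star (v i) * v i := by noncomm_ring
      _ = 0 := by rw [hv, hi, hi]; abel
  have hqv : ∀ i, q (σ i) * v i = v i := by
    intro i
    rw [← hv', mul_assoc, hv, hvq]
  have hqv' : ∀ i, star (v i) * q (σ i) = star (v i) := by
    intro i
    have := congrArg star (hqv i)
    rwa [star_mul, (hq _).isSelfAdjoint.star_eq] at this
  have hvq' : ∀ i, q i * star (v i) = star (v i) := by
    intro i
    have := congrArg star (hvq i)
    rwa [star_mul, (hq _).isSelfAdjoint.star_eq] at this
  have h1 : ∀ i j, i ≠ j → star (v i) * v j = 0 := by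
    intro i j hij
    rw [← hqv' i, ← hqv j, mul_assoc, ← mul_assoc (q (σ i)),
      hort _ _ (fun h => hij (σ.injective h)), zero_mul, mul_zero]
  have h2 : ∀ i j, i ≠ j → v i * star (v j) = 0 := by
    intro i j hij
    rw [← hvq i, ← hvq' j, mul_assoc, ← mul_assoc (q i), hort _ _ hij, zero_mul, mul_zero]
  have hwq : ∀ i, (∑ j, v j) * q i = v i := by
    intro i
    rw [Finset.sum_mul, Finset.sum_eq_single i, hvq]
    · intro j _ hji
      rw [← hvq j, mul_assoc, hort _ _ hji, mul_zero]
    · simp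
  refine ⟨∑ i, v i, Unitary.mem_iff.mpr ⟨?_, ?_⟩, fun i => ?_⟩
  · rw [star_sum, Finset.sum_mul_sum, ← hsum]
    refine Finset.sum_congr rfl fun i _ => ?_
    rw [Finset.sum_eq_single i, hv]
    · intro j _ hji
      exact h1 i j hji.symm
    · simp
  · rw [star_sum, Finset.sum_mul_sum, ← hsum, ← Equiv.sum_comp σ q]
    refine Finset.sum_congr rfl fun i _ => ?_
    rw [Finset.sum_eq_single i, hv']
    · intro j _ hji
      exact h2 i j hji.symm
    · simp
  · rw [hwq, star_sum, Finset.mul_sum, Finset.sum_eq_single i, hv']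
    · intro j _ hji
      exact h2 i j hji.symm
    · simp

variable [FiniteDimensional ℂ F]

/-- A unitary with finite spectrum has a logarithm, because the argument is continuous on a finite
set. -/
theorem exists_expUnitary_eq (w : unitary F) :
    ∃ K : selfAdjoint F, selfAdjoint.expUnitary K = w := by
  refine ⟨Unitary.argSelfAdjoint w, ?_⟩
  ext
  have hc : ContinuousOn Complex.arg (spectrum ℂ (w : F)) :=
    (finite_spectrum (w : F)).continuousOn _
  rw [selfAdjoint.expUnitary_coe, Unitary.argSelfAdjoint_coe,
    ← CFC.exp_eq_normedSpace_exp (𝕜 := ℂ), ← cfc_comp_smul .., ← cfc_comp' ..]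
  conv_rhs => rw [← cfc_id' ℂ (w : F)]
  refine cfc_congr fun y hy => ?_
  have hy₁ : ‖y‖ = 1 := spectrum.norm_eq_one_of_unitary w.2 hy
  have : Complex.I * y.arg = Complex.log y :=
    Complex.ext (by simp [Complex.log_re, hy₁]) (by simp [Complex.log_im])
  have hy0 : y ≠ 0 := fun h => by simp [h] at hy₁
  simpa [← Complex.exp_eq_exp_ℂ, this] using Complex.exp_log hy0

/-- Every selfadjoint element of a finite-dimensional C*-algebra is the sum of a central element and
a difference of two commuting selfadjoint elements that are conjugate by an exponential unitary. -/
theorem exists_central_add_conjugate_difference [PartialOrder F] [StarOrderedRing F] {T : F}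
    (hT : IsSelfAdjoint T) :
    ∃ (K : selfAdjoint F) (S E : F), IsSelfAdjoint S ∧ IsSelfAdjoint E ∧ (∀ x, Commute E x) ∧
      T = E + (S - selfAdjoint.expUnitary K * S * star (selfAdjoint.expUnitary K : F)) ∧
      Commute S (selfAdjoint.expUnitary K * S * star (selfAdjoint.expUnitary K : F)) := by
  obtain ⟨P, hP, hTP, hmin⟩ := exists_minimal_projections hT
  let q : P → F := fun i => i
  have hq : ∀ i, IsStarProjection (q i) := fun i => hP.proj i i.2
  have hort : ∀ i j, i ≠ j → q i * q j = 0 :=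
    fun i j hij => hP.orth i i.2 j j.2 fun h => hij (Subtype.ext h)
  have hsum : ∑ i, q i = 1 := by
    rw [← hP.sum_eq]
    exact Finset.sum_coe_sort P (fun x => x)
  have hmin' : ∀ i x, ∃ c : ℂ, q i * x * q i = c • q i := fun i x => hmin i i.2 x
  choose a ha using fun i : P => hTP i i.2
  obtain ⟨σ, hσ, hinv⟩ := exists_perm_of_setoid (projectionSetoid q hq)
  obtain ⟨w, hw, hwq⟩ := exists_unitary_permuting hq hort hsum σ hσ
  obtain ⟨s, e, he, hae⟩ := exists_average_add_coboundary σ a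
  obtain ⟨K, hK⟩ := exists_expUnitary_eq ⟨w, hw⟩
  -- `D f` is the diagonal element with entries `f`; conjugation by `w` permutes the entries.
  let D : (P → ℝ) → F := fun f => ∑ i, f i • q i
  have hDD : ∀ f g, D f * D g = D (fun i => f i * g i) := by
    intro f g
    simp only [D, Finset.sum_mul_sum]
    refine Finset.sum_congr rfl fun i _ => ?_
    rw [Finset.sum_eq_single i, smul_mul_smul_comm, (hq i).isIdempotentElem]
    · intro j _ hji
      rw [smul_mul_smul_comm, hort i j hji.symm, smul_zero]
    · simp
  have hDc : ∀ f g, Commute (D f) (D g) := by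
    intro f g
    rw [Commute, SemiconjBy, hDD, hDD]
    simp only [mul_comm]
  have hDsa : ∀ f, IsSelfAdjoint (D f) := by
    intro f
    simp only [D, isSelfAdjoint_iff, star_sum, star_smul, star_trivial,
      (hq _).isSelfAdjoint.star_eq]
  have hTD : T = D a := by
    rw [← mul_one T, ← hsum, Finset.mul_sum]
    exact Finset.sum_congr rfl fun i _ => ha i
  have hconj : w * D s * star w = D (fun i => s (σ⁻¹ i)) := by
    simp only [D, Finset.mul_sum, Finset.sum_mul]
    rw [← Equiv.sum_comp σ (fun i => s (σ⁻¹ i) • q i)]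
    refine Finset.sum_congr rfl fun i _ => ?_
    rw [mul_smul_comm, smul_mul_assoc, hwq, show σ⁻¹ (σ i) = i from σ.symm_apply_apply i]
  -- A diagonal element is central if its entries agree on equivalent projections.
  have hcentral : ∀ x, Commute (D e) x := by
    intro x
    have h1 : D e * x = ∑ i, ∑ j, e i • (q i * x * q j) := by
      conv_lhs => rw [← mul_one (D e * x), ← hsum]
      rw [Finset.mul_sum, Finset.sum_comm]
      simp only [D, Finset.sum_mul, smul_mul_assoc]
    have h2 : x * D e = ∑ i, ∑ j, e j • (q i * x * q j) := by
      conv_lhs => rw [← one_mul (x * D e), ← hsum]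
      rw [Finset.sum_mul]
      simp only [D, Finset.mul_sum, mul_smul_comm, mul_assoc]
    rw [Commute, SemiconjBy, h1, h2]
    refine Finset.sum_congr rfl fun i _ => Finset.sum_congr rfl fun j _ => ?_
    by_cases h0 : q i * x * q j = 0
    · rw [h0, smul_zero, smul_zero]
    · rw [hinv ℝ e he i j (exists_partial_isometry (hq i) (hq j) (hmin' i) (hmin' j) h0)]
  have hw' : (selfAdjoint.expUnitary K : F) = w := by rw [hK]
  refine ⟨K, D s, D e, hDsa s, hDsa e, hcentral, ?_, ?_⟩
  · rw [hw', hconj, hTD]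
    simp only [D, ← Finset.sum_sub_distrib, ← Finset.sum_add_distrib, ← sub_smul, ← add_smul]
    exact Finset.sum_congr rfl fun i _ => by rw [hae i]
  · rw [hw', hconj]
    exact hDc _ _

end Transport

/-! ### The centre-valued trace -/

section CentralAverage

open MeasureTheory

variable {F : Type*} [CStarAlgebra F]

theorem norm_unitary_le_one {u : F} (hu : u ∈ unitary F) : ‖u‖ ≤ 1 := by
  cases subsingleton_or_nontrivial F
  · simp [Subsingleton.elim u 0]
  · exact (CStarRing.norm_of_mem_unitary hu).le

/-- `Φ` is the trace of `F` with values in the centre of `F`. The last field records that `Φ x` is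
an average of unitary conjugates of `x`. -/
structure IsCentralTrace (Φ : F →ₗ[ℂ] F) : Prop where
  commute : ∀ x y, Commute (Φ x) y
  trace : ∀ x y, Φ (x * y) = Φ (y * x)
  apply_central : ∀ z, (∀ y, Commute z y) → Φ z = z
  mem_convex : ∀ x (C : Set F), Convex ℝ C → IsClosed C →
    (∀ u ∈ unitary F, u * x * star u ∈ C) → Φ x ∈ C

theorem IsCentralTrace.norm_le {Φ : F →ₗ[ℂ] F} (hΦ : IsCentralTrace Φ) (x : F) :
    ‖Φ x‖ ≤ ‖x‖ := by
  have h := hΦ.mem_convex x (Metric.closedBall 0 ‖x‖) (convex_closedBall _ _)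
    Metric.isClosed_closedBall fun u hu => ?_
  · simpa using h
  · rw [mem_closedBall_zero_iff, CStarRing.norm_mul_mem_unitary _ (Unitary.star_mem hu),
      CStarRing.norm_mem_unitary_mul _ hu]

theorem IsCentralTrace.isSelfAdjoint {Φ : F →ₗ[ℂ] F} (hΦ : IsCentralTrace Φ) {x : F}
    (hx : IsSelfAdjoint x) : IsSelfAdjoint (Φ x) := by
  refine hΦ.mem_convex x {y | IsSelfAdjoint y} ?_ ?_ fun u _ => hx.conjugate u
  · intro a ha b hb s t _ _ _
    exact ((IsSelfAdjoint.all s).smul ha).add ((IsSelfAdjoint.all t).smul hb)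
  · exact isClosed_eq continuous_star continuous_id

variable [FiniteDimensional ℂ F]

theorem compactSpace_unitary : CompactSpace (unitary F) := by
  have : ProperSpace F := FiniteDimensional.proper ℂ F
  have h : IsCompact ((unitary F : Submonoid F) : Set F) := by
    refine Metric.isCompact_of_isClosed_isBounded isClosed_unitary ?_
    refine (Metric.isBounded_closedBall (x := (0 : F)) (r := 1)).subset fun u hu => ?_
    rw [mem_closedBall_zero_iff]
    exact norm_unitary_le_one hu
  exact isCompact_iff_compactSpace.mp h

/-- The central trace is the average of the conjugates of an element over the compact group of
unitaries. -/
theorem exists_central_trace (F : Type*) [CStarAlgebra F] [FiniteDimensional ℂ F] :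
    ∃ Φ : F →ₗ[ℂ] F, IsCentralTrace Φ := by
  have : CompactSpace (unitary F) := compactSpace_unitary
  let _ : MeasurableSpace (unitary F) := borel _
  have : BorelSpace (unitary F) := ⟨rfl⟩
  obtain ⟨μ, hμ, hμ1⟩ : ∃ μ : Measure (unitary F), μ.IsHaarMeasure ∧ IsProbabilityMeasure μ :=
    ⟨Measure.haarMeasure ⊤, inferInstance,
      ⟨by simpa using Measure.haarMeasure_self (K₀ := (⊤ : TopologicalSpace.PositiveCompacts
        (unitary F)))⟩⟩
  have hright : ∀ v : unitary F, μ.map (fun u => u * v) = μ := by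
    intro v
    have : IsProbabilityMeasure (μ.map (fun u => u * v)) :=
      Measure.isProbabilityMeasure_map (measurable_mul_const v).aemeasurable
    exact Measure.isHaarMeasure_eq_of_isProbabilityMeasure _ _
  have hcont : ∀ x : F, Continuous fun u : unitary F => (u : F) * x * star (u : F) := by
    intro x; fun_prop
  have hint : ∀ x : F, Integrable (fun u : unitary F => (u : F) * x * star (u : F)) μ :=
    fun x => (hcont x).integrable_of_hasCompactSupport (HasCompactSupport.of_compactSpace _)
  let Φ : F →ₗ[ℂ] F :=
    { toFun := fun x => ∫ u : unitary F, (u : F) * x * star (u : F) ∂μ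
      map_add' := fun x y => by
        rw [← integral_add (hint x) (hint y)]
        simp only [mul_add, add_mul]
      map_smul' := fun c x => by
        rw [RingHom.id_apply, ← integral_smul]
        simp only [mul_smul_comm, smul_mul_assoc] }
  have hΦ : ∀ x, Φ x = ∫ u : unitary F, (u : F) * x * star (u : F) ∂μ := fun _ => rfl
  have hspan : ∀ (p : F → Prop), (∀ u : unitary F, p u) → (∀ x y, p x → p y → p (x + y)) →
      (∀ (c : ℂ) x, p x → p (c • x)) → ∀ x, p x := by
    intro p hu hadd hsmul x
    have hx : x ∈ Submodule.span ℂ (unitary F : Set F) := by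
      rw [CStarAlgebra.span_unitary]; trivial
    induction hx using Submodule.span_induction with
    | mem x h => exact hu ⟨x, h⟩
    | zero => simpa using hsmul 0 _ (hu 1)
    | add x y _ _ h1 h2 => exact hadd x y h1 h2
    | smul c x _ h => exact hsmul c x h
  have hleft : ∀ x (v : unitary F), (v : F) * Φ x * star (v : F) = Φ x := by
    intro x v
    rw [hΦ, ← integral_const_mul_of_integrable (hint x),
      ← integral_mul_const_of_integrable ((hint x).const_mul _)]
    rw [← integral_mul_left_eq_self (fun u : unitary F => (u : F) * x * star (u : F)) v]
    simp [mul_assoc]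
  have hconj : ∀ x (v : unitary F), Φ ((v : F) * x * star (v : F)) = Φ x := by
    intro x v
    rw [hΦ, hΦ]
    conv_rhs => rw [← hright v]
    rw [integral_map (measurable_mul_const v).aemeasurable
      (hcont x).aestronglyMeasurable]
    simp [mul_assoc]
  refine ⟨Φ, fun x => ?_, fun x => ?_, fun z hz => ?_, fun x C hC hCc hu => ?_⟩
  · refine hspan _ (fun v => ?_) (fun _ _ h1 h2 => h1.add_right h2) (fun c _ h => h.smul_right c)
    have h := congrArg (· * (v : F)) (hleft x v)
    simp only [mul_assoc, Unitary.coe_star_mul_self, mul_one] at h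
    exact h.symm
  · refine hspan _ (fun v => ?_) (fun y z h1 h2 => by
        rw [mul_add, add_mul, map_add, map_add, h1, h2])
      (fun c y h => by rw [mul_smul_comm, smul_mul_assoc, map_smul, map_smul, h])
    have h := hconj (x * v) v
    rw [← h]
    simp [mul_assoc]
  · rw [hΦ]
    have : ∀ u : unitary F, (u : F) * z * star (u : F) = z := by
      intro u
      rw [← (hz u).eq, mul_assoc, Unitary.mul_star_self_of_mem u.2, mul_one]
    simp [this]
  · exact hC.integral_mem hCc (Filter.Eventually.of_forall fun u => hu u u.2) (hint x)

end CentralAverage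

/-! ### Summands of the identity as multiplication operators -/

section Approximation

variable {A : Type*} [NonUnitalCStarAlgebra A] [PartialOrder A] [StarOrderedRing A]

/-- The right-hand side is additive in `θ`. If completely positive contractions add up to nearly the
identity, and `y` is nearly a unit for `x`, then their right-hand sides are positive with a sum near
zero, so that each of them is nearly multiplication by its value at `y * y`. -/
theorem star_mul_self_sub_le (θ : A →CP A) (hθ : ∀ a, ‖θ a‖ ≤ ‖a‖) {y : A}
    (hy : IsSelfAdjoint y) (hy1 : ‖y‖ ≤ 1) (x : A) :
    star (θ (y * x) - θ (y * y) * x) * (θ (y * x) - θ (y * y) * x)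
      ≤ star x * θ (y * y) * x - star x * θ (y * x) - θ (star x * y) * x
        + θ (star x * x) := by
  set e := θ (y * y) with he
  set Y := θ (y * x) with hY
  have hesa : star e = e := by rw [he, ← map_star, star_mul, hy.star_eq]
  have hYs : θ (star x * y) = star Y := by rw [hY, ← map_star, star_mul, hy.star_eq]
  have he1 : ‖e‖ ≤ 1 := by
    refine (hθ _).trans ((norm_mul_le _ _).trans ?_)
    exact mul_le_one₀ hy1 (norm_nonneg _) hy1
  set Z := Y - e * x with hZ
  -- The form is minimal at `-(x + e⁻¹ * Z)` if `e` is invertible. Replacing `e⁻¹ * Z` by `Z` is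
  -- harmless, because `star Z * e * Z ≤ star Z * Z`.
  have h := cp_quadratic_nonneg θ y x (-(x + Z))
  rw [hy.star_eq, hYs, ← he, ← hY] at h
  have h2 : star Z * e * Z ≤ star Z * Z := by
    refine (CStarAlgebra.star_left_conjugate_le_norm_smul (a := Z) (b := e) hesa).trans ?_
    calc ‖e‖ • (star Z * Z) ≤ (1 : ℝ) • (star Z * Z) :=
          smul_le_smul_of_nonneg_right he1 (star_mul_self_nonneg Z)
      _ = star Z * Z := one_smul _ _
  rw [hYs, ← sub_nonneg]
  have h3 := add_nonneg h (sub_nonneg.mpr h2)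
  convert h3 using 1
  have hZs : star Z = star Y - star x * e := by rw [hZ, star_sub, star_mul, hesa]
  have hYZ : Y = Z + e * x := by rw [hZ]; abel
  have hYZs : star Y = star Z + star x * e := by rw [hZs]; abel
  rw [hYZs, hYZ, star_neg, star_add]
  noncomm_ring

/-- The composition of completely positive maps. -/
def cpComp {B C : Type*} [NonUnitalCStarAlgebra B] [PartialOrder B] [StarOrderedRing B]
    [NonUnitalCStarAlgebra C] [PartialOrder C] [StarOrderedRing C]
    (φ : B →CP C) (ψ : A →CP B) : A →CP C where
  toLinearMap := φ.toLinearMap ∘ₗ ψ.toLinearMap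
  map_cstarMatrix_nonneg' k M hM :=
    φ.map_cstarMatrix_nonneg' k _ (ψ.map_cstarMatrix_nonneg' k M hM)

theorem exists_approximate_unit (S : Finset A) {δ : ℝ} (hδ : 0 < δ) :
    ∃ y : A, IsSelfAdjoint y ∧ ‖y‖ ≤ 1 ∧ ∀ x ∈ S, ‖y * x - x‖ ≤ δ := by
  have hl := CStarAlgebra.increasingApproximateUnit A
  have h1 : ∀ᶠ y in CStarAlgebra.approximateUnit A, ∀ x ∈ S, ‖y * x - x‖ ≤ δ := by
    rw [Filter.eventually_all_finset]
    intro x _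
    have := hl.tendsto_mul_right x
    rw [Metric.tendsto_nhds] at this
    filter_upwards [this δ hδ] with y hy
    rw [dist_eq_norm] at hy
    exact hy.le
  obtain ⟨y, ⟨hy1, hy2⟩, hy3⟩ :=
    ((h1.and hl.eventually_norm).and hl.eventually_isSelfAdjoint).exists
  exact ⟨y, hy3, hy2, hy1⟩

/-- Two completely positive contractions that add up to nearly the identity on the elements listed
in the hypotheses are nearly multiplication operators at `x`. -/
theorem norm_sub_mul_le_of_sum_approx (θ : Fin 2 → (A →CP A)) (hθ : ∀ i a, ‖θ i a‖ ≤ ‖a‖) {y : A}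
    (hy : IsSelfAdjoint y) (hy1 : ‖y‖ ≤ 1) {x : A} {δ M : ℝ} (hδ1 : δ ≤ 1) (hM : 1 ≤ M)
    (hxM : ‖x‖ ≤ M) (hyx : ‖y * x - x‖ ≤ δ)
    (h1 : ‖∑ i, θ i (y * y) - y * y‖ ≤ δ) (h2 : ‖∑ i, θ i (y * x) - y * x‖ ≤ δ)
    (h3 : ‖∑ i, θ i (star x * x) - star x * x‖ ≤ δ) (i : Fin 2) :
    ‖θ i x - θ i (y * y) * x‖ ≤ δ + M * (3 * Real.sqrt δ) := by
  have hδ0 : 0 ≤ δ := (norm_nonneg _).trans hyx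
  have hM0 : 0 ≤ M := by linarith
  let D : Fin 2 → A := fun i => star x * θ i (y * y) * x - star x * θ i (y * x)
    - θ i (star x * y) * x + θ i (star x * x)
  have hZD := fun i => star_mul_self_sub_le (θ i) (hθ i) hy hy1 x
  have hD0 : ∀ i, 0 ≤ D i := fun i => (star_mul_self_nonneg _).trans (hZD i)
  have hstar : ∀ i, θ i (star x * y) = star (θ i (y * x)) := fun i => by
    rw [← map_star, star_mul, hy.star_eq]
  have hsum : ∑ i, D i = star x * (∑ i, θ i (y * y) - y * y) * x
      - star x * (∑ i, θ i (y * x) - y * x) - star (∑ i, θ i (y * x) - y * x) * x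
      + (∑ i, θ i (star x * x) - star x * x) + star (y * x - x) * (y * x - x) := by
    simp only [D, Fin.sum_univ_two, hstar, star_sub, star_add, star_mul, hy.star_eq]
    noncomm_ring
  have hx0 := norm_nonneg x
  have hDn : ‖∑ i, D i‖ ≤ 5 * M ^ 2 * δ := by
    rw [hsum]
    have e1 : ‖star x * (∑ i, θ i (y * y) - y * y) * x‖ ≤ M * δ * M := by
      refine (norm_mul_le _ _).trans ?_
      refine mul_le_mul ((norm_mul_le _ _).trans ?_) hxM hx0 (by positivity)
      rw [norm_star]
      exact mul_le_mul hxM h1 (norm_nonneg _) hM0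
    have e2 : ‖star x * (∑ i, θ i (y * x) - y * x)‖ ≤ M * δ := by
      refine (norm_mul_le _ _).trans ?_
      rw [norm_star]
      exact mul_le_mul hxM h2 (norm_nonneg _) hM0
    have e3 : ‖star (∑ i, θ i (y * x) - y * x) * x‖ ≤ δ * M := by
      refine (norm_mul_le _ _).trans ?_
      rw [norm_star]
      exact mul_le_mul h2 hxM hx0 hδ0
    have e4 : ‖star (y * x - x) * (y * x - x)‖ ≤ δ := by
      rw [CStarRing.norm_star_mul_self]
      nlinarith [norm_nonneg (y * x - x)]
    refine (norm_add_le _ _).trans ?_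
    refine (add_le_add ((norm_add_le _ _).trans (add_le_add ((norm_sub_le _ _).trans
      (add_le_add ((norm_sub_le _ _).trans (add_le_add e1 e2)) e3)) h3)) e4).trans ?_
    nlinarith [mul_nonneg hδ0 (by nlinarith : (0 : ℝ) ≤ M ^ 2 - M),
      mul_nonneg hδ0 (by nlinarith : (0 : ℝ) ≤ M ^ 2 - 1)]
  have hZn : ‖θ i (y * x) - θ i (y * y) * x‖ ≤ M * (3 * Real.sqrt δ) := by
    have hle : D i ≤ ∑ i, D i := Finset.single_le_sum (fun j _ => hD0 j) (Finset.mem_univ i)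
    have h := CStarAlgebra.norm_le_norm_of_nonneg_of_le (star_mul_self_nonneg _)
      ((hZD i).trans hle)
    rw [CStarRing.norm_star_mul_self] at h
    refine abs_le_of_sq_le_sq' (b := M * (3 * Real.sqrt δ)) ?_ (by positivity) |>.2
    have := Real.sq_sqrt hδ0
    calc _ = ‖θ i (y * x) - θ i (y * y) * x‖ * ‖θ i (y * x) - θ i (y * y) * x‖ := sq _
      _ ≤ 5 * M ^ 2 * δ := h.trans hDn
      _ ≤ 9 * M ^ 2 * δ := by nlinarith [mul_nonneg (sq_nonneg M) hδ0]
      _ = _ := by rw [mul_pow, mul_pow, this]; ring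
  have e : θ i x - θ i (y * y) * x = -θ i (y * x - x) + (θ i (y * x) - θ i (y * y) * x) := by
    rw [map_sub]; abel
  rw [e]
  refine (norm_add_le _ _).trans (add_le_add ?_ hZn)
  rw [norm_neg]
  exact (hθ i _).trans hyx

end Approximation

/-! ### Cutting down by a resolvent -/

section Resolvent

variable {F : Type*} [CStarAlgebra F] [PartialOrder F] [StarOrderedRing F]

theorem exists_resolvent {g : F} (hg : 0 ≤ g) {η : ℝ} (hη : 0 < η) :
    ∃ R : F, 0 ≤ R ∧ η • R + R * g = 1 ∧ η • R + g * R = 1 ∧ ‖R‖ ≤ η⁻¹ := by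
  have hpos : ∀ t ∈ spectrum ℝ g, 0 < t + η := fun t ht =>
    add_pos_of_nonneg_of_pos (spectrum_nonneg_of_nonneg hg ht) hη
  have hc : ContinuousOn (fun t : ℝ => (t + η)⁻¹) (spectrum ℝ g) :=
    ContinuousOn.inv₀ (by fun_prop) fun t ht => (hpos t ht).ne'
  have hgsa : IsSelfAdjoint g := .of_nonneg hg
  have h1 : η • cfc (fun t : ℝ => (t + η)⁻¹) g + cfc (fun t : ℝ => (t + η)⁻¹) g * g = 1 := by
    conv_lhs =>
      enter [2, 2]
      rw [← cfc_id' ℝ g]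
    rw [← cfc_mul _ _ g hc (by fun_prop), ← cfc_const_mul η _ g hc,
      ← cfc_add g (fun t => η * (t + η)⁻¹) (fun t => (t + η)⁻¹ * t) (continuousOn_const.mul hc)
        (hc.mul continuousOn_id), ← cfc_one ℝ g]
    refine cfc_congr fun t ht => ?_
    have := (hpos t ht).ne'
    simp only [Pi.one_apply]
    field_simp
    ring
  refine ⟨cfc (fun t : ℝ => (t + η)⁻¹) g, ?_, h1, ?_, ?_⟩
  · exact cfc_nonneg fun t ht => (inv_pos.mpr (hpos t ht)).le
  · rwa [((Commute.refl g).cfc_real _).eq] at h1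
  · refine norm_cfc_le (inv_pos.mpr hη).le fun t ht => ?_
    have h2 := spectrum_nonneg_of_nonneg hg ht
    rw [Real.norm_of_nonneg (inv_pos.mpr (hpos t ht)).le]
    exact inv_anti₀ hη (by linarith)

variable {A : Type*} [NonUnitalCStarAlgebra A] [PartialOrder A] [StarOrderedRing A]

/-- The Kadison-Schwarz inequality makes `ψ (y * x)` small on the part of the spectrum of
`ψ (y * y)` near zero. -/
theorem norm_resolvent_mul_le (ψ : A →CP F) (hψ : ∀ a, ‖ψ a‖ ≤ ‖a‖) {y : A}
    (hy : IsSelfAdjoint y) (x : A) {R : F} {η : ℝ} (hη : 0 < η) (hR0 : 0 ≤ R)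
    (hR1 : η • R + R * ψ (y * y) = 1) : ‖η • R * ψ (y * x)‖ ≤ Real.sqrt η * ‖x‖ := by
  set g := ψ (y * y) with hg
  set Y := ψ (y * x) with hY
  have hYs : ψ (star x * y) = star Y := by rw [hY, ← map_star, star_mul, hy.star_eq]
  have hRsa : star R = R := IsSelfAdjoint.of_nonneg hR0
  -- The minimum of the quadratic form in `c` is approximated at `c = -R * Y`, since `R` is nearly
  -- the inverse of `g`.
  have h := cp_quadratic_nonneg ψ y x (-(R * Y))
  rw [hy.star_eq, hYs, ← hg, ← hY] at h
  have hRgR : R * g = 1 - η • R := by rw [← hR1]; abel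
  have e : star (-(R * Y)) * g * -(R * Y) + star (-(R * Y)) * Y + star Y * -(R * Y)
      + ψ (star x * x) = ψ (star x * x) - star Y * R * Y - η • (star (R * Y) * (R * Y)) := by
    have e1 : star (-(R * Y)) * g * -(R * Y) = star Y * (R * g) * R * Y := by
      rw [star_neg, star_mul, hRsa]
      noncomm_ring
    rw [e1, hRgR, star_neg, star_mul, hRsa]
    simp only [mul_sub, sub_mul, mul_one, mul_smul_comm, smul_mul_assoc, neg_mul, mul_neg,
      mul_assoc]
    abel
  rw [e] at h
  have hle : η • (star (R * Y) * (R * Y)) ≤ ψ (star x * x) := by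
    have h2 : 0 ≤ star Y * R * Y := star_left_conjugate_nonneg hR0 Y
    have h3 := add_nonneg h h2
    rw [← sub_nonneg]
    convert h3 using 1
    abel
  have hn := CStarAlgebra.norm_le_norm_of_nonneg_of_le
    (smul_nonneg hη.le (star_mul_self_nonneg (R * Y))) hle
  rw [norm_smul, CStarRing.norm_star_mul_self, Real.norm_of_nonneg hη.le] at hn
  have hn2 : ‖ψ (star x * x)‖ ≤ ‖x‖ * ‖x‖ := by
    refine (hψ _).trans ?_
    rw [CStarRing.norm_star_mul_self]
  rw [smul_mul_assoc, norm_smul, Real.norm_of_nonneg hη.le]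
  refine abs_le_of_sq_le_sq' (b := Real.sqrt η * ‖x‖) ?_ (by positivity) |>.2
  have := Real.sq_sqrt hη.le
  calc (η * ‖R * Y‖) ^ 2 = η * (η * (‖R * Y‖ * ‖R * Y‖)) := by ring
    _ ≤ η * (‖x‖ * ‖x‖) := by
      refine mul_le_mul_of_nonneg_left (hn.trans hn2) hη.le
    _ = _ := by rw [mul_pow, this]; ring

end Resolvent

/-! ### Central traces of commutators -/

section NearMultiplication

variable {A : Type*} [NonUnitalCStarAlgebra A]

/-- `NearMultiplication θ e δ a` says that `θ a` is within `δ` of both `e * a` and `a * e`. -/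
def NearMultiplication (θ : A → A) (e : A) (δ : ℝ) (a : A) : Prop :=
  ‖θ a - e * a‖ ≤ δ ∧ ‖θ a - a * e‖ ≤ δ

theorem NearMultiplication.norm_mul_sub_le {θ : A → A} (hθ : ∀ a, ‖θ a‖ ≤ ‖a‖) {e : A} {δ : ℝ}
    (he : ‖e‖ ≤ 1) {a b : A} (ha : NearMultiplication θ e δ a) (hb : NearMultiplication θ e δ b)
    (hab : NearMultiplication θ e δ (a * b)) :
    ‖θ a * θ b - e * θ (a * b)‖ ≤ δ * (‖a‖ + ‖b‖ + 1) := by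
  have hδ : 0 ≤ δ := (norm_nonneg _).trans ha.1
  have e1 : θ a * θ b - e * θ (a * b) = (θ a - e * a) * θ b + e * (a * (θ b - b * e))
      - e * (θ (a * b) - a * b * e) := by noncomm_ring
  rw [e1]
  have h1 : ‖(θ a - e * a) * θ b‖ ≤ δ * ‖b‖ :=
    (norm_mul_le _ _).trans (mul_le_mul ha.1 (hθ b) (norm_nonneg _) hδ)
  have h2 : ‖e * (a * (θ b - b * e))‖ ≤ 1 * (‖a‖ * δ) :=
    (norm_mul_le _ _).trans (mul_le_mul he ((norm_mul_le _ _).trans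
      (mul_le_mul_of_nonneg_left hb.2 (norm_nonneg _))) (norm_nonneg _) zero_le_one)
  have h3 : ‖e * (θ (a * b) - a * b * e)‖ ≤ 1 * δ :=
    (norm_mul_le _ _).trans (mul_le_mul he hab.2 (norm_nonneg _) zero_le_one)
  refine (norm_sub_le _ _).trans ((add_le_add ((norm_add_le _ _).trans (add_le_add h1 h2)) h3).trans
    (le_of_eq ?_))
  ring

theorem NearMultiplication.norm_commutator_le {θ : A → A} {e : A} {δ : ℝ}
    (he : ‖e‖ ≤ 1) {b : A} (hb : NearMultiplication θ e δ b) :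
    ‖e * θ b - θ b * e‖ ≤ 2 * δ := by
  have hδ : 0 ≤ δ := (norm_nonneg _).trans hb.1
  have e1 : e * θ b - θ b * e = e * (θ b - b * e) - (θ b - e * b) * e := by noncomm_ring
  rw [e1]
  have h1 : ‖e * (θ b - b * e)‖ ≤ 1 * δ :=
    (norm_mul_le _ _).trans (mul_le_mul he hb.2 (norm_nonneg _) zero_le_one)
  have h2 : ‖(θ b - e * b) * e‖ ≤ δ * 1 :=
    (norm_mul_le _ _).trans (mul_le_mul hb.1 he (norm_nonneg _) hδ)
  refine (norm_sub_le _ _).trans ((add_le_add h1 h2).trans (le_of_eq ?_))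
  ring

end NearMultiplication

section TraceEstimate

variable {A : Type*} [NonUnitalCStarAlgebra A] [PartialOrder A] [StarOrderedRing A]
  {F : Type*} [CStarAlgebra F] [PartialOrder F] [StarOrderedRing F] [FiniteDimensional ℂ F]

/-- The seminorm `‖φ 1 * φ x‖` is unitarily invariant and convex, so averaging over the unitaries
does not increase it. -/
theorem norm_one_mul_map_centralTrace_le {φ : F →CP A} (hφ : IsOrderZero φ) {Φ : F →ₗ[ℂ] F}
    (hΦ : IsCentralTrace Φ) (x : F) : ‖φ 1 * φ (Φ x)‖ ≤ ‖φ 1 * φ x‖ := by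
  let L : F →ₗ[ℝ] A :=
    ((LinearMap.mulLeft ℂ (φ 1)).comp φ.toLinearMap).restrictScalars ℝ
  have hL : ∀ z, L z = φ 1 * φ z := fun _ => rfl
  have : FiniteDimensional ℝ F := FiniteDimensional.complexToReal F
  have hLc : Continuous L := L.continuous_of_finiteDimensional
  have h := hΦ.mem_convex x (L ⁻¹' Metric.closedBall 0 ‖φ 1 * φ x‖)
    ((convex_closedBall _ _).linear_preimage L) (Metric.isClosed_closedBall.preimage hLc)
    fun u hu => ?_
  · simpa [hL] using h
  · rw [Set.mem_preimage, mem_closedBall_zero_iff, hL]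
    refine (hφ.norm_one_mul_map_mul_le' _ _).trans ?_
    refine (mul_le_of_le_one_right (norm_nonneg _)
      (norm_unitary_le_one (Unitary.star_mem hu))).trans ?_
    refine (hφ.norm_one_mul_map_mul_le _ _).trans ?_
    exact mul_le_of_le_one_left (norm_nonneg _) (norm_unitary_le_one hu)

/-- The composition of the central trace of `F` with `ψ` nearly vanishes on a commutator, as
seen through `φ`. With `g = ψ (y * y)` one has `ψ a * ψ b ≈ g * ψ (a * b)` in the seminorm
`‖φ 1 * φ x‖`, so that `ψ (a * b)` is nearly `R * (ψ a * ψ b)` for the approximate inverse `R` of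
`g`; since `R` nearly commutes with `ψ b`, the trace property applies. -/
theorem norm_one_mul_map_centralTrace_commutator_le {φ : F →CP A} (hφ : IsOrderZero φ)
    (hφ1 : ∀ x, ‖φ x‖ ≤ ‖x‖) {ψ : A →CP F} (hψ : ∀ a, ‖ψ a‖ ≤ ‖a‖) {Φ : F →ₗ[ℂ] F}
    (hΦ : IsCentralTrace Φ) {y : A} (hy : IsSelfAdjoint y) (hy1 : ‖y‖ ≤ 1) {a b : A} {δ η : ℝ}
    (hη : 0 < η)
    (hya : ‖y * (a * b - b * a) - (a * b - b * a)‖ ≤ δ)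
    (hma : NearMultiplication (fun x => φ (ψ x)) (φ (ψ (y * y))) δ a)
    (hmb : NearMultiplication (fun x => φ (ψ x)) (φ (ψ (y * y))) δ b)
    (hmab : NearMultiplication (fun x => φ (ψ x)) (φ (ψ (y * y))) δ (a * b))
    (hmba : NearMultiplication (fun x => φ (ψ x)) (φ (ψ (y * y))) δ (b * a)) :
    ‖φ 1 * φ (Φ (ψ (a * b - b * a)))‖ ≤ Real.sqrt η * ‖a * b - b * a‖
      + δ * (1 + 2 * η⁻¹ * (‖a‖ + ‖b‖ + 1) + 2 * η⁻¹ * η⁻¹ * ‖a‖) := by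
  set g := ψ (y * y) with hg
  have hg0 : 0 ≤ g := by
    have : 0 ≤ y * y := by
      have := star_mul_self_nonneg y
      rwa [hy.star_eq] at this
    simpa [hg] using map_nonneg ψ this
  have hyy : ‖y * y‖ ≤ 1 := (norm_mul_le _ _).trans (mul_le_one₀ hy1 (norm_nonneg _) hy1)
  have he1 : ‖φ g‖ ≤ 1 := (hφ1 _).trans ((hψ _).trans hyy)
  obtain ⟨R, hR0, hR1, hR2, hRn⟩ := exists_resolvent hg0 hη
  have hδ : 0 ≤ δ := (norm_nonneg _).trans hya
  have hη' : 0 ≤ η⁻¹ := (inv_pos.mpr hη).le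
  let N : F → ℝ := fun x => ‖φ 1 * φ x‖
  have hN_le : ∀ x, N x ≤ ‖x‖ := fun x => by
    have h1 : ‖φ 1‖ ≤ 1 := (hφ1 1).trans (norm_unitary_le_one (one_mem _))
    exact (norm_mul_le _ _).trans ((mul_le_of_le_one_left (norm_nonneg _) h1).trans (hφ1 x))
  have hN_add : ∀ x z, N (x + z) ≤ N x + N z := fun x z => by
    simp only [N, map_add, mul_add]; exact norm_add_le _ _
  have hN_sub : ∀ x z, N (x - z) ≤ N x + N z := fun x z => by
    simp only [N, map_sub, mul_sub]; exact norm_sub_le _ _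
  have hN_mul : ∀ x z, N (x * z) ≤ ‖x‖ * N z := hφ.norm_one_mul_map_mul_le
  have hN_mul' : ∀ x z, N (x * z) ≤ N x * ‖z‖ := hφ.norm_one_mul_map_mul_le'
  have hN0 : ∀ x, 0 ≤ N x := fun x => norm_nonneg _
  let X := ψ a * ψ b - g * ψ (a * b)
  let X' := ψ b * ψ a - g * ψ (b * a)
  let C := g * ψ b - ψ b * g
  let W := a * b - b * a
  have hθ : ∀ x, ‖φ (ψ x)‖ ≤ ‖x‖ := fun x => (hφ1 _).trans (hψ x)
  have hX : N X ≤ δ * (‖a‖ + ‖b‖ + 1) := by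
    have := NearMultiplication.norm_mul_sub_le hθ he1 hma hmb hmab
    simpa only [N, X, map_sub, mul_sub, ← hφ.map_mul] using this
  have hX' : N X' ≤ δ * (‖a‖ + ‖b‖ + 1) := by
    have := NearMultiplication.norm_mul_sub_le hθ he1 hmb hma hmba
    rw [add_comm ‖b‖ ‖a‖] at this
    simpa only [N, X', map_sub, mul_sub, ← hφ.map_mul] using this
  have hC : N C ≤ 2 * δ := by
    have := hmb.norm_commutator_le he1
    simpa only [N, C, map_sub, mul_sub, ← hφ.map_mul] using this
  -- The resolvent identity.
  have hcomm : ψ b * R - R * ψ b = R * C * R := by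
    have e1 : R * C * R = (η • R + R * g) * (ψ b * R) - (R * ψ b) * (η • R + g * R) := by
      simp only [C]
      simp only [add_mul, mul_add, mul_sub, sub_mul, smul_mul_assoc, mul_smul_comm, mul_assoc]
      abel
    rw [e1, hR1, hR2, one_mul, mul_one]
  have hdec : ∀ z w, ψ z = η • R * ψ z + R * w - R * (w - g * ψ z) := by
    intro z w
    have e1 : η • R * ψ z + R * w - R * (w - g * ψ z) = (η • R + R * g) * ψ z := by
      simp only [add_mul, mul_sub, smul_mul_assoc, mul_assoc]; abel
    rw [e1, hR1, one_mul]
  have hΦW : Φ (ψ W) = Φ (η • R * ψ W - R * X + R * X' + R * C * (R * ψ a)) := by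
    have e1 : ψ W = η • R * ψ W - R * X + R * X' + (R * (ψ a * ψ b) - R * (ψ b * ψ a)) := by
      have h1 := hdec (a * b) (ψ a * ψ b)
      have h2 := hdec (b * a) (ψ b * ψ a)
      have h3 : ψ W = ψ (a * b) - ψ (b * a) := map_sub _ _ _
      calc ψ W = ψ (a * b) - ψ (b * a) := h3
        _ = (η • R * ψ (a * b) + R * (ψ a * ψ b) - R * X)
            - (η • R * ψ (b * a) + R * (ψ b * ψ a) - R * X') := by
          rw [← h1, ← h2]
        _ = _ := by rw [h3, mul_sub (η • R)]; abel
    have e2 : Φ (R * (ψ a * ψ b) - R * (ψ b * ψ a)) = Φ (R * C * (R * ψ a)) := by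
      rw [map_sub, ← mul_assoc, hΦ.trace, ← mul_assoc, ← mul_assoc R, ← map_sub, ← sub_mul, hcomm,
        mul_assoc (R * C)]
    conv_lhs => rw [e1]
    rw [map_add, e2, ← map_add]
  have hηR : ‖η • R‖ ≤ 1 := by
    rw [norm_smul, Real.norm_of_nonneg hη.le]
    calc η * ‖R‖ ≤ η * η⁻¹ := mul_le_mul_of_nonneg_left hRn hη.le
      _ = 1 := mul_inv_cancel₀ hη.ne'
  have h1 : N (η • R * ψ W) ≤ Real.sqrt η * ‖W‖ + δ := by
    refine (hN_le _).trans ?_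
    have e1 : η • R * ψ W = η • R * ψ (y * W) - η • R * ψ (y * W - W) := by
      rw [map_sub ψ (y * W) W, mul_sub (η • R)]; abel
    rw [e1]
    refine (norm_sub_le _ _).trans (add_le_add (norm_resolvent_mul_le ψ hψ hy W hη hR0 hR1) ?_)
    refine (norm_mul_le _ _).trans ?_
    exact (mul_le_of_le_one_left (norm_nonneg _) hηR).trans ((hψ _).trans hya)
  have h2 : N (R * X) ≤ η⁻¹ * (δ * (‖a‖ + ‖b‖ + 1)) :=
    (hN_mul _ _).trans (mul_le_mul hRn hX (hN0 _) hη')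
  have h3 : N (R * X') ≤ η⁻¹ * (δ * (‖a‖ + ‖b‖ + 1)) :=
    (hN_mul _ _).trans (mul_le_mul hRn hX' (hN0 _) hη')
  have h4 : N (R * C * (R * ψ a)) ≤ (η⁻¹ * (2 * δ)) * (η⁻¹ * ‖a‖) := by
    refine (hN_mul' _ _).trans (mul_le_mul ((hN_mul _ _).trans (mul_le_mul hRn hC (hN0 _) hη'))
      ((norm_mul_le _ _).trans (mul_le_mul hRn (hψ a) (norm_nonneg _) hη')) (norm_nonneg _)
      (by positivity))
  change N (Φ (ψ W)) ≤ _
  rw [hΦW]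
  refine (norm_one_mul_map_centralTrace_le hφ hΦ _).trans ?_
  refine (hN_add _ _).trans ((add_le_add ((hN_add _ _).trans (add_le_add ((hN_sub _ _).trans
    (add_le_add h1 h2)) h3)) h4).trans (le_of_eq ?_))
  simp only [W]
  ring

end TraceEstimate

/-! ### Approximations compatible with the universal trace -/

section TracialApproximation

theorem exists_commutator_list {A : Type*} [NonUnitalCStarAlgebra A] {h : A}
    (hh : h ∈ closedCommutatorSpan A) {ν : ℝ} (hν : 0 < ν) :
    ∃ L : List (A × A), ‖h - (L.map fun p => p.1 * p.2 - p.2 * p.1).sum‖ ≤ ν := by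
  obtain ⟨z, hz, hd⟩ := Metric.mem_closure_iff.mp
    (show h ∈ closure (Submodule.span ℂ {z : A | ∃ x y : A, z = x * y - y * x} : Set A) from hh)
    ν hν
  have key : ∃ L : List (A × A), z = (L.map fun p => p.1 * p.2 - p.2 * p.1).sum := by
    clear hd
    induction hz using Submodule.span_induction with
    | mem x hx =>
      obtain ⟨a, b, rfl⟩ := hx
      exact ⟨[(a, b)], by simp⟩
    | zero => exact ⟨[], by simp⟩
    | add x y _ _ h1 h2 =>
      obtain ⟨L1, rfl⟩ := h1
      obtain ⟨L2, rfl⟩ := h2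
      exact ⟨L1 ++ L2, by simp⟩
    | smul c x _ h1 =>
      obtain ⟨L, rfl⟩ := h1
      refine ⟨L.map fun p => (c • p.1, p.2), ?_⟩
      rw [List.map_map, List.smul_sum, List.map_map]
      congr 1
      refine List.map_congr_left fun p _ => ?_
      simp [smul_sub, smul_mul_assoc, mul_smul_comm]
  obtain ⟨L, rfl⟩ := key
  exact ⟨L, by rw [← dist_eq_norm]; exact hd.le⟩

variable {A : Type*} [NonUnitalCStarAlgebra A] [PartialOrder A] [StarOrderedRing A]

/-- In an algebra of nuclear dimension at most one the two summands of an approximation of the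
identity are nearly multiplication operators on a given finite set, provided that the approximation
is good enough on a larger set. -/
theorem exists_near_multiplication (hA : NuclearDimensionAtMost 1 A) (S : Finset A) {δ : ℝ}
    (hδ : 0 < δ) :
    ∃ (y : A) (F : Fin 2 → Type) (_ : ∀ i, CStarAlgebra (F i)) (_ : ∀ i, PartialOrder (F i))
      (_ : ∀ i, StarOrderedRing (F i)) (_ : ∀ i, FiniteDimensional ℂ (F i))
      (ψ : ∀ i, A →CP F i) (φ : ∀ i, F i →CP A),
      IsSelfAdjoint y ∧ ‖y‖ ≤ 1 ∧ (∀ i a, ‖ψ i a‖ ≤ ‖a‖) ∧ (∀ i x, ‖φ i x‖ ≤ ‖x‖) ∧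
      (∀ i, IsOrderZero (φ i)) ∧ ∀ a ∈ S, ‖y * a - a‖ ≤ δ ∧ ‖(∑ i, φ i (ψ i a)) - a‖ ≤ δ ∧
        ∀ i, NearMultiplication (fun a => φ i (ψ i a)) (φ i (ψ i (y * y))) δ a := by
  classical
  -- Closing up under adjoints gives right multiplication from left multiplication.
  let S' : Finset A := S ∪ S.image star
  obtain ⟨M, hM1, hM⟩ : ∃ M : ℝ, 1 ≤ M ∧ ∀ x ∈ S', ‖x‖ ≤ M := by
    refine ⟨1 + ∑ x ∈ S', ‖x‖, ?_, fun x hx => ?_⟩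
    · have := Finset.sum_nonneg fun x (_ : x ∈ S') => norm_nonneg x
      linarith
    · have := Finset.single_le_sum (f := fun x => ‖x‖) (fun x _ => norm_nonneg x) hx
      linarith
  set ε : ℝ := min 1 ((δ / (4 * M)) ^ 2) with hε
  have hε0 : 0 < ε := lt_min one_pos (by positivity)
  have hε1 : ε ≤ 1 := min_le_left _ _
  have hsq : Real.sqrt ε ≤ δ / (4 * M) := by
    rw [← Real.sqrt_sq (by positivity : 0 ≤ δ / (4 * M))]
    exact Real.sqrt_le_sqrt (min_le_right _ _)
  have hεsq : ε ≤ Real.sqrt ε := by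
    have h1 := Real.sq_sqrt hε0.le
    have h2 := Real.sqrt_nonneg ε
    have h3 : Real.sqrt ε ≤ 1 := Real.sqrt_le_one.mpr hε1
    nlinarith
  have hMsq : M * Real.sqrt ε ≤ δ / 4 := by
    calc M * Real.sqrt ε ≤ M * (δ / (4 * M)) := by gcongr
      _ = δ / 4 := by field_simp
  have hεδ : ε + M * (3 * Real.sqrt ε) ≤ δ := by
    nlinarith [mul_le_mul_of_nonneg_right hM1 (Real.sqrt_nonneg ε)]
  have hεδ' : ε ≤ δ := by
    have : 0 ≤ M * (3 * Real.sqrt ε) := by positivity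
    linarith
  obtain ⟨y, hy, hy1, hyS⟩ := exists_approximate_unit S' hε0
  obtain ⟨F, i1, i2, i3, i4, ψ, φ, hψ, hφ, hφ0, happ⟩ :=
    hA (S' ∪ {y * y} ∪ S'.image (fun x => y * x) ∪ S'.image (fun x => star x * x)) ε hε0
  refine ⟨y, F, i1, i2, i3, i4, ψ, φ, hy, hy1, hψ, hφ, hφ0, ?_⟩
  have happ1 : ∀ x ∈ S', ‖(∑ i, φ i (ψ i x)) - x‖ ≤ ε := fun x hx =>
    (happ x (by simp only [Finset.mem_union]; exact Or.inl (Or.inl (Or.inl hx)))).le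
  have happ2 : ‖(∑ i, φ i (ψ i (y * y))) - y * y‖ ≤ ε := (happ _ (by simp)).le
  have happ3 : ∀ x ∈ S', ‖(∑ i, φ i (ψ i (y * x))) - y * x‖ ≤ ε := fun x hx =>
    (happ _ (by
      simp only [Finset.mem_union]
      exact Or.inl (Or.inr (Finset.mem_image_of_mem (fun x => y * x) hx)))).le
  have happ4 : ∀ x ∈ S', ‖(∑ i, φ i (ψ i (star x * x))) - star x * x‖ ≤ ε := fun x hx =>
    (happ _ (by
      simp only [Finset.mem_union]
      exact Or.inr (Finset.mem_image_of_mem (fun x => star x * x) hx))).le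
  have hnear : ∀ x ∈ S', ∀ i, ‖φ i (ψ i x) - φ i (ψ i (y * y)) * x‖ ≤ δ := fun x hx i =>
    (norm_sub_mul_le_of_sum_approx (fun i => cpComp (φ i) (ψ i))
      (fun i a => (hφ i _).trans (hψ i a)) hy hy1 hε1 hM1 (hM x hx) (hyS x hx) happ2 (happ3 x hx)
      (happ4 x hx) i).trans hεδ
  intro a ha
  have ha1 : a ∈ S' := Finset.mem_union_left _ ha
  have ha2 : star a ∈ S' := Finset.mem_union_right _ (Finset.mem_image_of_mem _ ha)
  refine ⟨(hyS a ha1).trans hεδ', (happ1 a ha1).trans hεδ', fun i => ⟨hnear a ha1 i, ?_⟩⟩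
  have h := hnear (star a) ha2 i
  rw [← norm_star, star_sub, star_mul, star_star, ← map_star (φ i), ← map_star (ψ i), star_star,
    ← map_star (φ i), ← map_star (ψ i), star_mul, hy.star_eq] at h
  exact h

/-- In an algebra of nuclear dimension at most one there are approximations of the identity whose
two summands nearly commute at given elements, and which nearly preserve the vanishing of the
universal trace. -/
theorem exists_tracial_approximation (hA : NuclearDimensionAtMost 1 A) (S : Finset A) {h : A}
    (hsa : IsSelfAdjoint h) (hh : h ∈ closedCommutatorSpan A) {ν : ℝ} (hν : 0 < ν) :
    ∃ (F : Fin 2 → Type) (_ : ∀ i, CStarAlgebra (F i)) (_ : ∀ i, PartialOrder (F i))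
      (_ : ∀ i, StarOrderedRing (F i)) (_ : ∀ i, FiniteDimensional ℂ (F i))
      (ψ : ∀ i, A →CP F i) (φ : ∀ i, F i →CP A),
      (∀ i a, ‖ψ i a‖ ≤ ‖a‖) ∧ (∀ i x, ‖φ i x‖ ≤ ‖x‖) ∧ (∀ i, IsOrderZero (φ i)) ∧
      (∀ a ∈ S, ‖a - (φ 0 (ψ 0 a) + φ 1 (ψ 1 a))‖ ≤ ν ∧
        ‖φ 0 (ψ 0 a) * φ 1 (ψ 1 a) - φ 1 (ψ 1 a) * φ 0 (ψ 0 a)‖ ≤ ν) ∧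
      ∀ i (Φ : F i →ₗ[ℂ] F i), IsCentralTrace Φ → ‖φ i (Φ (ψ i h))‖ ≤ ν := by
  classical
  -- The norm of `φ x` is controlled by the square root of `‖φ 1 * φ x‖`, which is bounded by
  -- `3 * ρ`: one `ρ` for the distance to a sum of commutators, one for the term with `√η`, one for
  -- that with `δ` in the estimate for commutators.
  set ρ : ℝ := ν ^ 2 / (3 * (‖h‖ + 1)) with hρ
  have hρ0 : 0 < ρ := by positivity
  obtain ⟨L, hL⟩ := exists_commutator_list hh hρ0
  let W : A × A → A := fun p => p.1 * p.2 - p.2 * p.1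
  have hsum0 : ∀ f : A × A → ℝ, (∀ p, 0 ≤ f p) → 0 ≤ (L.map f).sum := fun f hf =>
    List.sum_nonneg fun x hx => by
      obtain ⟨p, -, rfl⟩ := List.mem_map.mp hx
      exact hf p
  set c1 : ℝ := (L.map fun p => ‖W p‖).sum with hc1
  have hc10 : 0 ≤ c1 := hsum0 _ fun p => norm_nonneg _
  set η : ℝ := (ρ / (c1 + 1)) ^ 2 with hη
  have hη0 : 0 < η := by positivity
  have hsη : Real.sqrt η * c1 ≤ ρ := by
    rw [hη, Real.sqrt_sq (by positivity), div_mul_eq_mul_div, div_le_iff₀ (by positivity)]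
    nlinarith
  let K : A × A → ℝ := fun p =>
    1 + 2 * η⁻¹ * (‖p.1‖ + ‖p.2‖ + 1) + 2 * η⁻¹ * η⁻¹ * ‖p.1‖
  set c2 : ℝ := (L.map K).sum with hc2
  have hc20 : 0 ≤ c2 := hsum0 _ fun p => by positivity
  set c3 : ℝ := ∑ a ∈ S, ‖a‖ with hc3
  have hc30 : 0 ≤ c3 := Finset.sum_nonneg fun a _ => norm_nonneg a
  set δ : ℝ := min (ρ / (c2 + 1)) (ν / (4 * (c3 + 1))) with hδ
  have hδ0 : 0 < δ := lt_min (by positivity) (by positivity)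
  have hδ1 : δ * c2 ≤ ρ := by
    calc δ * c2 ≤ ρ / (c2 + 1) * c2 := mul_le_mul_of_nonneg_right (min_le_left _ _) hc20
      _ ≤ ρ := by
        rw [div_mul_eq_mul_div, div_le_iff₀ (by positivity)]
        nlinarith
  have hδ2 : 4 * δ * (c3 + 1) ≤ ν := by
    calc 4 * δ * (c3 + 1) ≤ 4 * (ν / (4 * (c3 + 1))) * (c3 + 1) := by
          gcongr
          exact min_le_right _ _
      _ = ν := by field_simp
  let T : Finset A := S ∪ (L.flatMap fun p => [p.1, p.2, p.1 * p.2, p.2 * p.1, W p]).toFinset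
  obtain ⟨y, F, i1, i2, i3, i4, ψ, φ, hy, hy1, hψ, hφ, hφ0, hT⟩ :=
    exists_near_multiplication hA T hδ0
  refine ⟨F, i1, i2, i3, i4, ψ, φ, hψ, hφ, hφ0, fun a ha => ?_, fun i Φ hΦ => ?_⟩
  · obtain ⟨-, h2, h3⟩ := hT a (Finset.mem_union_left _ ha)
    rw [Fin.sum_univ_two] at h2
    obtain ⟨h3, h4⟩ := h3 0
    have hac : ‖a‖ ≤ c3 := Finset.single_le_sum (f := fun x => ‖x‖) (fun x _ => norm_nonneg x) ha
    simp only at h3 h4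
    set s := φ 0 (ψ 0 a) with hs
    set t := φ 1 (ψ 1 a) with ht
    set e := φ 0 (ψ 0 (y * y)) with he
    have hsn : ‖s‖ ≤ ‖a‖ := (hφ _ _).trans (hψ _ _)
    constructor
    · rw [norm_sub_rev]
      nlinarith
    · -- `t` is nearly `a - s`, and `s` nearly commutes with `a`.
      have e1 : s * t - t * s = s * (s + t - a) - (s + t - a) * s
          + (a * (e * a - s) - (a * e - s) * a) := by noncomm_ring
      have b1 : ‖s * (s + t - a)‖ ≤ ‖a‖ * δ :=
        (norm_mul_le _ _).trans (mul_le_mul hsn h2 (norm_nonneg _) (norm_nonneg _))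
      have b2 : ‖(s + t - a) * s‖ ≤ δ * ‖a‖ :=
        (norm_mul_le _ _).trans (mul_le_mul h2 hsn (norm_nonneg _) hδ0.le)
      have b3 : ‖a * (e * a - s)‖ ≤ ‖a‖ * δ := by
        refine (norm_mul_le _ _).trans (mul_le_mul_of_nonneg_left ?_ (norm_nonneg _))
        rwa [norm_sub_rev]
      have b4 : ‖(a * e - s) * a‖ ≤ δ * ‖a‖ := by
        refine (norm_mul_le _ _).trans (mul_le_mul_of_nonneg_right ?_ (norm_nonneg _))
        rwa [norm_sub_rev]
      rw [e1]
      refine (norm_add_le _ _).trans ((add_le_add ((norm_sub_le _ _).trans (add_le_add b1 b2))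
        ((norm_sub_le _ _).trans (add_le_add b3 b4))).trans ?_)
      nlinarith
  · have hpair : ∀ p ∈ L, ‖φ i 1 * φ i (Φ (ψ i (W p)))‖ ≤ Real.sqrt η * ‖W p‖ + δ * K p := by
      intro p hp
      have hmem : ∀ x ∈ [p.1, p.2, p.1 * p.2, p.2 * p.1, W p], x ∈ T := by
        intro x hx
        refine Finset.mem_union_right _ ?_
        rw [List.mem_toFinset, List.mem_flatMap]
        exact ⟨p, hp, hx⟩
      exact norm_one_mul_map_centralTrace_commutator_le (hφ0 i) (hφ i) (hψ i) hΦ hy hy1 hη0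
        (hT _ (hmem _ (by simp [W]))).1 ((hT _ (hmem _ (by simp))).2.2 i)
        ((hT _ (hmem _ (by simp))).2.2 i) ((hT _ (hmem _ (by simp))).2.2 i)
        ((hT _ (hmem _ (by simp))).2.2 i)
    have hlist : ∀ L' : List (A × A), (∀ p ∈ L', p ∈ L) →
        ‖φ i 1 * φ i (Φ (ψ i (L'.map W).sum))‖
          ≤ Real.sqrt η * (L'.map fun p => ‖W p‖).sum + δ * (L'.map K).sum := by
      intro L'
      induction L' with
      | nil => simp
      | cons p L' ih =>
        intro hp
        simp only [List.map_cons, List.sum_cons, map_add, mul_add]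
        have h1 := hpair p (hp p (by simp))
        have h2 := ih fun q hq => hp q (by simp [hq])
        refine (norm_add_le _ _).trans ?_
        linarith
    have hone : ‖φ i 1‖ ≤ 1 := (hφ i 1).trans (norm_unitary_le_one (one_mem _))
    have hN : ‖φ i 1 * φ i (Φ (ψ i h))‖ ≤ 3 * ρ := by
      have e1 : h = (h - (L.map W).sum) + (L.map W).sum := by abel
      rw [e1, map_add, map_add, map_add, mul_add]
      have h1 : ‖φ i 1 * φ i (Φ (ψ i (h - (L.map W).sum)))‖ ≤ ρ := by
        refine (norm_mul_le _ _).trans ((mul_le_of_le_one_left (norm_nonneg _) hone).trans ?_)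
        exact (hφ i _).trans ((hΦ.norm_le _).trans ((hψ i _).trans hL))
      have h2 := hlist L fun p hp => hp
      refine (norm_add_le _ _).trans ?_
      linarith
    have hΦsa : IsSelfAdjoint (Φ (ψ i h)) :=
      hΦ.isSelfAdjoint (by rw [isSelfAdjoint_iff, ← map_star, hsa.star_eq])
    have h3 := (hφ0 i).norm_map_sq_le hΦsa
    have h4 : ‖Φ (ψ i h)‖ ≤ ‖h‖ := (hΦ.norm_le _).trans (hψ i h)
    refine abs_le_of_sq_le_sq' (b := ν) (h3.trans ?_) hν.le |>.2
    calc ‖Φ (ψ i h)‖ * ‖φ i 1 * φ i (Φ (ψ i h))‖ ≤ ‖h‖ * (3 * ρ) :=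
          mul_le_mul h4 hN (norm_nonneg _) (norm_nonneg _)
      _ ≤ (‖h‖ + 1) * (3 * ρ) := by gcongr; linarith
      _ = ν ^ 2 := by rw [hρ]; field_simp

end TracialApproximation

/-! ### The trace of the logarithm -/

section Logarithm

open Filter

variable {B : Type*} [CStarAlgebra B]

/-- The Taylor series of the logarithm at `1` converges to the logarithm given by the functional
calculus. -/
theorem hasSum_log_unitary (u : unitary B) {δ : ℝ} (hδ : δ < 1) (hu : ‖(u : B) - 1‖ ≤ δ) :
    HasSum (fun n : ℕ => (((-1) ^ n / (n + 1) : ℂ)) • ((u : B) - 1) ^ (n + 1))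
      (Complex.I • (Unitary.argSelfAdjoint u : B)) := by
  cases subsingleton_or_nontrivial B
  · simp only [Subsingleton.elim _ (0 : B)]
    exact hasSum_zero
  have hδ0 : 0 ≤ δ := (norm_nonneg _).trans hu
  have hbound : ∀ (n : ℕ), ‖((-1) ^ n / (n + 1) : ℂ)‖ ≤ 1 := by
    intro n
    rw [norm_div, norm_pow, norm_neg, norm_one, one_pow]
    have : ‖(n + 1 : ℂ)‖ = n + 1 := by
      rw [← Nat.cast_succ, Complex.norm_natCast]; push_cast; rfl
    rw [this]
    exact div_le_one_of_le₀ (by linarith [n.cast_nonneg (α := ℝ)]) (by positivity)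
  have hsummable : Summable fun n : ℕ => δ ^ (n + 1) :=
    (summable_nat_add_iff 1).mpr (summable_geometric_of_lt_one hδ0 hδ)
  have hnorm : ∀ n : ℕ, ‖(((-1) ^ n / (n + 1) : ℂ)) • ((u : B) - 1) ^ (n + 1)‖ ≤ δ ^ (n + 1) := by
    intro n
    rw [norm_smul]
    refine (mul_le_of_le_one_left (norm_nonneg _) (hbound n)).trans ?_
    exact (norm_pow_le _ _).trans (pow_le_pow_left₀ (norm_nonneg _) hu _)
  rw [(Summable.of_norm_bounded hsummable hnorm).hasSum_iff_tendsto_nat]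
  let f : ℕ → ℂ → ℂ := fun n z => ((-1) ^ n / (n + 1) : ℂ) * (z - 1) ^ (n + 1)
  have hspec : ∀ z ∈ spectrum ℂ (u : B), ‖z - 1‖ ≤ δ := by
    intro z hz
    have h1 : z - 1 ∈ spectrum ℂ ((u : B) - 1) := by
      have := spectrum.sub_singleton_eq (a := (u : B)) (r := (1 : ℂ))
      rw [map_one] at this
      rw [← this]
      exact Set.sub_mem_sub hz rfl
    exact (spectrum.norm_le_norm_of_mem h1).trans hu
  have hlog : ∀ z ∈ spectrum ℂ (u : B), ∑' n, f n z = Complex.I * z.arg := by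
    intro z hz
    have hy₁ : ‖z‖ = 1 := spectrum.norm_eq_one_of_unitary u.2 hz
    have h1 : Complex.I * z.arg = Complex.log z :=
      Complex.ext (by simp [Complex.log_re, hy₁]) (by simp [Complex.log_im])
    have h2 := Complex.hasSum_taylorSeries_log ((hspec z hz).trans_lt hδ)
    rw [add_sub_cancel] at h2
    have h3 := (hasSum_nat_add_iff' 1).mpr h2
    simp only [Finset.range_one, Finset.sum_singleton, Nat.cast_zero, div_zero, sub_zero] at h3
    rw [h1, ← h3.tsum_eq]
    refine tsum_congr fun n => ?_
    simp only [f]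
    push_cast
    ring
  have hcont : ∀ n, Continuous (f n) := fun n => by fun_prop
  have hcfc : ∀ n, cfc (f n) (u : B) = (((-1) ^ n / (n + 1) : ℂ)) • ((u : B) - 1) ^ (n + 1) := by
    intro n
    have e1 : cfc (fun z : ℂ => z - 1) (u : B) = (u : B) - 1 := by
      rw [cfc_sub .., cfc_id' ℂ (u : B), cfc_const_one ℂ (u : B)]
    rw [cfc_const_mul _ _ _ (by fun_prop), cfc_pow _ _ _ (by fun_prop), e1]
  have harg : cfc (fun z : ℂ => Complex.I * z.arg) (u : B)
      = Complex.I • (Unitary.argSelfAdjoint u : B) := by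
    have hc : ContinuousOn Complex.arg (spectrum ℂ (u : B)) :=
      Complex.continuousOn_arg.mono <|
        (Unitary.spectrum_subset_slitPlane_iff_norm_lt_two u.2).mpr (by linarith)
    rw [Unitary.argSelfAdjoint_coe, cfc_const_mul ..]
  have ht := tendsto_cfc_fun (a := (u : B)) (l := atTop)
    (F := fun N => ∑ n ∈ Finset.range N, f n) (f := fun z => ∑' n, f n z) ?_ ?_
  · rw [cfc_congr (fun z hz => hlog z hz), harg] at ht
    refine ht.congr fun N => ?_
    rw [cfc_sum _ _ _ fun n _ => (hcont n).continuousOn]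
    exact Finset.sum_congr rfl fun n _ => hcfc n
  · have h := tendstoUniformlyOn_tsum_nat (f := f) hsummable (s := spectrum ℂ (u : B)) ?_
    · convert h using 2 with N
      ext z
      simp
    · intro n z hz
      rw [norm_mul, norm_pow]
      refine (mul_le_of_le_one_left (by positivity) (hbound n)).trans ?_
      exact pow_le_pow_left₀ (norm_nonneg _) (hspec z hz) _
  · refine Eventually.of_forall fun N => ?_
    have : Continuous (∑ n ∈ Finset.range N, f n) := by
      rw [show (∑ n ∈ Finset.range N, f n) = fun z => ∑ n ∈ Finset.range N, f n z by
        ext z; simp]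
      exact continuous_finsetSum _ fun n _ => hcont n
    exact this.continuousOn

/-- Chords and arcs of the unit circle have comparable lengths. -/
theorem norm_argSelfAdjoint_le (u : unitary B) (hu : ‖(u : B) - 1‖ < 2) :
    ‖Unitary.argSelfAdjoint u‖ ≤ 2 * ‖(u : B) - 1‖ := by
  have h1 := Unitary.two_mul_one_sub_cos_norm_argSelfAdjoint hu
  have h2 := Unitary.norm_argSelfAdjoint_le_pi u
  set c := ‖Unitary.argSelfAdjoint u‖
  have hc : 0 ≤ c := norm_nonneg _
  have h3 := Real.cos_le_one_sub_mul_cos_sq (x := c) (by rwa [abs_of_nonneg hc])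
  have h4 : c ^ 2 ≤ (2 * ‖(u : B) - 1‖) ^ 2 := by
    have hpi := Real.pi_lt_four
    have hpi0 := Real.pi_pos
    have h5 : 4 / Real.pi ^ 2 * c ^ 2 ≤ ‖(u : B) - 1‖ ^ 2 := by
      have : 4 / Real.pi ^ 2 * c ^ 2 = 2 * (2 / Real.pi ^ 2 * c ^ 2) := by ring
      linarith
    have h6 : 1 ≤ 4 * (4 / Real.pi ^ 2) := by
      rw [← mul_div_assoc, le_div_iff₀ (by positivity)]
      nlinarith
    nlinarith [sq_nonneg c]
  exact abs_le_of_sq_le_sq' h4 (by positivity) |>.2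

variable {E : Type*} [NormedAddCommGroup E] [NormedSpace ℂ E] [CompleteSpace E]

/-- Along a differentiable path of unitaries near `1`, the trace of the logarithm has the trace of
the logarithmic derivative as its derivative. -/
theorem hasDerivAt_trace_log (τ : B →L[ℂ] E) (hτ : ∀ x y, τ (x * y) = τ (y * x))
    {γ : ℝ → unitary B} {γ' : ℝ → B} {s : Set ℝ} (hs : IsOpen s) (hs' : IsPreconnected s)
    {δ C : ℝ} (hδ : δ < 1) (hγ : ∀ t ∈ s, ‖(γ t : B) - 1‖ ≤ δ)
    (hd : ∀ t ∈ s, HasDerivAt (fun t => (γ t : B)) (γ' t) t) (hC : ∀ t ∈ s, ‖γ' t‖ ≤ C)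
    {t : ℝ} (ht : t ∈ s) :
    HasDerivAt (fun t => ∑' n : ℕ, τ ((((-1) ^ n / (n + 1) : ℂ)) • ((γ t : B) - 1) ^ (n + 1)))
      (τ (star (γ t : B) * γ' t)) t := by
  have hδ0 : 0 ≤ δ := (norm_nonneg _).trans (hγ t ht)
  have hC0 : 0 ≤ C := (norm_nonneg _).trans (hC t ht)
  have hg : ∀ (n : ℕ) (t), t ∈ s → HasDerivAt
      (fun t => τ ((((-1) ^ n / (n + 1) : ℂ)) • ((γ t : B) - 1) ^ (n + 1)))
      (((-1) ^ n : ℂ) • τ (((γ t : B) - 1) ^ n * γ' t)) t := by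
    intro n t ht
    have h1 := ((hd t ht).sub_const 1).fun_pow' (n + 1)
    have h2 : HasDerivAt (fun t => τ (((γ t : B) - 1) ^ (n + 1))) _ t :=
      (τ.restrictScalars ℝ).hasFDerivAt.comp_hasDerivAt t h1
    have e : (fun t => τ ((((-1) ^ n / (n + 1) : ℂ)) • ((γ t : B) - 1) ^ (n + 1)))
        = fun t => ((-1) ^ n / (n + 1) : ℂ) • τ (((γ t : B) - 1) ^ (n + 1)) := by
      ext t; rw [map_smul]
    rw [e]
    convert h2.const_smul ((-1) ^ n / (n + 1) : ℂ) using 1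
    · rfl
    simp only [ContinuousLinearMap.coe_restrictScalars', map_sum]
    -- Under a trace the factor `γ'` may be moved to the end.
    have h3 : ∀ i ∈ Finset.range (n + 1), τ (((γ t : B) - 1) ^ ((n + 1).pred - i) * γ' t
        * ((γ t : B) - 1) ^ i) = τ (((γ t : B) - 1) ^ n * γ' t) := by
      intro i hi
      rw [hτ, ← mul_assoc, ← pow_add]
      have := Finset.mem_range.mp hi
      congr 3
      simp only [Nat.pred_succ]
      omega
    rw [Finset.sum_congr rfl h3, Finset.sum_const, Finset.card_range, ← Nat.cast_smul_eq_nsmul ℂ,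
      smul_smul]
    congr 1
    have : (n + 1 : ℂ) ≠ 0 := by exact_mod_cast Nat.succ_ne_zero n
    push_cast
    field_simp
  have hpow : ∀ n : ℕ, 0 < n → ∀ t ∈ s, ‖((γ t : B) - 1) ^ n‖ ≤ δ ^ n := fun n hn t ht =>
    (norm_pow_le' _ hn).trans (pow_le_pow_left₀ (norm_nonneg _) (hγ t ht) _)
  have hsum : Summable fun n : ℕ => ‖τ‖ * (δ ^ n * C) :=
    ((summable_geometric_of_lt_one hδ0 hδ).mul_right C).mul_left _
  have hb : ∀ (n : ℕ) (t), t ∈ s →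
      ‖((-1) ^ n : ℂ) • τ (((γ t : B) - 1) ^ n * γ' t)‖ ≤ ‖τ‖ * (δ ^ n * C) := by
    intro n t ht
    rw [norm_smul, norm_pow, norm_neg, norm_one, one_pow, one_mul]
    refine (τ.le_opNorm _).trans (mul_le_mul_of_nonneg_left ?_ (norm_nonneg _))
    rcases Nat.eq_zero_or_pos n with rfl | hn
    · simpa using hC t ht
    · exact (norm_mul_le _ _).trans (mul_le_mul (hpow n hn t ht) (hC t ht) (norm_nonneg _)
        (by positivity))
  have h0 := ((hasSum_log_unitary (γ t) hδ (hγ t ht)).mapL τ).summable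
  have h := hasDerivAt_tsum_of_isPreconnected hsum hs hs' hg hb ht h0 ht
  convert h using 1
  -- The differentiated series is geometric, with sum the inverse of `γ t`.
  have hx : ‖-((γ t : B) - 1)‖ < 1 := by rw [norm_neg]; exact (hγ t ht).trans_lt hδ
  have hgeo : HasSum (fun n : ℕ => (-((γ t : B) - 1)) ^ n) (star (γ t : B)) := by
    have h1 := (summable_geometric_of_norm_lt_one hx).hasSum
    convert h1 using 1
    have h2 := geom_series_mul_neg (-((γ t : B) - 1)) hx
    rw [sub_neg_eq_add, add_sub_cancel] at h2
    calc star (γ t : B) = (∑' n : ℕ, (-((γ t : B) - 1)) ^ n) * (γ t : B) * star (γ t : B) := by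
          rw [h2, one_mul]
      _ = _ := by rw [mul_assoc, Unitary.mul_star_self_of_mem (γ t).2, mul_one]
  have h2 := (hgeo.mul_right (γ' t)).mapL τ
  rw [← h2.tsum_eq]
  refine tsum_congr fun n => ?_
  rw [← map_smul, ← smul_mul_assoc]
  rcases Nat.even_or_odd n with hn | hn
  · rw [hn.neg_one_pow, hn.neg_pow, one_smul]
  · rw [hn.neg_one_pow, hn.neg_pow, neg_smul, one_smul]

end Logarithm

open selfAdjoint Unitary

/-! ### Products of exponentials -/

section Paths

variable {B : Type*} [CStarAlgebra B]

theorem hasDerivAt_expUnitary_smul (x : selfAdjoint B) (t : ℝ) :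
    HasDerivAt (fun t : ℝ => (expUnitary (t • x) : B))
      (expUnitary (t • x) * (Complex.I • (x : B))) t := by
  have e : ∀ t : ℝ, (expUnitary (t • x) : B) = NormedSpace.exp (t • (Complex.I • (x : B))) := by
    intro t
    rw [expUnitary_coe, selfAdjoint.val_smul, smul_comm]
  simp only [e]
  exact hasDerivAt_exp_smul_const (𝕂 := ℝ) _ t

/-- The path `t ↦ e ^ (i t x₁) ⋯ e ^ (i t xₙ)` of unitaries attached to a list of selfadjoint
elements. -/
noncomputable def expProd (l : List (selfAdjoint B)) (t : ℝ) : unitary B :=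
  (l.map fun x => expUnitary (t • x)).prod

theorem expProd_cons (x : selfAdjoint B) (l : List (selfAdjoint B)) (t : ℝ) :
    expProd (x :: l) t = expUnitary (t • x) * expProd l t := by
  simp [expProd]

theorem expProd_append (l l' : List (selfAdjoint B)) (t : ℝ) :
    expProd (l ++ l') t = expProd l t * expProd l' t := by
  simp [expProd]

theorem expUnitary_neg_eq_inv (x : selfAdjoint B) : expUnitary (-x) = (expUnitary x)⁻¹ := by
  rw [eq_inv_iff_mul_eq_one, ← Commute.expUnitary_add (by simp), neg_add_cancel, expUnitary_zero]

theorem expProd_reverse_neg (l : List (selfAdjoint B)) (t : ℝ) :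
    expProd (l.map Neg.neg).reverse t = (expProd l t)⁻¹ := by
  rw [expProd, expProd, List.prod_inv_reverse, List.map_reverse, List.map_map, List.map_map]
  congr 3
  ext x
  simp [expUnitary_neg_eq_inv]

theorem norm_inv_mul_sub_one (u v : unitary B) :
    ‖((v⁻¹ * u : unitary B) : B) - 1‖ = ‖(u : B) - v‖ := by
  rw [← CStarRing.norm_coe_unitary_mul v, mul_sub, mul_one, ← Submonoid.coe_mul,
    mul_inv_cancel_left]

theorem expProd_one (l : List (selfAdjoint B)) : expProd l 1 = (l.map expUnitary).prod := by
  simp [expProd]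

theorem expProd_zero (l : List (selfAdjoint B)) : expProd l 0 = 1 := by
  simp [expProd]

variable {E : Type*} [NormedAddCommGroup E] [NormedSpace ℂ E]

/-- The logarithmic derivative of a product of exponentials is a sum of conjugates of the
exponents. -/
theorem exists_hasDerivAt_expProd (τ : B →L[ℂ] E) (hτ : ∀ x y, τ (x * y) = τ (y * x))
    (l : List (selfAdjoint B)) (t : ℝ) :
    ∃ d : B, HasDerivAt (fun t => (expProd l t : B)) d t ∧
      ‖d‖ ≤ (l.map fun x : selfAdjoint B => ‖x‖).sum ∧
      τ (star (expProd l t : B) * d)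
        = Complex.I • τ (l.map fun x : selfAdjoint B => (x : B)).sum := by
  induction l with
  | nil => exact ⟨0, by simpa [expProd] using hasDerivAt_const t (1 : B), by simp, by simp⟩
  | cons x l ih =>
    obtain ⟨d, hd, hn, ht⟩ := ih
    refine ⟨expUnitary (t • x) * (Complex.I • (x : B)) * expProd l t + expUnitary (t • x) * d,
      ?_, ?_, ?_⟩
    · simp only [expProd_cons, Submonoid.coe_mul]
      exact (hasDerivAt_expUnitary_smul x t).mul hd
    · rw [List.map_cons, List.sum_cons]
      refine (norm_add_le _ _).trans (add_le_add ?_ ?_)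
      · refine (norm_mul_le _ _).trans ((mul_le_of_le_one_right (norm_nonneg _)
          (norm_unitary_le_one (Subtype.prop _))).trans ((norm_mul_le _ _).trans
          ((mul_le_of_le_one_left (norm_nonneg _)
            (norm_unitary_le_one (Subtype.prop _))).trans ?_)))
        rw [norm_smul, Complex.norm_I, one_mul]
        rfl
      · exact (norm_mul_le _ _).trans ((mul_le_of_le_one_left (norm_nonneg _)
          (norm_unitary_le_one (Subtype.prop _))).trans hn)
    · have h1 : star (expUnitary (t • x) : B) * expUnitary (t • x) = 1 :=
        Unitary.star_mul_self_of_mem (expUnitary (t • x)).2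
      have h2 : (expProd l t : B) * star (expProd l t : B) = 1 :=
        Unitary.mul_star_self_of_mem (expProd l t).2
      have e : star (expProd (x :: l) t : B) *
          (expUnitary (t • x) * (Complex.I • (x : B)) * expProd l t + expUnitary (t • x) * d)
          = star (expProd l t : B) * ((Complex.I • (x : B)) * expProd l t)
            + star (expProd l t : B) * d := by
        rw [expProd_cons, Submonoid.coe_mul, star_mul, mul_add]
        congr 1
        · calc _ = star (expProd l t : B) * (star (expUnitary (t • x) : B) * expUnitary (t • x))
                * ((Complex.I • (x : B)) * expProd l t) := by noncomm_ring
            _ = _ := by rw [h1, mul_one]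
        · calc _ = star (expProd l t : B) * (star (expUnitary (t • x) : B) * expUnitary (t • x))
                * d := by noncomm_ring
            _ = _ := by rw [h1, mul_one]
      rw [e, map_add, ht, hτ, mul_assoc, h2, mul_one, List.map_cons, List.sum_cons, map_add,
        smul_add, map_smul]

variable [CompleteSpace E]

/-- As long as the path of products of exponentials stays close to `1`, the trace of the
logarithm of its end point is the trace of the sum of the exponents. -/
theorem trace_argSelfAdjoint_expProd (τ : B →L[ℂ] E) (hτ : ∀ x y, τ (x * y) = τ (y * x))
    (l : List (selfAdjoint B)) {δ : ℝ} (hδ : δ < 1)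
    (h : ∀ t ∈ Set.Ioo (-1 : ℝ) 2, ‖(expProd l t : B) - 1‖ ≤ δ) :
    τ (Unitary.argSelfAdjoint (expProd l 1) : B)
      = τ (l.map fun x : selfAdjoint B => (x : B)).sum := by
  choose d hd hn hτd using exists_hasDerivAt_expProd τ hτ l
  let G : ℝ → E := fun t =>
    ∑' n : ℕ, τ ((((-1) ^ n / (n + 1) : ℂ)) • ((expProd l t : B) - 1) ^ (n + 1))
  have hG : ∀ t ∈ Set.Ioo (-1 : ℝ) 2,
      HasDerivAt G (Complex.I • τ (l.map fun x : selfAdjoint B => (x : B)).sum) t := by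
    intro t ht
    rw [← hτd t]
    exact hasDerivAt_trace_log τ hτ isOpen_Ioo isPreconnected_Ioo hδ h (fun t _ => hd t)
      (fun t _ => hn t) ht
  have hG0 : G 0 = 0 := by simp [G, expProd_zero]
  have hG1 : G 1 = Complex.I • τ (Unitary.argSelfAdjoint (expProd l 1) : B) := by
    rw [← map_smul]
    exact ((hasSum_log_unitary _ hδ (h 1 (by norm_num))).mapL τ).tsum_eq
  have hconst := norm_image_sub_le_of_norm_deriv_le_segment_01'
    (f := fun t : ℝ => G t - t • (Complex.I • τ (l.map fun x : selfAdjoint B => (x : B)).sum))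
    (f' := 0) (C := 0)
    (fun t ht => by
      have h1 := (hG t ⟨by linarith [ht.1], by linarith [ht.2]⟩).sub
        ((hasDerivAt_id t).smul_const
          (Complex.I • τ (l.map fun x : selfAdjoint B => (x : B)).sum))
      rw [one_smul, sub_self] at h1
      exact h1.hasDerivWithinAt) (fun t _ => by simp)
  simp only [norm_le_zero_iff, hG0, hG1, zero_smul, one_smul, sub_zero] at hconst
  exact smul_right_injective E Complex.I_ne_zero (sub_eq_zero.mp hconst)

end Paths

/-! ### Exponentials in the unitization -/

section Unitization

variable {A : Type*} [NonUnitalCStarAlgebra A]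

/-- The inclusion of the selfadjoint elements of `A` into those of its unitization. -/
def inrSelfAdjoint (h : selfAdjoint A) : selfAdjoint (Unitization ℂ A) :=
  ⟨((h : A) : Unitization ℂ A), IsSelfAdjoint.inr (R := ℂ) h.2⟩

theorem expUnitization_eq (h : selfAdjoint A) :
    expUnitization h = expUnitary (inrSelfAdjoint h) := rfl

theorem mem_unitaryZeroOfNonUnital_iff {u : unitary (Unitization ℂ A)} :
    u ∈ unitaryZeroOfNonUnital A ↔ u ∈ unitaryZero (Unitization ℂ A) ∧
      (u : Unitization ℂ A).fst = 1 := by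
  rw [unitaryZeroOfNonUnital, Subgroup.mem_inf, MonoidHom.mem_ker, Subtype.ext_iff]
  rfl

theorem expUnitary_mem_unitaryZero {B : Type*} [CStarAlgebra B] (x : selfAdjoint B) :
    expUnitary x ∈ unitaryZero B :=
  pathComponent_subset_component 1 (joined_one_expUnitary x)

theorem expUnitization_mem (h : selfAdjoint A) : expUnitization h ∈ unitaryZeroOfNonUnital A := by
  rw [mem_unitaryZeroOfNonUnital_iff]
  refine ⟨expUnitary_mem_unitaryZero _, ?_⟩
  let +nondep : NormedAlgebra ℚ (Unitization ℂ A) := .restrictScalars ℚ ℂ _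
  have h1 : (Unitization.fstHom ℂ A).toRingHom (NormedSpace.exp
      (Complex.I • ((h : A) : Unitization ℂ A)))
      = NormedSpace.exp ((Unitization.fstHom ℂ A).toRingHom
        (Complex.I • ((h : A) : Unitization ℂ A))) :=
    NormedSpace.map_exp _ Unitization.continuous_fst _
  have h2 : (Unitization.fstHom ℂ A).toRingHom (Complex.I • ((h : A) : Unitization ℂ A)) = 0 := by
    simp
  rw [h2, NormedSpace.exp_zero] at h1
  exact h1

instance : IsClosed (closedCommutatorSpan A : Set A) := Submodule.isClosed_topologicalClosure _

theorem trEquiv_iff {a b : A} : TrEquiv a b ↔ a - b ∈ closedCommutatorSpan A :=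
  Submodule.Quotient.mk_eq_zero _

theorem mul_sub_mul_mem (x y : A) : x * y - y * x ∈ closedCommutatorSpan A :=
  Submodule.le_topologicalClosure _ (Submodule.subset_span ⟨x, y, rfl⟩)

/-- The extension of the universal trace to the unitization that vanishes at `1`. -/
noncomputable def unitizationTrace (A : Type*) [NonUnitalCStarAlgebra A] :
    Unitization ℂ A →L[ℂ] A ⧸ closedCommutatorSpan A :=
  { toFun := fun x => (closedCommutatorSpan A).mkQ x.snd
    map_add' := fun x y => by rw [Unitization.snd_add, map_add]
    map_smul' := fun r x => by rw [Unitization.snd_smul, map_smul, RingHom.id_apply]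
    cont := continuous_quotient_mk'.comp Unitization.continuous_snd }

theorem unitizationTrace_apply (x : Unitization ℂ A) :
    unitizationTrace A x = (closedCommutatorSpan A).mkQ x.snd := rfl

theorem unitizationTrace_mul_comm (x y : Unitization ℂ A) :
    unitizationTrace A (x * y) = unitizationTrace A (y * x) := by
  rw [← sub_eq_zero, unitizationTrace_apply, unitizationTrace_apply, ← map_sub,
    Submodule.mkQ_apply, Submodule.Quotient.mk_eq_zero]
  convert mul_sub_mul_mem x.snd y.snd using 1
  simp only [Unitization.snd_mul]
  abel

/-- The logarithm series of a unitary `1 + x` with `x` in `A` has its terms in `A`. -/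
theorem fst_argSelfAdjoint {u : unitary (Unitization ℂ A)}
    (hu : (u : Unitization ℂ A).fst = 1) {δ : ℝ} (hδ : δ < 1)
    (h : ‖(u : Unitization ℂ A) - 1‖ ≤ δ) :
    (Unitary.argSelfAdjoint u : Unitization ℂ A).fst = 0 := by
  have h1 := (hasSum_log_unitary u hδ h).map (Unitization.fstHom ℂ A) Unitization.continuous_fst
  have h2 : (⇑(Unitization.fstHom ℂ A) ∘ fun n : ℕ =>
      (((-1) ^ n / (n + 1) : ℂ)) • ((u : Unitization ℂ A) - 1) ^ (n + 1)) = 0 := by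
    ext n
    have : Unitization.fstHom ℂ A (u : Unitization ℂ A) = 1 := hu
    rw [Function.comp_apply, map_smul, map_pow, map_sub, this, map_one, sub_self,
      zero_pow n.succ_ne_zero, smul_zero, Pi.zero_apply]
  rw [h2, map_smul] at h1
  exact (smul_eq_zero.mp (h1.unique hasSum_zero)).resolve_left Complex.I_ne_zero

/-- If two paths of products of exponentials stay close to each other, then their end points differ
by a small exponential `e ^ (i c)`, where the trace of `c` is the difference of the traces of the
sums of the exponents. -/
theorem exists_expUnitization_of_norm_sub_le (l l' : List (selfAdjoint A)) {δ : ℝ} (hδ : δ < 1)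
    (h : ∀ t ∈ Set.Ioo (-1 : ℝ) 2,
      ‖(expProd (l.map inrSelfAdjoint) t : Unitization ℂ A)
        - expProd (l'.map inrSelfAdjoint) t‖ ≤ δ) :
    ∃ c : selfAdjoint A, expProd (l.map inrSelfAdjoint) 1
        = expProd (l'.map inrSelfAdjoint) 1 * expUnitization c ∧
      TrEquiv (c : A) ((l.map fun x : selfAdjoint A => (x : A)).sum
        - (l'.map fun x : selfAdjoint A => (x : A)).sum) ∧
      ‖(c : A)‖ ≤ 2 * δ := by
  -- `m` is the list for the product of the inverse of the second path with the first.
  set m := ((l'.map inrSelfAdjoint).map Neg.neg).reverse ++ l.map inrSelfAdjoint with hm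
  have hprod : ∀ t, expProd m t
      = (expProd (l'.map inrSelfAdjoint) t)⁻¹ * expProd (l.map inrSelfAdjoint) t := fun t => by
    rw [hm, expProd_append, expProd_reverse_neg]
  have hnear : ∀ t ∈ Set.Ioo (-1 : ℝ) 2, ‖(expProd m t : Unitization ℂ A) - 1‖ ≤ δ := by
    intro t ht
    rw [hprod, norm_inv_mul_sub_one]
    exact h t ht
  have hmem : ∀ l : List (selfAdjoint A), expProd (l.map inrSelfAdjoint) 1
      ∈ unitaryZeroOfNonUnital A := by
    intro l
    rw [expProd_one, List.map_map]
    refine Subgroup.list_prod_mem _ fun x hx => ?_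
    rw [List.mem_map] at hx
    obtain ⟨y, -, rfl⟩ := hx
    exact expUnitization_mem y
  have hfst : (expProd m 1 : Unitization ℂ A).fst = 1 := by
    have := Subgroup.mul_mem _ (Subgroup.inv_mem _ (hmem l')) (hmem l)
    rw [← hprod] at this
    exact (mem_unitaryZeroOfNonUnital_iff.mp this).2
  set b := Unitary.argSelfAdjoint (expProd m 1) with hb
  have h1 := hnear 1 (by norm_num)
  have hb0 : (b : Unitization ℂ A).fst = 0 := fst_argSelfAdjoint hfst hδ h1
  have hb1 : ((b : Unitization ℂ A).snd : Unitization ℂ A) = b := by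
    ext
    · rw [Unitization.fst_inr, hb0]
    · rw [Unitization.snd_inr]
  have hsa : IsSelfAdjoint (b : Unitization ℂ A).snd := by
    have : star (b : Unitization ℂ A).snd = (star (b : Unitization ℂ A)).snd :=
      (Unitization.snd_star _).symm
    rw [IsSelfAdjoint, this, b.2.star_eq]
  refine ⟨⟨(b : Unitization ℂ A).snd, hsa⟩, ?_, ?_, ?_⟩
  · have e : expUnitization ⟨(b : Unitization ℂ A).snd, hsa⟩ = expProd m 1 := by
      rw [expUnitization_eq, ← expUnitary_argSelfAdjoint (h1.trans_lt (by linarith)), ← hb]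
      congr 1
      exact Subtype.ext hb1
    rw [e, hprod, mul_inv_cancel_left]
  · have h2 := trace_argSelfAdjoint_expProd (unitizationTrace A) unitizationTrace_mul_comm m hδ
      hnear
    rw [trEquiv_iff, ← Submodule.Quotient.mk_eq_zero, Submodule.Quotient.mk_sub, sub_eq_zero]
    refine h2.trans ?_
    rw [unitizationTrace_apply, Submodule.mkQ_apply]
    congr 1
    have hs : ∀ l : List (selfAdjoint A),
        ((l.map inrSelfAdjoint).map fun x : selfAdjoint (Unitization ℂ A) =>
            (x : Unitization ℂ A)).sum.snd
          = (l.map fun x : selfAdjoint A => (x : A)).sum := by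
      intro l
      induction l with
      | nil => rfl
      | cons x l ih =>
        rw [List.map_cons, List.map_cons, List.sum_cons, Unitization.snd_add, ih, List.map_cons,
          List.sum_cons]
        rfl
    have hs' : (((l'.map inrSelfAdjoint).map Neg.neg).map fun x : selfAdjoint (Unitization ℂ A) =>
        (x : Unitization ℂ A)).sum.snd
          = -(l'.map fun x : selfAdjoint A => (x : A)).sum := by
      clear * -
      induction l' with
      | nil => simp
      | cons x l ih =>
        rw [List.map_cons, List.map_cons, List.map_cons, List.sum_cons, Unitization.snd_add, ih,
          List.map_cons, List.sum_cons, neg_add]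
        rfl
    rw [hm, List.map_append, List.sum_append, Unitization.snd_add, hs, List.map_reverse,
      List.sum_reverse, hs', neg_add_eq_sub]
  · have h3 := norm_argSelfAdjoint_le (expProd m 1) (h1.trans_lt (by linarith))
    calc ‖(b : Unitization ℂ A).snd‖ = ‖((b : Unitization ℂ A).snd : Unitization ℂ A)‖ :=
          (Unitization.norm_inr _).symm
      _ = ‖(b : Unitization ℂ A)‖ := by rw [hb1]
      _ ≤ 2 * δ := h3.trans (by linarith)

end Unitization

/-! ### Estimates for exponentials -/

section Closeness

variable {B : Type*} [CStarAlgebra B]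

theorem norm_coe_unitary_mul_mul_le (u v : unitary B) (x : B) : ‖(u : B) * x * v‖ ≤ ‖x‖ := by
  refine (norm_mul_le _ _).trans ((mul_le_of_le_one_right (norm_nonneg _)
    (norm_unitary_le_one v.2)).trans ?_)
  exact (norm_mul_le _ _).trans (mul_le_of_le_one_left (norm_nonneg _) (norm_unitary_le_one u.2))

theorem coe_expUnitary_mul_neg (x : selfAdjoint B) :
    (expUnitary x : B) * (expUnitary (-x) : B) = 1 := by
  rw [expUnitary_neg_eq_inv, ← Submonoid.coe_mul, mul_inv_cancel, OneMemClass.coe_one]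

theorem coe_expUnitary_neg_mul (x : selfAdjoint B) :
    (expUnitary (-x) : B) * (expUnitary x : B) = 1 := by
  rw [expUnitary_neg_eq_inv, ← Submonoid.coe_mul, inv_mul_cancel, OneMemClass.coe_one]

theorem hasDerivAt_expUnitary_smul' (x : selfAdjoint B) (t : ℝ) :
    HasDerivAt (fun t : ℝ => (expUnitary (t • x) : B))
      ((Complex.I • (x : B)) * expUnitary (t • x)) t := by
  convert hasDerivAt_expUnitary_smul x t using 1
  rw [expUnitary_coe]
  refine (Commute.exp_right ?_).eq
  rw [selfAdjoint.val_smul]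
  exact (((Commute.refl (x : B)).smul_right t).smul_right Complex.I).smul_left Complex.I

/-- This is the mean value inequality for `t ↦ e ^ (i t x) * y * e ^ (-i t x)`. -/
theorem norm_expUnitary_mul_sub_mul_le (x : selfAdjoint B) (y : B) :
    ‖expUnitary x * y - y * expUnitary x‖ ≤ ‖(x : B) * y - y * x‖ := by
  have hd : ∀ t : ℝ, HasDerivAt
      (fun t : ℝ => (expUnitary (t • x) : B) * y * (expUnitary (t • -x) : B))
      ((expUnitary (t • x) : B) * ((Complex.I • (x : B)) * y - y * (Complex.I • (x : B)))
        * (expUnitary (t • -x) : B)) t := by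
    intro t
    refine (((hasDerivAt_expUnitary_smul x t).mul_const y).fun_mul
      (hasDerivAt_expUnitary_smul' (-x) t)).congr_deriv ?_
    rw [AddSubgroup.coe_neg, smul_neg Complex.I]
    noncomm_ring
  have h := norm_image_sub_le_of_norm_deriv_le_segment_01'
    (fun t _ => (hd t).hasDerivWithinAt) (C := ‖(x : B) * y - y * x‖) (fun t _ => by
      refine (norm_coe_unitary_mul_mul_le _ _ _).trans ?_
      rw [smul_mul_assoc, mul_smul_comm, ← smul_sub, norm_smul, Complex.norm_I, one_mul])
  simp only [one_smul, zero_smul, expUnitary_zero, OneMemClass.coe_one, one_mul, mul_one] at h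
  have e : expUnitary x * y - y * expUnitary x
      = ((1 : unitary B) : B) * (expUnitary x * y * (expUnitary (-x) : B) - y) * expUnitary x := by
    rw [OneMemClass.coe_one, one_mul, sub_mul, mul_assoc _ _ (expUnitary x : B),
      coe_expUnitary_neg_mul, mul_one]
  rw [e]
  exact (norm_coe_unitary_mul_mul_le _ _ _).trans h

/-- Exponentials turn sums of nearly commuting elements into products, up to a small error: this is
the mean value inequality for `t ↦ e ^ (-i t h) * e ^ (i t a) * e ^ (i t b)`. -/
theorem norm_expUnitary_sub_mul_le (h a b : selfAdjoint B) :
    ‖(expUnitary h : B) - expUnitary a * expUnitary b‖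
      ≤ ‖(h : B) - (a + b)‖ + ‖(a : B) * b - b * a‖ := by
  have hd : ∀ t : ℝ, HasDerivAt (fun t : ℝ => (expUnitary (t • -h) : B)
        * ((expUnitary (t • a) : B) * (expUnitary (t • b) : B)))
      ((expUnitary (t • -h) : B)
        * ((Complex.I • (a : B) + Complex.I • (b : B) - Complex.I • (h : B)) * expUnitary (t • a)
          + ((expUnitary (t • a) : B) * (Complex.I • (b : B))
          - (Complex.I • (b : B)) * expUnitary (t • a))) * (expUnitary (t • b) : B)) t := by
    intro t
    refine ((hasDerivAt_expUnitary_smul (-h) t).fun_mul ((hasDerivAt_expUnitary_smul' a t).fun_mul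
      (hasDerivAt_expUnitary_smul' b t))).congr_deriv ?_
    rw [AddSubgroup.coe_neg, smul_neg Complex.I]
    noncomm_ring
  have h1 := norm_image_sub_le_of_norm_deriv_le_segment_01'
    (fun t _ => (hd t).hasDerivWithinAt) (C := ‖(h : B) - (a + b)‖ + ‖(a : B) * b - b * a‖)
    (fun t ht => by
      refine (norm_coe_unitary_mul_mul_le _ _ _).trans ((norm_add_le _ _).trans
        (add_le_add ?_ ?_))
      · refine (norm_mul_le _ _).trans ((mul_le_of_le_one_right (norm_nonneg _)
          (norm_unitary_le_one (expUnitary (t • a)).2)).trans ?_)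
        rw [← smul_add, ← smul_sub, norm_smul, Complex.norm_I, one_mul, norm_sub_rev]
      · rw [smul_mul_assoc, mul_smul_comm, ← smul_sub, norm_smul, Complex.norm_I, one_mul]
        refine (norm_expUnitary_mul_sub_mul_le _ _).trans ?_
        rw [selfAdjoint.val_smul, smul_mul_assoc, mul_smul_comm, ← smul_sub, norm_smul,
          Real.norm_of_nonneg ht.1]
        exact mul_le_of_le_one_left (norm_nonneg _) ht.2.le)
  simp only [one_smul, zero_smul, expUnitary_zero, OneMemClass.coe_one, mul_one] at h1
  have e : (expUnitary h : B) - expUnitary a * expUnitary b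
      = -(expUnitary h * ((expUnitary (-h) : B) * (expUnitary a * expUnitary b) - 1)
        * ((1 : unitary B) : B)) := by
    rw [OneMemClass.coe_one, mul_one, mul_sub, ← mul_assoc, coe_expUnitary_mul_neg, one_mul,
      mul_one, neg_sub]
  rw [e, norm_neg]
  exact (norm_coe_unitary_mul_mul_le _ _ _).trans h1

theorem norm_expUnitary_sub_le (a b : selfAdjoint B) :
    ‖(expUnitary a : B) - expUnitary b‖ ≤ ‖(a : B) - b‖ := by
  simpa using norm_expUnitary_sub_mul_le a b 0

theorem norm_mul_unitary_sub_mul_le (u u' v v' : unitary B) :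
    ‖((u * u' : unitary B) : B) - (v * v' : unitary B)‖ ≤ ‖(u : B) - v‖ + ‖(u' : B) - v'‖ := by
  have e : ((u * u' : unitary B) : B) - (v * v' : unitary B)
      = ((1 : unitary B) : B) * ((u : B) - v) * u'
        + v * ((u' : B) - v') * ((1 : unitary B) : B) := by
    simp only [Submonoid.coe_mul, OneMemClass.coe_one]
    noncomm_ring
  rw [e]
  exact (norm_add_le _ _).trans (add_le_add (norm_coe_unitary_mul_mul_le _ _ _)
    (norm_coe_unitary_mul_mul_le _ _ _))

theorem norm_prod_unitary_sub_le {J : Type*} (L : List J) (u v : J → unitary B) {η : ℝ}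
    (h : ∀ j, ‖(u j : B) - v j‖ ≤ η) :
    ‖((L.map u).prod : B) - ((L.map v).prod : unitary B)‖ ≤ L.length * η := by
  induction L with
  | nil => simp
  | cons x L ih =>
    rw [List.map_cons, List.prod_cons, List.map_cons, List.prod_cons]
    refine (norm_mul_unitary_sub_mul_le _ _ _ _).trans ?_
    rw [List.length_cons, Nat.cast_succ, add_mul, one_mul, add_comm]
    exact add_le_add ih (h x)

end Closeness

/-! ### Commutators from order zero maps -/

section Cutoff

variable {A : Type*} [NonUnitalCStarAlgebra A] [PartialOrder A] [StarOrderedRing A]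

/-- Approximate inverses in the algebra generated by a positive element: `r` is an approximate unit
for `p`, and `q` inverts `p` on the support of `r`. -/
theorem exists_cutoff {p : A} (hp : 0 ≤ p) {ε : ℝ} (hε : 0 < ε) :
    ∃ r q : A, IsSelfAdjoint r ∧ IsSelfAdjoint q ∧ r * q * p = r ∧ ‖r‖ ≤ 1 ∧
      ‖p - r * p‖ ≤ 2 * ε ∧ Commute r q ∧ ∀ x, Commute p x → Commute r x ∧ Commute q x := by
  have hps : IsSelfAdjoint p := hp.isSelfAdjoint
  -- `f` rises from `0` to `1` between `ε` and `2 * ε`, and `g` is `t⁻¹` for `ε ≤ t`.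
  let f : ℝ → ℝ := fun t => min 1 (max 0 ((t - ε) / ε))
  let g : ℝ → ℝ := fun t => t / (max t ε) ^ 2
  have hf0 : f 0 = 0 := by
    have : (0 - ε) / ε = -1 := by rw [zero_sub, neg_div, div_self hε.ne']
    simp only [f, this]
    norm_num
  have hg0 : g 0 = 0 := by simp [g]
  have hfc : Continuous f := by fun_prop
  have hgc : Continuous g := by
    refine continuous_id.div (by fun_prop) fun t => ?_
    have : 0 < max t ε := lt_max_of_lt_right hε
    positivity
  have hf1 : ∀ t, ‖f t‖ ≤ 1 := fun t => by
    rw [Real.norm_of_nonneg (le_min zero_le_one (le_max_left _ _))]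
    exact min_le_left _ _
  refine ⟨cfcₙ f p, cfcₙ g p, cfcₙ_predicate _ _, cfcₙ_predicate _ _, ?_,
    norm_cfcₙ_le fun t _ => hf1 t, ?_, cfcₙ_commute_cfcₙ f g p,
    fun x hx => ⟨hx.cfcₙ_real f, hx.cfcₙ_real g⟩⟩
  · have h2 : cfcₙ (fun t : ℝ => f t * g t * t) p = cfcₙ f p * cfcₙ g p * p := by
      rw [cfcₙ_mul (fun t => f t * g t) (fun t => t) p (hfc.mul hgc).continuousOn (by simp [hf0])
        continuousOn_id rfl, cfcₙ_mul f g p hfc.continuousOn hf0 hgc.continuousOn hg0,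
        cfcₙ_id' ℝ p]
    rw [← h2]
    refine cfcₙ_congr fun t _ => ?_
    rcases le_total t ε with ht | ht
    · have : f t = 0 := by
        have h3 : (t - ε) / ε ≤ 0 := div_nonpos_of_nonpos_of_nonneg (by linarith) hε.le
        simp only [f, max_eq_left h3]
        norm_num
      simp [this]
    · have ht0 : t ≠ 0 := (hε.trans_le ht).ne'
      simp only [g, max_eq_left ht]
      field_simp
  · have h2 : cfcₙ (fun t : ℝ => t - f t * t) p = p - cfcₙ f p * p := by
      rw [cfcₙ_sub (fun t => t) (fun t => f t * t) p continuousOn_id rfl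
        (hfc.mul continuous_id).continuousOn (by simp), cfcₙ_id' ℝ p,
        cfcₙ_mul f (fun t => t) p hfc.continuousOn hf0 continuousOn_id rfl, cfcₙ_id' ℝ p]
    rw [← h2]
    refine norm_cfcₙ_le fun t ht => ?_
    have ht0 : 0 ≤ t := quasispectrum_nonneg_of_nonneg p hp t ht
    have hft : 0 ≤ f t := le_min zero_le_one (le_max_left _ _)
    have hft1 : f t ≤ 1 := min_le_left _ _
    rcases le_total t (2 * ε) with h | h
    · rw [Real.norm_of_nonneg (by nlinarith)]
      nlinarith
    · have : f t = 1 := by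
        have h3 : 1 ≤ (t - ε) / ε := by rw [le_div_iff₀ hε]; linarith
        exact min_eq_left (h3.trans (le_max_right _ _))
      rw [this, one_mul, sub_self, norm_zero]
      positivity

end Cutoff

section Rotation

variable {A : Type*} [NonUnitalCStarAlgebra A]
variable {F : Type*} [CStarAlgebra F] [FiniteDimensional ℂ F]

/-- If an element acts on the range of `ρ` like left multiplication by `x`, then its exponential
acts like left multiplication by the exponential of `x`. -/
theorem exp_mul_map (ρ : F →ₗ[ℂ] A) {x : F} {y : Unitization ℂ A}
    (h : ∀ z, y * (ρ z : Unitization ℂ A) = (ρ (x * z) : Unitization ℂ A)) (z : F) :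
    NormedSpace.exp y * (ρ z : Unitization ℂ A)
      = (ρ (NormedSpace.exp x * z) : Unitization ℂ A) := by
  have hpow : ∀ (n : ℕ) z, y ^ n * (ρ z : Unitization ℂ A)
      = (ρ (x ^ n * z) : Unitization ℂ A) := by
    intro n
    induction n with
    | zero => simp
    | succ n ih => intro z; rw [pow_succ, mul_assoc, h, ih, pow_succ, mul_assoc]
  have h1 := (NormedSpace.exp_series_hasSum_exp' (𝕂 := ℂ) y).mul_right (ρ z : Unitization ℂ A)
  let M : F →ₗ[ℂ] A := ρ ∘ₗ LinearMap.mulRight ℂ z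
  have hM : Continuous fun w : F => ((M w : A) : Unitization ℂ A) :=
    Unitization.continuous_inr.comp M.continuous_of_finiteDimensional
  have h2 := (NormedSpace.exp_series_hasSum_exp' (𝕂 := ℂ) x).map
    ((Unitization.inrHom ℂ ℂ A).toAddMonoidHom.comp M.toAddMonoidHom) hM
  have e : (fun n : ℕ => ((n.factorial : ℂ)⁻¹ • y ^ n) * (ρ z : Unitization ℂ A))
      = (((Unitization.inrHom ℂ ℂ A).toAddMonoidHom.comp M.toAddMonoidHom) ∘
        fun n : ℕ => (n.factorial : ℂ)⁻¹ • x ^ n) := by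
    ext1 n
    have h3 : M ((n.factorial : ℂ)⁻¹ • x ^ n) = (n.factorial : ℂ)⁻¹ • ρ (x ^ n * z) := by
      rw [map_smul]; rfl
    rw [smul_mul_assoc, hpow, ← Unitization.inr_smul ℂ, ← h3]
    rfl
  rw [e] at h1
  exact h1.unique h2

theorem expUnitary_conj {B : Type*} [CStarAlgebra B] (u : unitary B) {x y : selfAdjoint B}
    (h : (y : B) = u * x * star (u : B)) : expUnitary y = u * expUnitary x * u⁻¹ := by
  let +nondep : NormedAlgebra ℚ B := .restrictScalars ℚ ℂ B
  ext
  have h1 := NormedSpace.exp_units_conj (Unitary.toUnits u) (Complex.I • (x : B))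
  rw [Submonoid.coe_mul, Submonoid.coe_mul, expUnitary_coe, expUnitary_coe, h]
  rw [← smul_mul_assoc, ← mul_smul_comm]
  exact h1

variable [PartialOrder A] [StarOrderedRing A] [PartialOrder F] [StarOrderedRing F]

/-- An order zero map is close to a map `ρ` into its cone for which inner automorphisms of `F` are
implemented by unitaries of `U⁰(A)`. The exponential of the image of an element of trace zero is
therefore a commutator. -/
theorem IsOrderZero.exists_commutator_model {φ : F →CP A} (hφ : IsOrderZero φ)
    {Φ : F →ₗ[ℂ] F} (hΦ : IsCentralTrace Φ) {ε : ℝ} (hε : 0 < ε) :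
    ∃ ρ : F →ₗ[ℂ] A, (∀ x, IsSelfAdjoint x → IsSelfAdjoint (ρ x)) ∧
      (∀ x, ‖φ x - ρ x‖ ≤ ‖x‖ * (2 * ε)) ∧ (∀ x, ‖ρ x‖ ≤ ‖φ x‖) ∧
      (∀ x y, Commute x y → Commute (ρ x) (ρ y)) ∧
      ∀ T, IsSelfAdjoint T → ∀ s : selfAdjoint A, (s : A) = ρ (T - Φ T) →
        (s : A) ∈ closedCommutatorSpan A ∧
        ∃ V ∈ unitaryZeroOfNonUnital A, ∃ W ∈ unitaryZeroOfNonUnital A,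
          expUnitization s = V * W * V⁻¹ * W⁻¹ := by
  have hp : 0 ≤ φ 1 := by
    have := OrderHomClass.mono φ (zero_le_one (α := F))
    rwa [map_zero] at this
  obtain ⟨r, q, hr, hq, hrqp, hr1, hrp, hrq, hcomm⟩ := exists_cutoff hp hε
  have hrφ : ∀ x, Commute r (φ x) := fun x => (hcomm _ (hφ.commute_one x)).1
  have hqφ : ∀ x, Commute q (φ x) := fun x => (hcomm _ (hφ.commute_one x)).2
  let ρ : F →ₗ[ℂ] A := LinearMap.mulLeft ℂ r ∘ₗ φ.toLinearMap
  have hρ : ∀ x, ρ x = r * φ x := fun x => rfl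
  have hstar : ∀ x, star (ρ x) = ρ (star x) := by
    intro x
    rw [hρ, hρ, star_mul, hr.star_eq, ← map_star, (hrφ _).eq]
  have hsa : ∀ x, IsSelfAdjoint x → IsSelfAdjoint (ρ x) := fun x hx => by
    rw [IsSelfAdjoint, hstar, hx.star_eq]
  have hmul : ∀ x y, ρ x * ρ y = r * r * φ 1 * φ (x * y) := by
    intro x y
    calc r * φ x * (r * φ y) = r * (φ x * r) * φ y := by simp only [mul_assoc]
      _ = r * r * (φ x * φ y) := by rw [← (hrφ x).eq]; simp only [mul_assoc]
      _ = _ := by rw [hφ.map_mul, ← mul_assoc]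
  have hcommute : ∀ x y, Commute x y → Commute (ρ x) (ρ y) := fun x y hxy => by
    rw [Commute, SemiconjBy, hmul, hmul, hxy.eq]
  refine ⟨ρ, hsa, ?_, ?_, hcommute, ?_⟩
  · intro x
    exact (hφ.norm_sub_mul_map_le hr hrφ x).trans (mul_le_mul_of_nonneg_left hrp (norm_nonneg _))
  · intro x
    exact (norm_mul_le _ _).trans (mul_le_of_le_one_left (norm_nonneg _) hr1)
  intro T hT s hs
  obtain ⟨K, S, E, hS, hE, hEc, hTE, hSc⟩ := exists_central_add_conjugate_difference hT
  set w : F := (expUnitary K : F) with hw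
  have hΦT : T - Φ T = S - w * S * star w := by
    have h1 : Φ (w * S * star w) = Φ S := by
      rw [hΦ.trace, ← mul_assoc, hw, Unitary.star_mul_self_of_mem (expUnitary K).2, one_mul]
    have h2 : Φ T = E := by
      rw [hTE, map_add, map_sub, h1, sub_self, add_zero, hΦ.apply_central E hEc]
    rw [h2, sub_eq_iff_eq_add', ← hTE]
  have hS' : IsSelfAdjoint (w * S * star w) := hS.conjugate w
  have hqK : IsSelfAdjoint (q * φ K) := by
    rw [IsSelfAdjoint, star_mul, hq.star_eq, ← map_star, K.2.star_eq, (hqφ _).eq]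
  -- On the range of `ρ`, multiplication by `q * φ K` acts like `K` in `F`, since `r * q * φ 1 = r`;
  -- thus `W` acts like `w`.
  set W := expUnitization ⟨q * φ K, hqK⟩ with hW
  have hWcoe : (W : Unitization ℂ A)
      = NormedSpace.exp (Complex.I • ((q * φ K : A) : Unitization ℂ A)) := rfl
  have hleft : ∀ z, (W : Unitization ℂ A) * (ρ z : Unitization ℂ A) = (ρ (w * z) : A) := by
    intro z
    rw [hWcoe, hw, expUnitary_coe]
    refine exp_mul_map ρ (fun z => ?_) z
    rw [smul_mul_assoc, ← Unitization.inr_mul, smul_mul_assoc, map_smul, Unitization.inr_smul]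
    congr 2
    calc q * φ K * (r * φ z) = q * (φ K * r) * φ z := by simp only [mul_assoc]
      _ = (q * r) * (φ K * φ z) := by rw [← (hrφ K).eq]; simp only [mul_assoc]
      _ = r * q * φ 1 * φ (K * z) := by rw [hφ.map_mul, ← hrq.eq]; simp only [mul_assoc]
      _ = r * φ (K * z) := by rw [hrqp]
  have hconj : ((ρ (w * S * star w) : A) : Unitization ℂ A)
      = W * (ρ S : Unitization ℂ A) * star (W : Unitization ℂ A) := by
    rw [hleft, ← star_inj, star_mul, star_star, ← Unitization.inr_star, ← Unitization.inr_star,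
      hstar, hstar, hleft, star_mul (w * S), star_star]
  have hs' : (s : A) = ρ S - ρ (w * S * star w) := by rw [hs, hΦT, map_sub]
  refine ⟨?_, expUnitization ⟨ρ S, hsa S hS⟩, expUnitization_mem _, W, expUnitization_mem _, ?_⟩
  · have h1 : unitizationTrace A ((ρ (w * S * star w) : A) : Unitization ℂ A)
        = unitizationTrace A (ρ S : Unitization ℂ A) := by
      rw [hconj, unitizationTrace_mul_comm, ← mul_assoc, Unitary.star_mul_self_of_mem W.2, one_mul]
    rw [← Submodule.Quotient.mk_eq_zero, hs', Submodule.Quotient.mk_sub, sub_eq_zero]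
    exact h1.symm
  · have e : inrSelfAdjoint s
        = inrSelfAdjoint ⟨ρ S, hsa S hS⟩ + inrSelfAdjoint (-⟨_, hsa _ hS'⟩) := by
      refine Subtype.ext ?_
      change ((s : A) : Unitization ℂ A)
        = (ρ S : Unitization ℂ A) + ((-ρ (w * S * star w) : A) : Unitization ℂ A)
      rw [← Unitization.inr_add, ← sub_eq_add_neg, hs']
    have h1 : expUnitary (inrSelfAdjoint (-⟨_, hsa _ hS'⟩))
        = W * expUnitary (-inrSelfAdjoint ⟨ρ S, hsa S hS⟩) * W⁻¹ := by
      refine expUnitary_conj W ?_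
      change ((-ρ (w * S * star w) : A) : Unitization ℂ A)
        = W * (-(ρ S : Unitization ℂ A)) * star (W : Unitization ℂ A)
      rw [Unitization.inr_neg, hconj, mul_neg, neg_mul]
    have hc : Commute (ρ S : Unitization ℂ A) ((-ρ (w * S * star w) : A) : Unitization ℂ A) := by
      have := (hcommute _ _ hSc).neg_right
      rw [Commute, SemiconjBy, ← Unitization.inr_mul, ← Unitization.inr_mul, this.eq]
    rw [expUnitization_eq, e, Commute.expUnitary_add hc, h1, expUnitary_neg_eq_inv,
      ← expUnitization_eq]
    simp only [mul_assoc]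

end Rotation

/-! ### Products of commutators in a group -/

section Group

variable {G : Type*} [Group G]

/-- `g` is a product of `n` multiplicative commutators of elements of the subgroup `H`. -/
def IsCommutatorProduct (H : Subgroup G) (n : ℕ) (g : G) : Prop :=
  ∃ v w : Fin n → G, (∀ j, v j ∈ H) ∧ (∀ j, w j ∈ H) ∧
    g = (List.ofFn fun j => v j * w j * (v j)⁻¹ * (w j)⁻¹).prod

variable {H : Subgroup G} {m n : ℕ} {g g' : G}

theorem isCommutatorProduct_one (n : ℕ) : IsCommutatorProduct H n 1 :=
  ⟨1, 1, fun _ => H.one_mem, fun _ => H.one_mem, by simp⟩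

theorem isCommutatorProduct_commutator {v w : G} (hv : v ∈ H) (hw : w ∈ H) :
    IsCommutatorProduct H 1 (v * w * v⁻¹ * w⁻¹) :=
  ⟨fun _ => v, fun _ => w, fun _ => hv, fun _ => hw, by simp⟩

theorem IsCommutatorProduct.mul (h : IsCommutatorProduct H m g)
    (h' : IsCommutatorProduct H n g') : IsCommutatorProduct H (m + n) (g * g') := by
  obtain ⟨v, w, hv, hw, rfl⟩ := h
  obtain ⟨v', w', hv', hw', rfl⟩ := h'
  refine ⟨Fin.append v v', Fin.append w w', fun j => ?_, fun j => ?_, ?_⟩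
  · refine Fin.addCases (fun i => ?_) (fun i => ?_) j
    · rw [Fin.append_left]; exact hv i
    · rw [Fin.append_right]; exact hv' i
  · refine Fin.addCases (fun i => ?_) (fun i => ?_) j
    · rw [Fin.append_left]; exact hw i
    · rw [Fin.append_right]; exact hw' i
  · rw [← List.prod_append, ← List.ofFn_fin_append]
    congr 2
    ext j
    refine Fin.addCases (fun i => ?_) (fun i => ?_) j <;> simp

theorem IsCommutatorProduct.mono (h : IsCommutatorProduct H m g) (hmn : m ≤ n) :
    IsCommutatorProduct H n g := by
  obtain ⟨d, rfl⟩ := Nat.exists_eq_add_of_le hmn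
  simpa using h.mul (isCommutatorProduct_one d)

theorem IsCommutatorProduct.conj (h : IsCommutatorProduct H n g) {x : G} (hx : x ∈ H) :
    IsCommutatorProduct H n (x * g * x⁻¹) := by
  obtain ⟨v, w, hv, hw, rfl⟩ := h
  refine ⟨fun j => x * v j * x⁻¹, fun j => x * w j * x⁻¹,
    fun j => H.mul_mem (H.mul_mem hx (hv j)) (H.inv_mem hx),
    fun j => H.mul_mem (H.mul_mem hx (hw j)) (H.inv_mem hx), ?_⟩
  rw [← MulAut.conj_apply, map_list_prod, List.map_ofFn]
  congr 2
  ext j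
  simp only [Function.comp_apply, MulAut.conj_apply]
  group

theorem isCommutatorProduct_prod {J : Type*} (L : List J) {x : J → G}
    (h : ∀ j, IsCommutatorProduct H 1 (x j)) :
    IsCommutatorProduct H L.length (L.map x).prod := by
  induction L with
  | nil => exact isCommutatorProduct_one 0
  | cons a L ih =>
    rw [List.map_cons, List.prod_cons, List.length_cons, add_comm]
    exact (h a).mul ih

/-- Sorting a product of `k` products of two factors costs `k - 1` commutators. -/
theorem exists_prod_mul_eq {J : Type*} (L : List J) (hL : L ≠ []) {x y : J → G}
    (hx : ∀ j, x j ∈ H) (hy : ∀ j, y j ∈ H) :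
    ∃ c, IsCommutatorProduct H (L.length - 1) c ∧
      (L.map fun j => x j * y j).prod = c * ((L.map x).prod * (L.map y).prod) := by
  induction L with
  | nil => exact absurd rfl hL
  | cons a L ih =>
    rcases eq_or_ne L [] with rfl | hL'
    · exact ⟨1, isCommutatorProduct_one _, by simp⟩
    obtain ⟨c, hc, hprod⟩ := ih hL'
    have hP : (L.map x).prod ∈ H := H.list_prod_mem fun z hz => by
      obtain ⟨j, -, rfl⟩ := List.mem_map.mp hz
      exact hx j
    -- With `P` and `Q` the products over the tail, moving `P` past `y a` costs the commutator of
    -- `y a` and `P`, conjugated by `x a`.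
    refine ⟨(x a * y a) * c * (x a * y a)⁻¹ * (x a * (y a * (L.map x).prod * (y a)⁻¹
      * ((L.map x).prod)⁻¹) * (x a)⁻¹), ?_, ?_⟩
    · have h1 := (hc.conj (H.mul_mem (hx a) (hy a))).mul
        ((isCommutatorProduct_commutator (hy a) hP).conj (hx a))
      have : L.length - 1 + 1 = (a :: L).length - 1 := by
        have := List.length_pos_iff.mpr hL'
        simp only [List.length_cons]
        omega
      rwa [this] at h1
    · rw [List.map_cons, List.prod_cons, hprod, List.map_cons, List.prod_cons, List.map_cons,
        List.prod_cons]
      group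

theorem prod_map_mul_of_commute {J : Type*} (L : List J) {x y : J → G}
    (h : ∀ i j, Commute (y i) (x j)) :
    (L.map fun j => x j * y j).prod = (L.map x).prod * (L.map y).prod := by
  induction L with
  | nil => simp
  | cons a L ih =>
    have hc : Commute (y a) (L.map x).prod := Commute.list_prod_right _ _ fun z hz => by
      obtain ⟨j, -, rfl⟩ := List.mem_map.mp hz
      exact h a j
    simp only [List.map_cons, List.prod_cons, ih]
    rw [mul_assoc, ← mul_assoc (y a), hc.eq]
    simp only [mul_assoc]

end Group

/-! ### Products of commuting or nearly commuting exponentials -/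

section Exponentials

variable {B : Type*} [CStarAlgebra B]

theorem prod_map_expUnitary {J : Type*} (L : List J) {y : J → selfAdjoint B}
    (h : ∀ i j, Commute (y i : B) (y j : B)) :
    (L.map fun j => expUnitary (y j)).prod = expUnitary (L.map y).sum := by
  induction L with
  | nil => simp
  | cons a L ih =>
    rw [List.map_cons, List.prod_cons, ih, List.map_cons, List.sum_cons, Commute.expUnitary_add]
    have e : ((L.map y).sum : B) = (L.map fun j => (y j : B)).sum := by
      clear ih
      induction L with
      | nil => simp
      | cons a L ih => simp [← ih]
    rw [e]
    exact Commute.list_sum_right _ _ fun z hz => by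
      obtain ⟨j, -, rfl⟩ := List.mem_map.mp hz
      exact h a j

theorem expProd_quadruple {a b c d : selfAdjoint B} (hab : Commute (a : B) b)
    (hcd : Commute (c : B) d) (t : ℝ) :
    expProd [a, b, c, d] t = expUnitary (t • (a + b)) * expUnitary (t • (c + d)) := by
  rw [smul_add, smul_add, Commute.expUnitary_add, Commute.expUnitary_add]
  · simp [expProd, mul_assoc]
  · rw [selfAdjoint.val_smul, selfAdjoint.val_smul]
    exact (hcd.smul_left t).smul_right t
  · rw [selfAdjoint.val_smul, selfAdjoint.val_smul]
    exact (hab.smul_left t).smul_right t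

theorem expProd_flatMap {J : Type*} (L : List J) (g : J → List (selfAdjoint B)) (t : ℝ) :
    expProd (L.flatMap g) t = (L.map fun j => expProd (g j) t).prod := by
  induction L with
  | nil => simp [expProd]
  | cons a L ih => rw [List.flatMap_cons, expProd_append, ih, List.map_cons, List.prod_cons]

theorem norm_expUnitary_smul_sub_mul_le (h a b a' b' : selfAdjoint B) {t : ℝ} (ht : |t| ≤ 2) :
    ‖(expUnitary (t • h) : B) - (expUnitary (t • a') * expUnitary (t • b') : unitary B)‖
      ≤ 2 * ‖(h : B) - (a + b)‖ + 4 * ‖(a : B) * b - b * a‖ + 2 * ‖(a : B) - a'‖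
        + 2 * ‖(b : B) - b'‖ := by
  have h1 := norm_expUnitary_sub_mul_le (t • h) (t • a) (t • b)
  have h2 := norm_mul_unitary_sub_mul_le (expUnitary (t • a)) (expUnitary (t • b))
    (expUnitary (t • a')) (expUnitary (t • b'))
  have hs : ∀ x y : selfAdjoint B,
      ‖(expUnitary (t • x) : B) - expUnitary (t • y)‖ ≤ 2 * ‖(x : B) - y‖ := by
    intro x y
    refine (norm_expUnitary_sub_le _ _).trans ?_
    rw [selfAdjoint.val_smul, selfAdjoint.val_smul, ← smul_sub, norm_smul]
    exact mul_le_mul_of_nonneg_right ht (norm_nonneg _)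
  have h3 : ‖((t • h : selfAdjoint B) : B) - ((t • a : selfAdjoint B) + (t • b : selfAdjoint B))‖
      ≤ 2 * ‖(h : B) - (a + b)‖ := by
    rw [selfAdjoint.val_smul, selfAdjoint.val_smul, selfAdjoint.val_smul, ← smul_add, ← smul_sub,
      norm_smul]
    exact mul_le_mul_of_nonneg_right ht (norm_nonneg _)
  have h4 : ‖((t • a : selfAdjoint B) : B) * (t • b : selfAdjoint B)
      - (t • b : selfAdjoint B) * (t • a : selfAdjoint B)‖ ≤ 4 * ‖(a : B) * b - b * a‖ := by
    rw [selfAdjoint.val_smul, selfAdjoint.val_smul, smul_mul_smul_comm, smul_mul_smul_comm,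
      ← smul_sub, norm_smul, norm_mul, Real.norm_eq_abs]
    refine mul_le_mul_of_nonneg_right ?_ (norm_nonneg _)
    nlinarith [abs_nonneg t]
  have h5 := norm_sub_le_norm_sub_add_norm_sub (expUnitary (t • h) : B)
    (expUnitary (t • a) * expUnitary (t • b) : unitary B)
    (expUnitary (t • a') * expUnitary (t • b') : unitary B)
  rw [← Submonoid.coe_mul] at h1
  linarith [hs a a', hs b b']

end Exponentials

/-! ### Decomposition of the exponents -/

section Color

variable {A : Type*} [NonUnitalCStarAlgebra A] [PartialOrder A] [StarOrderedRing A]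
variable {F : Type*} [CStarAlgebra F] [FiniteDimensional ℂ F] [PartialOrder F] [StarOrderedRing F]

/-- Up to a small error, the images under an order zero map of elements whose central traces nearly
sum to zero split into a part whose exponential is a commutator, and a part that commutes with
both parts and sums to zero. -/
theorem IsOrderZero.exists_color_decomposition {φ : F →CP A} (hφ : IsOrderZero φ)
    {Φ : F →ₗ[ℂ] F} (hΦ : IsCentralTrace Φ) {k : ℕ} (hk : 1 ≤ k) {b : Fin k → F}
    (hb : ∀ j, IsSelfAdjoint (b j)) {ν η : ℝ} (hν : ‖φ (Φ (∑ j, b j))‖ ≤ ν) (hη : 0 < η) :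
    ∃ x y : Fin k → selfAdjoint A, (∀ j, (x j : A) ∈ closedCommutatorSpan A) ∧
      ∑ j, y j = 0 ∧ (∀ i j, Commute (y i : A) (x j : A)) ∧
      (∀ i j, Commute (y i : A) (y j : A)) ∧
      (∀ j, IsCommutatorProduct (unitaryZeroOfNonUnital A) 1 (expUnitization (x j))) ∧
      ∀ j, ‖φ (b j) - ((x j : A) + y j)‖ ≤ ν + η := by
  have hM : 0 ≤ ∑ j, ‖b j‖ := Finset.sum_nonneg fun j _ => norm_nonneg _
  obtain ⟨ρ, hsa, hφρ, hρφ, hcomm, hmodel⟩ := hφ.exists_commutator_model hΦ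
    (ε := η / (2 * (∑ j, ‖b j‖ + 1))) (by positivity)
  set E : F := Φ (∑ j, b j) with hE
  have hEsa : IsSelfAdjoint E := hΦ.isSelfAdjoint (isSelfAdjoint_sum _ fun j _ => hb j)
  have hk0 : (k : ℝ) ≠ 0 := by positivity
  have hΦb : ∀ j, IsSelfAdjoint (Φ (b j)) := fun j => hΦ.isSelfAdjoint (hb j)
  have hxsa : ∀ j, IsSelfAdjoint (ρ (b j - Φ (b j))) := fun j => hsa _ ((hb j).sub (hΦb j))
  have hkE : IsSelfAdjoint ((k : ℝ)⁻¹ • E) := (IsSelfAdjoint.all _).smul hEsa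
  have hysa : ∀ j, IsSelfAdjoint (ρ (Φ (b j) - (k : ℝ)⁻¹ • E)) := fun j => hsa _ ((hΦb j).sub hkE)
  have hcentral : ∀ j z, Commute (Φ (b j) - (k : ℝ)⁻¹ • E) z := fun j z =>
    (hΦ.commute _ _).sub_left ((hΦ.commute _ _).smul_left _)
  -- `b j - Φ (b j)` has trace zero, the elements `Φ (b j) - E / k` are central with sum zero, and
  -- the remainder `E / k` is small in `A`.
  refine ⟨fun j => ⟨_, hxsa j⟩, fun j => ⟨_, hysa j⟩,
    fun j => ((hmodel _ (hb j)) ⟨_, hxsa j⟩ rfl).1, ?_, fun i j => hcomm _ _ (hcentral i _),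
    fun i j => hcomm _ _ (hcentral i _), fun j => ?_, fun j => ?_⟩
  · refine Subtype.ext ?_
    rw [AddSubgroup.val_finsetSum]
    change ∑ j, ρ (Φ (b j) - (k : ℝ)⁻¹ • E) = 0
    rw [← map_sum, Finset.sum_sub_distrib, ← map_sum, Finset.sum_const, Finset.card_univ,
      Fintype.card_fin, ← Nat.cast_smul_eq_nsmul ℝ, smul_smul, mul_inv_cancel₀ hk0, one_smul,
      sub_self, map_zero]
  · obtain ⟨V, hV, W, hW, e⟩ := ((hmodel _ (hb j)) ⟨_, hxsa j⟩ rfl).2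
    rw [e]
    exact isCommutatorProduct_commutator hV hW
  · change ‖φ (b j) - (ρ (b j - Φ (b j)) + ρ (Φ (b j) - (k : ℝ)⁻¹ • E))‖ ≤ ν + η
    have e : φ (b j) - (ρ (b j - Φ (b j)) + ρ (Φ (b j) - (k : ℝ)⁻¹ • E))
        = ρ (((k : ℝ)⁻¹ : ℂ) • E) + (φ (b j) - ρ (b j)) := by
      rw [← map_add, sub_add_sub_cancel, map_sub, ← Complex.ofReal_inv, Complex.coe_smul]
      abel
    rw [e]
    refine (norm_add_le _ _).trans (add_le_add ?_ ((hφρ _).trans ?_))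
    · rw [map_smul, norm_smul]
      refine (mul_le_of_le_one_left (norm_nonneg _) ?_).trans ((hρφ _).trans hν)
      rw [norm_inv, Complex.norm_real, Real.norm_natCast]
      exact inv_le_one_of_one_le₀ (by exact_mod_cast hk)
    · have h1 : ‖b j‖ ≤ ∑ j, ‖b j‖ :=
        Finset.single_le_sum (f := fun j => ‖b j‖) (fun j _ => norm_nonneg _) (Finset.mem_univ j)
      have h2 : 2 * (η / (2 * (∑ j, ‖b j‖ + 1))) = η / (∑ j, ‖b j‖ + 1) := by
        field_simp
      rw [h2, mul_div_assoc', div_le_iff₀ (by positivity)]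
      nlinarith

end Color

/-! ### Products of exponentials as products of commutators -/

section NonUnital

variable {A : Type*} [NonUnitalCStarAlgebra A]

theorem coe_sum_map_flatMap_quadruple {J : Type*} (L : List J) (x y x' y' : J → selfAdjoint A) :
    ((L.flatMap fun j => [x j, y j, x' j, y' j]).map fun z : selfAdjoint A => (z : A)).sum
      = (L.map fun j => (x j : A) + y j + (x' j + y' j)).sum := by
  induction L with
  | nil => rfl
  | cons a L ih =>
    rw [List.flatMap_cons, List.map_append, List.sum_append, ih, List.map_cons, List.sum_cons]
    simp only [List.map_cons, List.map_nil, List.sum_cons, List.sum_nil]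
    abel

theorem inrSelfAdjoint_add (x y : selfAdjoint A) :
    inrSelfAdjoint (x + y) = inrSelfAdjoint x + inrSelfAdjoint y :=
  Subtype.ext (Unitization.inr_add ℂ _ _)

/-- The result for algebras that need not have a unit, with the unitaries in the unitization. In
fact `3 * k - 1` commutators suffice. -/
theorem exists_commutator_product [PartialOrder A] [StarOrderedRing A] {k : ℕ} (hk : 1 ≤ k)
    (hA : NuclearDimensionAtMost 1 A)
    (h : Fin k → selfAdjoint A) (hh : TrEquiv (∑ j, (h j : A)) 0) {ε : ℝ} (hε : 0 < ε) :
    ∃ (g : unitary (Unitization ℂ A)) (c : selfAdjoint A),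
      IsCommutatorProduct (unitaryZeroOfNonUnital A) (5 * k - 1) g ∧
      (List.ofFn fun j => expUnitization (h j)).prod = g * expUnitization c ∧
      TrEquiv (c : A) 0 ∧ ‖(c : A)‖ < ε := by
  classical
  have hk0 : (0 : ℝ) < k := by exact_mod_cast hk
  set δ : ℝ := min (1 / 2) (ε / 4) with hδ
  have hδ0 : 0 < δ := lt_min (by norm_num) (by positivity)
  -- Each of the `k` factors will be approximated to within `14 * ν`.
  set ν : ℝ := δ / k / 14 with hν
  have hν0 : 0 < ν := by positivity
  rw [trEquiv_iff, sub_zero] at hh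
  obtain ⟨F, _, _, _, _, ψ, φ, -, -, hφ, happrox, htr⟩ := exists_tracial_approximation hA
    (Finset.univ.image fun j => (h j : A)) (isSelfAdjoint_sum _ fun j _ => (h j).2) hh hν0
  have hψsa : ∀ i j, IsSelfAdjoint (ψ i (h j)) := fun i j => by
    rw [IsSelfAdjoint, ← map_star, (h j).2.star_eq]
  have hφsa : ∀ i j, IsSelfAdjoint (φ i (ψ i (h j))) := fun i j => by
    rw [IsSelfAdjoint, ← map_star, (hψsa i j).star_eq]
  have hcolor : ∀ i, ∃ x y : Fin k → selfAdjoint A, (∀ j, (x j : A) ∈ closedCommutatorSpan A) ∧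
      ∑ j, y j = 0 ∧ (∀ i j, Commute (y i : A) (x j : A)) ∧
      (∀ i j, Commute (y i : A) (y j : A)) ∧
      (∀ j, IsCommutatorProduct (unitaryZeroOfNonUnital A) 1 (expUnitization (x j))) ∧
      ∀ j, ‖φ i (ψ i (h j)) - ((x j : A) + y j)‖ ≤ ν + ν := by
    intro i
    obtain ⟨Φ, hΦ⟩ := exists_central_trace (F i)
    have := htr i Φ hΦ
    rw [map_sum] at this
    exact (hφ i).exists_color_decomposition hΦ hk (hψsa i) this hν0
  choose x y hx hy hyx hyy hxc hxy using hcolor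
  have hxyc : ∀ i j, Commute (inrSelfAdjoint (x i j) : Unitization ℂ A)
      (inrSelfAdjoint (y i j) : Unitization ℂ A) := by
    intro i j
    change (x i j : Unitization ℂ A) * (y i j : Unitization ℂ A)
      = (y i j : Unitization ℂ A) * (x i j : Unitization ℂ A)
    rw [← Unitization.inr_mul, ← Unitization.inr_mul, (hyx i j j).eq]
  set g : Fin k → List (selfAdjoint A) := fun j => [x 0 j, y 0 j, x 1 j, y 1 j] with hg
  have hgt : ∀ (j : Fin k) (t : ℝ), expProd ((g j).map inrSelfAdjoint) t
      = expUnitary (t • inrSelfAdjoint (x 0 j + y 0 j))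
        * expUnitary (t • inrSelfAdjoint (x 1 j + y 1 j)) := by
    intro j t
    rw [inrSelfAdjoint_add, inrSelfAdjoint_add]
    exact expProd_quadruple (hxyc 0 j) (hxyc 1 j) t
  obtain ⟨c, hc, hctr, hcn⟩ := exists_expUnitization_of_norm_sub_le
    ((List.finRange k).map h) ((List.finRange k).flatMap g) (δ := δ)
    ((min_le_left _ _).trans_lt (by norm_num)) (by
      intro t ht
      have ht2 : |t| ≤ 2 := abs_le.mpr ⟨by linarith [ht.1], ht.2.le⟩
      rw [List.map_flatMap, expProd_flatMap, expProd, List.map_map, List.map_map]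
      refine (norm_prod_unitary_sub_le (η := δ / k) _ _ _ fun j => ?_).trans ?_
      · rw [hgt]
        have h1 := norm_expUnitary_smul_sub_mul_le (inrSelfAdjoint (h j))
          (inrSelfAdjoint ⟨_, hφsa 0 j⟩) (inrSelfAdjoint ⟨_, hφsa 1 j⟩)
          (inrSelfAdjoint (x 0 j + y 0 j)) (inrSelfAdjoint (x 1 j + y 1 j)) ht2
        refine h1.trans ?_
        obtain ⟨h2, h3⟩ := happrox (h j) (Finset.mem_image_of_mem _ (Finset.mem_univ j))
        rw [← Unitization.norm_inr (𝕜 := ℂ), Unitization.inr_sub, Unitization.inr_add] at h2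
        rw [← Unitization.norm_inr (𝕜 := ℂ), Unitization.inr_sub, Unitization.inr_mul,
          Unitization.inr_mul] at h3
        have h4 := hxy 0 j
        have h5 := hxy 1 j
        rw [← Unitization.norm_inr (𝕜 := ℂ), Unitization.inr_sub] at h4 h5
        have h6 : δ / k = 14 * ν := by rw [hν]; ring
        rw [h6]
        have h7 : 2 * ν + 4 * ν + 2 * (ν + ν) + 2 * (ν + ν) = 14 * ν := by ring
        rw [← h7]
        exact add_le_add (add_le_add (add_le_add (by gcongr; exact h2) (by gcongr; exact h3))
          (by gcongr; exact h4)) (by gcongr; exact h5)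
      · rw [List.length_finRange, mul_div_cancel₀ _ hk0.ne'])
  refine ⟨expProd (((List.finRange k).flatMap g).map inrSelfAdjoint) 1, c, ?_, ?_, ?_, ?_⟩
  · have hprod : expProd (((List.finRange k).flatMap g).map inrSelfAdjoint) 1
        = ((List.finRange k).map fun j => (expUnitization (x 0 j) * expUnitization (y 0 j))
          * (expUnitization (x 1 j) * expUnitization (y 1 j))).prod := by
      rw [List.map_flatMap, expProd_flatMap]
      congr 2
      ext1 j
      rw [expProd_one]
      simp only [hg, List.map_cons, List.map_nil, List.prod_cons, List.prod_nil, mul_one, mul_assoc]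
      rfl
    -- For each colour, the `k` commutators remain once the commuting factors have cancelled.
    have hone : ∀ i, IsCommutatorProduct (unitaryZeroOfNonUnital A) k
        ((List.finRange k).map fun j => expUnitization (x i j) * expUnitization (y i j)).prod := by
      intro i
      rw [prod_map_mul_of_commute]
      · have h1 : ((List.finRange k).map fun j => expUnitization (y i j)).prod = 1 := by
          have h2 := prod_map_expUnitary (List.finRange k)
            (y := fun j => inrSelfAdjoint (y i j)) (by
            intro j j'
            change (y i j : Unitization ℂ A) * (y i j' : Unitization ℂ A)
              = (y i j' : Unitization ℂ A) * (y i j : Unitization ℂ A)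
            rw [← Unitization.inr_mul, ← Unitization.inr_mul, (hyy i j j').eq])
          refine h2.trans ?_
          rw [← Fin.sum_univ_def]
          have h3 : ∑ j, inrSelfAdjoint (y i j) = 0 := by
            refine Subtype.ext ?_
            rw [AddSubgroup.val_finsetSum]
            have h4 := congrArg (fun z : selfAdjoint A => (Unitization.inrHom ℂ ℂ A) (z : A)) (hy i)
            simp only [AddSubgroup.val_finsetSum, map_sum] at h4
            exact h4.trans (map_zero _)
          rw [h3, expUnitary_zero]
        rw [h1, mul_one]
        simpa using isCommutatorProduct_prod (List.finRange k) (hxc i)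
      · intro j j'
        refine Commute.expUnitary ?_
        change (y i j : Unitization ℂ A) * (x i j' : Unitization ℂ A)
          = (x i j' : Unitization ℂ A) * (y i j : Unitization ℂ A)
        rw [← Unitization.inr_mul, ← Unitization.inr_mul, (hyx i j j').eq]
    have hmem : ∀ i j, expUnitization (x i j) * expUnitization (y i j)
        ∈ unitaryZeroOfNonUnital A := fun i j =>
      mul_mem (expUnitization_mem _) (expUnitization_mem _)
    obtain ⟨d, hd, he⟩ := exists_prod_mul_eq (List.finRange k) (by
      rw [← List.length_pos_iff, List.length_finRange]; exact hk) (hmem 0) (hmem 1)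
    -- There are `(k - 1) + (k + k)` commutators, and the rest of the `5 * k - 1` are trivial.
    rw [hprod, he]
    refine (hd.mul ((hone 0).mul (hone 1))).mono ?_
    rw [List.length_finRange]
    omega
  · rw [List.ofFn_eq_map, ← hc, expProd_one, List.map_map, List.map_map]
    rfl
  · rw [trEquiv_iff] at hctr ⊢
    have h1 : (((List.finRange k).map h).map fun z : selfAdjoint A => (z : A)).sum
        ∈ closedCommutatorSpan A := by
      rw [List.map_map]
      rw [Fin.sum_univ_def] at hh
      exact hh
    have h2 : (((List.finRange k).flatMap g).map fun z : selfAdjoint A => (z : A)).sum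
        ∈ closedCommutatorSpan A := by
      have hy' : ∀ i, ∑ j, (y i j : A) = 0 := fun i => by
        rw [← AddSubgroup.val_finsetSum, hy]; rfl
      rw [coe_sum_map_flatMap_quadruple, ← Fin.sum_univ_def, Finset.sum_add_distrib,
        Finset.sum_add_distrib, Finset.sum_add_distrib, hy', hy', add_zero, add_zero]
      exact add_mem (sum_mem fun j _ => hx 0 j) (sum_mem fun j _ => hx 1 j)
    have h3 := add_mem hctr (sub_mem h1 h2)
    rwa [sub_add_cancel, ← sub_zero (c : A)] at h3
  · refine hcn.trans_lt ?_
    have := min_le_right (1 / 2) (ε / 4)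
    linarith

end NonUnital

/-! ### Passage to unital algebras -/

theorem IsCommutatorProduct.map {G G' : Type*} [Group G] [Group G'] {H : Subgroup G}
    {H' : Subgroup G'} {n : ℕ} {g : G} (h : IsCommutatorProduct H n g) (f : G →* G')
    (hf : ∀ x ∈ H, f x ∈ H') : IsCommutatorProduct H' n (f g) := by
  obtain ⟨v, w, hv, hw, rfl⟩ := h
  refine ⟨fun j => f (v j), fun j => f (w j), fun j => hf _ (hv j), fun j => hf _ (hw j), ?_⟩
  rw [map_list_prod, List.map_ofFn]
  congr 2
  ext j
  simp

section Unital

variable (A : Type*) [CStarAlgebra A]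

/-- For unital `A`, the star homomorphism from the unitization of `A` to `A` that restricts to the
identity on `A`. -/
noncomputable def unitizationFold : Unitization ℂ A →⋆ₐ[ℂ] A :=
  Unitization.starLift (NonUnitalStarAlgHom.id ℂ A)

variable {A}

theorem unitizationFold_inr (a : A) : unitizationFold A (a : Unitization ℂ A) = a :=
  DFunLike.congr_fun (Unitization.starLift.symm_apply_apply (NonUnitalStarAlgHom.id ℂ A)) a

theorem continuous_unitizationFold : Continuous (unitizationFold A) :=
  map_continuous (unitizationFold A)

/-- The homomorphism of unitary groups induced by the retraction of the unitization onto a unital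
algebra. -/
noncomputable def unitaryFold (A : Type*) [CStarAlgebra A] :
    unitary (Unitization ℂ A) →* unitary A :=
  (Unitary.map ({ (unitizationFold A : Unitization ℂ A →* A) with
    map_star' := map_star (unitizationFold A) } : Unitization ℂ A →⋆* A)).toMonoidHom

theorem unitaryFold_mem {u : unitary (Unitization ℂ A)} (hu : u ∈ unitaryZeroOfNonUnital A) :
    unitaryFold A u ∈ unitaryZero A := by
  have hc : Continuous (unitaryFold A) :=
    Continuous.subtype_mk (continuous_unitizationFold.comp continuous_subtype_val) _
  have h := hc.image_connectedComponent_subset 1 (Set.mem_image_of_mem _ hu.1)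
  rwa [map_one] at h

theorem unitaryFold_expUnitization (h : selfAdjoint A) :
    unitaryFold A (expUnitization h) = expUnitary h := by
  let +nondep : NormedAlgebra ℚ (Unitization ℂ A) := .restrictScalars ℚ ℂ _
  let +nondep : NormedAlgebra ℚ A := .restrictScalars ℚ ℂ _
  refine Subtype.ext ?_
  have h1 := NormedSpace.map_exp (unitizationFold A) continuous_unitizationFold
    (Complex.I • ((h : A) : Unitization ℂ A))
  rw [map_smul, unitizationFold_inr] at h1
  exact h1

end Unital

end CommutatorProducts

open CommutatorProducts in
/-- Products of `k` exponentials in a C*-algebra of nuclear dimension at most one: the first part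
is for unital algebras, the second for algebras without unit, where unitaries are taken in the
unitization. Products are ordered from left to right. -/
theorem mainTheorem8 :
    (∀ (A : Type*) [CStarAlgebra A] [PartialOrder A] [StarOrderedRing A],
      NuclearDimensionAtMost 1 A →
      ∀ (k : ℕ), 1 ≤ k → ∀ (h : Fin k → selfAdjoint A), TrEquiv (∑ j, (h j : A)) 0 →
      ∀ (u : unitary A), u ∈ unitaryZero A →
      u = (List.ofFn fun j => selfAdjoint.expUnitary (h j)).prod →
      ∀ ε : ℝ, 0 < ε →
      ∃ (v w : Fin (5 * k - 1) → unitary A) (c : selfAdjoint A),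
        (∀ j, v j ∈ unitaryZero A) ∧ (∀ j, w j ∈ unitaryZero A) ∧
        u = (List.ofFn fun j => v j * w j * (v j)⁻¹ * (w j)⁻¹).prod * selfAdjoint.expUnitary c ∧
        TrEquiv (c : A) 0 ∧ ‖(c : A)‖ < ε) ∧
    (∀ (A : Type*) [NonUnitalCStarAlgebra A] [PartialOrder A] [StarOrderedRing A],
      NuclearDimensionAtMost 1 A →
      ∀ (k : ℕ), 1 ≤ k → ∀ (h : Fin k → selfAdjoint A), TrEquiv (∑ j, (h j : A)) 0 →
      ∀ (u : unitary (Unitization ℂ A)), u ∈ unitaryZeroOfNonUnital A →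
      u = (List.ofFn fun j => expUnitization (h j)).prod →
      ∀ ε : ℝ, 0 < ε →
      ∃ (v w : Fin (5 * k - 1) → unitary (Unitization ℂ A)) (c : selfAdjoint A),
        (∀ j, v j ∈ unitaryZeroOfNonUnital A) ∧ (∀ j, w j ∈ unitaryZeroOfNonUnital A) ∧
        u = (List.ofFn fun j => v j * w j * (v j)⁻¹ * (w j)⁻¹).prod * expUnitization c ∧
        TrEquiv (c : A) 0 ∧ ‖(c : A)‖ < ε) := by
  refine ⟨fun A _ _ _ hA k hk h hh u _ hu ε hε => ?_, fun A _ _ _ hA k hk h hh u _ hu ε hε => ?_⟩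
  · obtain ⟨g, c, hg, he, hc, hcε⟩ := exists_commutator_product hk hA h hh hε
    obtain ⟨v, w, hv, hw, hgv⟩ := hg.map (unitaryFold A) fun _ => unitaryFold_mem
    refine ⟨v, w, c, hv, hw, ?_, hc, hcε⟩
    have h1 := congrArg (unitaryFold A) he
    rw [map_mul, map_list_prod, List.map_ofFn, unitaryFold_expUnitization, hgv] at h1
    rw [hu, ← h1]
    congr 2
    ext1 j
    exact (unitaryFold_expUnitization (h j)).symm
  · obtain ⟨g, c, ⟨v, w, hv, hw, hgv⟩, he, hc, hcε⟩ := exists_commutator_product hk hA h hh hε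
    exact ⟨v, w, c, hv, hw, by rw [hu, he, hgv], hc, hcε⟩
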